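/- Let $d\ge 2$, $N\in\mathbb N_0$, and let $\Lambda=A\mathbb Z^d$ be a Bravais lattice with $A\in\mathbb R^{d\times d}$ non-singular. Let $\mathcal R\subset\Lambda\setminus\{0\}$ be finite with $\mathcal R=-\mathcal R$ and $\operatorname{span}_{\mathbb Z}\mathcal R=\Lambda$. For $u:\Lambda\to\mathbb R^N$ and $\rho\in\Lambda$ put $D_\rho u(\ell)=u(\ell+\rho)-u(\ell)$, $Du(\ell)=(D_\rho u(\ell))_{\rho\in\mathcal R}$, and for $j\ge1$ let $D^ju(\ell)=(D_{\rho_1}\cdots D_{\rho_j}u(\ell))_{(\rho_1,\dots,\rho_j)\in\mathcal R^j}$, with Euclidean norm $|D^ju(\ell)|$. Let $V\in C^2(\mathbb R^{N\times\mathcal R};\mathbb R)$ satisfy $V(B)=V\big((-B_{-\rho})_{\rho\in\mathcal R}\big)$ for all $B$, and let $$H[u](\ell):=\sum_{\rho\in\mathcal R}D_{-\rho}\big(\nabla^2V(0)[Du]\big)_{\cdot\rho}(\ell)$$ be the linearised force. Assume lattice stability: there is $c_0>0$ such that $$\sum_{\ell\in\Lambda}\nabla^2V(0)[Du(\ell),Du(\ell)]\ge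 c_0\sum_{\ell\in\Lambda}|Du(\ell)|^2$$ for all $u:\Lambda\to\mathbb R^N$ for which $Du$ has bounded support. Write $|\ell|_0:=|\ell|+2$. Let $p,\alpha\in\mathbb N_0$ and $j\ge1$. Then there is a constant $C$, depending only on $d,N,A,\mathcal R,V,p,\alpha,j$, such that the following holds for every $K\in\mathbb R$ and every $u:\Lambda\to\mathbb R^N$ with $\sum_{\ell\in\Lambda}|Du(\ell)|^2<\infty$. Suppose that $$|H[u](\ell)|\le K\,|\ell|_0^{-d-p}\log^\alpha|\ell|_0\qquad\text{for all }\ell\in\Lambda,$$ that the moments $\mathcal I_i:=\sum_{\ell\in\Lambda}H[u](\ell)\otimes\ell^{\otimes i}$ vanish for $i=0,\dots,p-1$, and, if $j\ge3$, that in addition $$|D^mH[u](\ell)|\le K\,|\ell|_0^{-d-p-m}\log^\alpha|\ell|_0\qquad\text{for all }\ell\in\Lambda,\ m=1,\dots,j-2.$$ Then $$|D^ju(\ell)|\le C\,K\,|\ell|_0^{2-d-p-j}\log^{\alpha+1}|\ell|_0\qquad\text{for all }\ell\in\Lambda.$$ In particular, for $j=1,2$ no assumption on differences of $H[u]$ is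 needed. -/

import Mathlib

/-- The Bravais lattice `Λ = A ℤᵈ` as a subgroup of Euclidean space `ℝᵈ`. -/
def bravaisLattice {d : ℕ} (A : Matrix (Fin d) (Fin d) ℝ) :
    AddSubgroup (EuclideanSpace ℝ (Fin d)) where
  carrier := {x | ∃ k : Fin d → ℤ, x = WithLp.toLp 2 (A.mulVec fun i => (k i : ℝ))}
  zero_mem' := ⟨0, by
    have h : (fun i : Fin d => (((0 : Fin d → ℤ) i : ℤ) : ℝ)) = 0 := by ext i; simp
    rw [h, Matrix.mulVec_zero]; rfl⟩
  add_mem' := by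
    rintro _ _ ⟨k, rfl⟩ ⟨l, rfl⟩
    refine ⟨k + l, ?_⟩
    rw [← WithLp.toLp_add, ← Matrix.mulVec_add]
    congr 2
    ext i
    simp
  neg_mem' := by
    rintro _ ⟨k, rfl⟩
    refine ⟨-k, ?_⟩
    rw [← WithLp.toLp_neg, ← Matrix.mulVec_neg]
    congr 2
    ext i
    simp

/-- The regularised modulus `|ℓ|₀ = |ℓ| + 2`. -/
noncomputable def modulus₀ {d : ℕ} {A : Matrix (Fin d) (Fin d) ℝ} (ℓ : bravaisLattice A) : ℝ :=
  ‖(ℓ : EuclideanSpace ℝ (Fin d))‖ + 2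

section Differences

/-- The iterated difference `D_{ρ₁} ⋯ D_{ρⱼ} u`, where `D_ρ u (ℓ) = u (ℓ + ρ) - u ℓ`
is Mathlib's `fwdDiff`. -/
def iterDiff {G F : Type*} [AddCommGroup G] [AddCommGroup F] :
    (j : ℕ) → (Fin j → G) → (G → F) → (G → F)
  | 0, _, u => u
  | j + 1, ρ, u => fwdDiff (ρ 0) (iterDiff j (Fin.tail ρ) u)

/-- The difference stencil `Du(ℓ) = (D_ρ u (ℓ))_{ρ ∈ R}`. -/
def stencil {G F : Type*} [AddCommGroup G] [AddCommGroup F] (R : Finset G)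
    (u : G → F) (ℓ : G) : R → F :=
  fun ρ => fwdDiff (ρ : G) u ℓ

/-- The Euclidean norm `|Dʲu(ℓ)|` of the tensor `Dʲu(ℓ) = (D_ρ u(ℓ))_{ρ ∈ Rʲ}`. -/
noncomputable def stencilNorm {G F : Type*} [AddCommGroup G] [NormedAddCommGroup F]
    (R : Finset G) (j : ℕ) (u : G → F) (ℓ : G) : ℝ :=
  Real.sqrt (∑ ρ : Fin j → R, ‖iterDiff j (fun i => (ρ i : G)) u ℓ‖ ^ 2)

/-- The discrete divergence `Div B = - ∑_{ρ ∈ R} D_{-ρ} B_{·ρ}`. -/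
def discreteDiv {G F : Type*} [AddCommGroup G] [AddCommGroup F] (R : Finset G)
    (B : G → R → F) (ℓ : G) : F :=
  -∑ ρ : R, fwdDiff (-(ρ : G)) (fun z => B z ρ) ℓ

/-- Membership in the energy space `ℋ¹`: the stencil `Du` is square summable. -/
def MemH1 {G F : Type*} [AddCommGroup G] [NormedAddCommGroup F] (R : Finset G)
    (u : G → F) : Prop :=
  Summable fun ℓ => stencilNorm R 1 u ℓ ^ 2

/-- Membership in `ℋᶜ`: the support of `Du` is bounded, that is, finite (a Bravais lattice has
finitely many points in every ball). -/
def MemHc {G F : Type*} [AddCommGroup G] [AddCommGroup F] (R : Finset G) (u : G → F) : Prop :=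
  {ℓ | stencil R u ℓ ≠ 0}.Finite

end Differences

section Hamiltonian

/-- The bilinear form `∇²V(0)` on `ℝ^{N × R}`. -/
noncomputable def hessZero {N : ℕ} {ι : Type*} [Fintype ι]
    (V : (ι → EuclideanSpace ℝ (Fin N)) → ℝ) (a b : ι → EuclideanSpace ℝ (Fin N)) : ℝ :=
  fderiv ℝ (fderiv ℝ V) 0 a b

open Classical in
/-- The matrix `∇²V(0)[a] ∈ ℝ^{N × R}` that represents the functional `b ↦ ∇²V(0)[a, b]`; its
entry at `(i, ρ)` is the value of the functional at the unit matrix `E_{iρ}`. -/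
noncomputable def hessZeroApply {N : ℕ} {ι : Type*} [Fintype ι]
    (V : (ι → EuclideanSpace ℝ (Fin N)) → ℝ) (a : ι → EuclideanSpace ℝ (Fin N)) :
    ι → EuclideanSpace ℝ (Fin N) :=
  fun ρ => WithLp.toLp 2 fun i => hessZero V a (Pi.single ρ (EuclideanSpace.single i 1))

/-- The pointwise linearised force `H[u](ℓ) = - Div (∇²V(0)[Du]) (ℓ)`. -/
noncomputable def linForce {G : Type*} [AddCommGroup G] {N : ℕ} (R : Finset G)
    (V : (R → EuclideanSpace ℝ (Fin N)) → ℝ) (u : G → EuclideanSpace ℝ (Fin N)) :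
    G → EuclideanSpace ℝ (Fin N) :=
  fun ℓ => -discreteDiv R (fun z => hessZeroApply V (stencil R u z)) ℓ

/-- Lattice stability: `H[u, u] = ∑_ℓ ∇²V(0)[Du(ℓ), Du(ℓ)] ≥ c₀ ‖Du‖²_{ℓ²}` for all `u ∈ ℋᶜ`,
with some `c₀ > 0`. For such `u` both sums are finite. -/
def LatticeStable {G : Type*} [AddCommGroup G] {N : ℕ} (R : Finset G)
    (V : (R → EuclideanSpace ℝ (Fin N)) → ℝ) : Prop :=
  ∃ c₀ : ℝ, 0 < c₀ ∧ ∀ u : G → EuclideanSpace ℝ (Fin N), MemHc R u →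
    c₀ * ∑' ℓ, stencilNorm R 1 u ℓ ^ 2 ≤ ∑' ℓ, hessZero V (stencil R u ℓ) (stencil R u ℓ)

/-- The `i`-th moment `∑_ℓ f(ℓ) ⊗ ℓ^{⊗ i}` of a force field `f`, an element of
`ℝᴺ ⊗ (ℝᵈ)^{⊗ i}`, written in coordinates. -/
noncomputable def forceMoment {d N : ℕ} {A : Matrix (Fin d) (Fin d) ℝ} (i : ℕ)
    (f : bravaisLattice A → EuclideanSpace ℝ (Fin N)) : Fin N → (Fin i → Fin d) → ℝ :=
  fun k s => ∑' ℓ : bravaisLattice A,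
    f ℓ k * ∏ m : Fin i, (ℓ : EuclideanSpace ℝ (Fin d)) (s m)

end Hamiltonian

/-! ### Lattice sums of power and logarithm weights -/

section

open Finset

/-! After passing to coordinates on `ℤᵈ` and complexifying, the linearised force is a
constant-coefficient operator `L = ∑ A_{ρσ} D_{-σ} D_ρ` (`latOp`). The proof shows that the
differences of `u` are convolutions of `L u` with differences of a lattice Green's function, and
that vanishing moments of `L u` improve the decay of such convolutions.

Coercivity. Testing stability with plane waves cut off to large cubes, and dividing by the volume,
gives `Re ⟨a, L̂(x) a⟩ ≥ c |x|² |a|²` on the frequency cube (`symbolCoercive_of_stable`).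

Green's function. It is built as the Neumann series `τ ∑ₙ (1 - τL)ⁿ`, a discrete-time heat
semigroup. Shifting the Fourier contour by a real tilt of size `(n+1)^{-1/2}` bounds a `j`-fold
difference of the `n`-th kernel by `(√(n+1) + |ℓ|)^{-(d+j)}` (`exists_iterKernel_bound`). Summing
over `n` gains two powers, so the differences of order `j ≥ 1` of the Green's function are
`O((|ℓ|+2)^{2-d-j})` (`greenDiff_bounds`). For square-summable differences of `u` the iterates of `1
- τL` tend to zero pointwise, and no homogeneous term is left in the representation
(`ldiff_eq_tsum_greenDiff`).

Convolution. In `∑ g(ℓ-k) f(k)` the Newton polynomial of degree `< p` of `k ↦ g(ℓ-k)` at `0` may be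
subtracted, because the moments of `f` vanish. Near the origin the Newton remainder gains
`(|k|/|ℓ|)^p`; elsewhere kernel and polynomial are estimated separately. The borderline sum of
`|k|^{-d}` costs one logarithm (`convolution_decay`). The argument needs a kernel of decay order `a`
with `1 ≤ a ≤ d`; with `a = d-2+j` this covers exactly `j = 1, 2`.

Higher orders. For `j ≥ 3` the second-order result is applied to `D^{j-2}u`. Its force `D^{j-2}L u`
decays faster by hypothesis, and summation by parts gives it one further vanishing moment per
difference (`moments_ldiff`), so `p` is replaced by `p+j-2` (`ldiff_decay`). -/

/-- The sup norm of a lattice point, as a natural number. -/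
def supAbs {d : ℕ} (k : Fin d → ℤ) : ℕ := Finset.univ.sup fun i => (k i).natAbs

theorem supAbs_le_iff {d : ℕ} (k : Fin d → ℤ) (m : ℕ) :
    supAbs k ≤ m ↔ ∀ i, -(m : ℤ) ≤ k i ∧ k i ≤ m := by
  simp only [supAbs, Finset.sup_le_iff, Finset.mem_univ, true_implies]
  exact forall_congr' fun i => by omega

theorem norm_eq_supAbs {d : ℕ} (k : Fin d → ℤ) : ‖k‖ = supAbs k := by
  apply le_antisymm
  · refine (pi_norm_le_iff_of_nonneg (by positivity)).2 fun i => ?_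
    have : (k i).natAbs ≤ supAbs k := Finset.le_sup (f := fun i => (k i).natAbs) (Finset.mem_univ i)
    rw [Int.norm_eq_abs, ← Int.cast_abs, Int.abs_eq_natAbs]
    exact_mod_cast this
  · have h : supAbs k ≤ ⌊‖k‖⌋₊ := by
      refine Finset.sup_le fun i _ => Nat.le_floor ?_
      have := norm_le_pi_norm k i
      rwa [Int.norm_eq_abs, ← Int.cast_abs, Int.abs_eq_natAbs] at this
    exact (Nat.cast_le.2 h).trans (Nat.floor_le (norm_nonneg _))

theorem add_two_pow_sub_pow_le (b : ℝ) (hb : 0 ≤ b) (d : ℕ) :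
    (b + 2) ^ (d + 1) - b ^ (d + 1) ≤ 2 * (d + 1) * (b + 2) ^ d := by
  induction d with
  | zero => simp
  | succ d ih =>
    have h1 : b ^ (d + 1) ≤ (b + 2) ^ (d + 1) := by gcongr; linarith
    have h2 : (b + 2) ^ (d + 1 + 1) - b ^ (d + 1 + 1)
      = (b + 2) * ((b + 2) ^ (d + 1) - b ^ (d + 1)) + 2 * b ^ (d + 1) := by ring
    have h3 := mul_le_mul_of_nonneg_left ih (by linarith : (0 : ℝ) ≤ b + 2)
    have h4 : (b + 2) * (2 * (d + 1) * (b + 2) ^ d) = 2 * (d + 1) * (b + 2) ^ (d + 1) := by ring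
    push_cast
    rw [h2]
    nlinarith

/-- A sphere in the sup norm is the difference of two consecutive centred boxes, whose side lengths
differ by two; the mean value bound `add_two_pow_sub_pow_le` then loses one power of the radius. -/
theorem card_shell_le {d : ℕ} (hd : 1 ≤ d) (m : ℕ) (s : Finset (Fin d → ℤ))
    (hs : ∀ k ∈ s, supAbs k = m) :
    (s.card : ℝ) ≤ (2 * d * 2 ^ d) * ((m : ℝ) + 2) ^ (d - 1) := by
  obtain ⟨d, rfl⟩ : ∃ e, d = e + 1 := ⟨d - 1, by omega⟩
  have card_box : ∀ m : ℕ, (Finset.Icc (fun _ : Fin (d + 1) => -(m : ℤ)) fun _ => (m : ℤ)).card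
      = (2 * m + 1) ^ (d + 1) := by
    intro m
    rw [Pi.card_Icc]
    simp only [Int.card_Icc, Finset.prod_const, Finset.card_univ, Fintype.card_fin]
    congr 1
    omega
  have mem_box : ∀ (m : ℕ) (k : Fin (d + 1) → ℤ),
      k ∈ Finset.Icc (fun _ : Fin (d + 1) => -(m : ℤ)) (fun _ => (m : ℤ)) ↔ supAbs k ≤ m := by
    intro m k
    rw [supAbs_le_iff, Finset.mem_Icc, Pi.le_def, Pi.le_def, ← forall_and]
  rcases m with _ | m
  · have h1 : s ⊆ Finset.Icc (fun _ : Fin (d + 1) => -((0 : ℕ) : ℤ)) (fun _ => ((0 : ℕ) : ℤ)) :=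
      fun k hk => (mem_box 0 k).2 (hs k hk).le
    have h2 := Finset.card_le_card h1
    rw [card_box] at h2
    have h3 : (s.card : ℝ) ≤ 1 := by exact_mod_cast (by simpa using h2)
    refine h3.trans ?_
    have : (1 : ℝ) ≤ 2 ^ (d + 1) := one_le_pow₀ (by norm_num)
    have h5 : (1 : ℝ) ≤ ((0 : ℕ) + 2 : ℝ) ^ (d + 1 - 1) := one_le_pow₀ (by norm_num)
    have h6 : (1 : ℝ) ≤ 2 * ((d + 1 : ℕ) : ℝ) := by push_cast; linarith [Nat.cast_nonneg (α := ℝ) d]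
    exact one_le_mul_of_one_le_of_one_le (one_le_mul_of_one_le_of_one_le h6 this) h5
  · have h1 : s ⊆ Finset.Icc (fun _ : Fin (d + 1) => -((m + 1 : ℕ) : ℤ)) (fun _ => ((m + 1 : ℕ) : ℤ))
        \ Finset.Icc (fun _ : Fin (d + 1) => -(m : ℤ)) (fun _ => (m : ℤ)) := by
      intro k hk
      rw [Finset.mem_sdiff, mem_box, mem_box, hs k hk]
      omega
    have h2 := Finset.card_le_card h1
    rw [Finset.card_sdiff_of_subset, card_box, card_box] at h2
    · have h3 : (s.card : ℝ) ≤ ((2 * m + 1 : ℝ) + 2) ^ (d + 1) - (2 * m + 1 : ℝ) ^ (d + 1) := by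
        have h4 : (2 * m + 1) ^ (d + 1) ≤ (2 * (m + 1) + 1) ^ (d + 1) := by gcongr; omega
        have h5 : ((s.card : ℕ) : ℝ) ≤ (((2 * (m + 1) + 1) ^ (d + 1) - (2 * m + 1) ^ (d + 1) : ℕ) : ℝ) :=
          by exact_mod_cast h2
        rw [Nat.cast_sub h4] at h5
        push_cast at h5
        refine h5.trans (le_of_eq ?_)
        ring
      refine h3.trans ((add_two_pow_sub_pow_le _ (by positivity) d).trans ?_)
      have h6 : ((2 * m + 1 : ℝ) + 2) ^ d ≤ 2 ^ (d + 1) * ((m + 1 : ℕ) + 2 : ℝ) ^ d := by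
        have : (2 * m + 1 : ℝ) + 2 ≤ 2 * ((m + 1 : ℕ) + 2 : ℝ) := by push_cast; linarith
        calc ((2 * m + 1 : ℝ) + 2) ^ d ≤ (2 * ((m + 1 : ℕ) + 2 : ℝ)) ^ d := by gcongr
          _ = 2 ^ d * ((m + 1 : ℕ) + 2 : ℝ) ^ d := mul_pow _ _ _
          _ ≤ 2 ^ (d + 1) * ((m + 1 : ℕ) + 2 : ℝ) ^ d := by
            gcongr
            · norm_num
            · omega
      rw [Nat.add_sub_cancel]
      calc _ ≤ 2 * ((d : ℝ) + 1) * (2 ^ (d + 1) * ((m + 1 : ℕ) + 2 : ℝ) ^ d) := by gcongr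
        _ = _ := by push_cast; ring
    · intro k hk
      rw [mem_box] at hk ⊢
      omega

/-- Polar coordinates for the sup norm: grouping by shells reduces the lattice sums with radial
weights to one-dimensional sums. -/
theorem sum_radial_le {d : ℕ} (hd : 1 ≤ d) (φ : ℕ → ℝ) (hφ : ∀ m, 0 ≤ φ m)
    (s : Finset (Fin d → ℤ)) :
    ∑ k ∈ s, φ (supAbs k) ≤
      (2 * d * 2 ^ d) * ∑ m ∈ s.image supAbs, ((m : ℝ) + 2) ^ (d - 1) * φ m := by
  rw [Finset.sum_comp, Finset.mul_sum]
  refine Finset.sum_le_sum fun m _ => ?_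
  rw [nsmul_eq_mul, ← mul_assoc]
  exact mul_le_mul_of_nonneg_right
    (card_shell_le hd m _ fun k hk => (Finset.mem_filter.1 hk).2) (hφ m)

theorem sum_inv_add_two_le_log (n : ℕ) :
    ∑ m ∈ Finset.range n, ((m : ℝ) + 2)⁻¹ ≤ Real.log (n + 1) := by
  induction n with
  | zero => simp
  | succ n ih =>
    rw [Finset.sum_range_succ]
    have h : ((n : ℝ) + 2)⁻¹ ≤ Real.log (n + 2) - Real.log (n + 1) := by
      rw [← Real.log_div (by positivity) (by positivity)]
      have := Real.one_sub_inv_le_log_of_pos (x := ((n : ℝ) + 2) / (n + 1)) (by positivity)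
      refine le_trans (le_of_eq ?_) this
      field_simp
      ring
    have h2 : (((n + 1 : ℕ) : ℝ) + 1) = n + 2 := by push_cast; ring
    rw [h2]
    linarith

theorem sum_inv_pow_ball_le {d : ℕ} (hd : 1 ≤ d) : ∃ C : ℝ, 0 ≤ C ∧ ∀ r : ℝ, 0 ≤ r →
    ∀ s : Finset (Fin d → ℤ), (∀ k ∈ s, ‖k‖ ≤ r) →
      ∑ k ∈ s, ((‖k‖ + 2) ^ d)⁻¹ ≤ C * Real.log (r + 2) := by
  refine ⟨2 * d * 2 ^ d, by positivity, fun r hr s hs => ?_⟩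
  have h := sum_radial_le hd (fun m => (((m : ℝ) + 2) ^ d)⁻¹) (fun m => by positivity) s
  simp only [norm_eq_supAbs] at hs ⊢
  refine h.trans (mul_le_mul_of_nonneg_left ?_ (by positivity))
  have h1 : s.image supAbs ⊆ Finset.range (⌊r⌋₊ + 1) := by
    intro m hm
    obtain ⟨k, hk, rfl⟩ := Finset.mem_image.1 hm
    exact Finset.mem_range.2 (Nat.lt_succ_of_le (Nat.le_floor (hs k hk)))
  calc _ ≤ ∑ m ∈ Finset.range (⌊r⌋₊ + 1), ((m : ℝ) + 2) ^ (d - 1) * (((m : ℝ) + 2) ^ d)⁻¹ :=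
        Finset.sum_le_sum_of_subset_of_nonneg h1 fun m _ _ => by positivity
    _ = ∑ m ∈ Finset.range (⌊r⌋₊ + 1), ((m : ℝ) + 2)⁻¹ := by
        refine Finset.sum_congr rfl fun m _ => ?_
        obtain ⟨e, rfl⟩ : ∃ e, d = e + 1 := ⟨d - 1, by omega⟩
        rw [Nat.add_sub_cancel, pow_succ]
        field_simp
    _ ≤ Real.log ((⌊r⌋₊ + 1 : ℕ) + 1) := sum_inv_add_two_le_log _
    _ ≤ Real.log (r + 2) := by
        apply Real.log_le_log (by positivity)
        push_cast
        linarith [Nat.floor_le hr]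

/-- The discrete form of `∫ x^{-3/2} = -2 x^{-1/2}`, obtained from `1 = (√x - √(x-1)) (√x +
√(x-1))`. The exponent `3/2`, rather than `2`, leaves half a power free to absorb logarithms. -/
theorem inv_sqrt_telescope (x : ℝ) (hx : 1 < x) :
    x⁻¹ * (√x)⁻¹ ≤ 2 * ((√(x - 1))⁻¹ - (√x)⁻¹) := by
  set a := √x with ha
  set b := √(x - 1) with hb
  have hx' : x = a ^ 2 := (Real.sq_sqrt (by linarith)).symm
  have hb2 : b ^ 2 = a ^ 2 - 1 := by rw [hb, Real.sq_sqrt (by linarith), hx']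
  have hb0 : 0 < b := Real.sqrt_pos.2 (by linarith)
  have ha0 : 0 < a := Real.sqrt_pos.2 (by linarith)
  have hab : b ≤ a := Real.sqrt_le_sqrt (by linarith)
  rw [hx', inv_sub_inv hb0.ne' ha0.ne', ← mul_inv, ← one_div, ← mul_div_assoc,
    div_le_div_iff₀ (by positivity) (by positivity)]
  have h1 : 1 = (a - b) * (a + b) := by nlinarith
  have h3 : (a + b) * b ≤ 2 * a ^ 2 := by nlinarith
  have h4 : 0 ≤ (a - b) * a := mul_nonneg (by linarith) ha0.le
  calc 1 * (b * a) = (a - b) * (a + b) * (b * a) := by rw [← h1]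
    _ = ((a - b) * a) * ((a + b) * b) := by ring
    _ ≤ ((a - b) * a) * (2 * a ^ 2) := mul_le_mul_of_nonneg_left h3 h4
    _ = _ := by ring

theorem sum_inv_mul_inv_sqrt_le (y : ℝ) (hy : 2 ≤ y) (s : Finset ℕ)
    (hs : ∀ m ∈ s, y ≤ (m : ℝ) + 2) :
    ∑ m ∈ s, ((m : ℝ) + 2)⁻¹ * (√((m : ℝ) + 2))⁻¹ ≤ 4 * (√y)⁻¹ := by
  obtain ⟨n₀, hn₀, hn₀'⟩ : ∃ n₀ : ℕ, y ≤ n₀ + 2 ∧ (n₀ : ℝ) + 1 < y := by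
    refine ⟨⌈y - 2⌉₊, by linarith [Nat.le_ceil (y - 2)], ?_⟩
    linarith [Nat.ceil_lt_add_one (by linarith : 0 ≤ y - 2)]
  have hsub : s ⊆ Finset.Ico n₀ (s.sup id + n₀ + 1) := by
    intro m hm
    have h1 : m ≤ s.sup id := Finset.le_sup (f := id) hm
    have h2 : n₀ ≤ m := by
      have h3 := hs m hm
      have h4 : (n₀ : ℝ) < m + 2 := by linarith
      by_contra hlt
      have h5 : (m : ℝ) + 1 ≤ n₀ := by exact_mod_cast (by omega : m + 1 ≤ n₀)
      linarith
    rw [Finset.mem_Ico]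
    omega
  have h1 : ∀ N, n₀ ≤ N → ∑ m ∈ Finset.Ico n₀ N, ((m : ℝ) + 2)⁻¹ * (√((m : ℝ) + 2))⁻¹
      ≤ 2 * ((√((n₀ : ℝ) + 1))⁻¹ - (√((N : ℝ) + 1))⁻¹) := by
    intro N hN
    induction N, hN using Nat.le_induction with
    | base => simp
    | succ N hN ih =>
      rw [Finset.sum_Ico_succ_top hN]
      have := inv_sqrt_telescope ((N : ℝ) + 2) (by linarith [Nat.cast_nonneg (α := ℝ) N])
      rw [show (N : ℝ) + 2 - 1 = N + 1 by ring] at this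
      have h2 : (((N + 1 : ℕ) : ℝ) + 1) = N + 2 := by push_cast; ring
      rw [h2]
      linarith
  refine (Finset.sum_le_sum_of_subset_of_nonneg hsub fun m _ _ => by positivity).trans
    ((h1 _ (by omega)).trans ?_)
  have h3 : (√((n₀ : ℝ) + 1))⁻¹ ≤ 2 * (√y)⁻¹ := by
    rw [← div_eq_mul_inv, ← one_div, div_le_div_iff₀ (by positivity) (by positivity), one_mul]
    calc √y ≤ √(2 ^ 2 * ((n₀ : ℝ) + 1)) :=
          Real.sqrt_le_sqrt (by linarith [Nat.cast_nonneg (α := ℝ) n₀])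
      _ = 2 * √((n₀ : ℝ) + 1) := by rw [Real.sqrt_mul (by norm_num), Real.sqrt_sq (by norm_num)]
  have h4 : 0 ≤ (√(((s.sup id + n₀ + 1 : ℕ) : ℝ) + 1))⁻¹ := by positivity
  linarith

/-- Lets a tail sum carry the logarithm at its inner radius `y` instead of at the running radius
`x`, at the cost of half a power of `x / y`. -/
theorem log_pow_le_mul_sqrt (α : ℕ) : ∃ C : ℝ, 0 ≤ C ∧ ∀ x y : ℝ, 2 ≤ y → y ≤ x →
    Real.log x ^ α ≤ C * Real.log y ^ α * √(x / y) := by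
  -- Chosen so that `α * ε ≤ 1/2`; the `+ 1` keeps `ε` finite when `α = 0`.
  set ε : ℝ := (2 * ((α : ℝ) + 1))⁻¹ with hε
  have hε0 : 0 < ε := by positivity
  have hl2 : 0 < Real.log 2 := Real.log_pos (by norm_num)
  refine ⟨(1 + 1 / (ε * Real.log 2)) ^ α, by positivity, fun x y hy hxy => ?_⟩
  have ht : 1 ≤ x / y := by rw [one_le_div (by linarith)]; exact hxy
  have hly : Real.log 2 ≤ Real.log y := Real.log_le_log (by norm_num) hy
  have h1 : Real.log (x / y) ≤ (x / y) ^ ε / ε := Real.log_le_rpow_div (by linarith) hε0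
  have h2 : Real.log x = Real.log y + Real.log (x / y) := by
    rw [Real.log_div (by linarith) (by linarith)]; ring
  have h3 : 1 ≤ (x / y) ^ ε := Real.one_le_rpow ht hε0.le
  have h4 : Real.log x ≤ (1 + 1 / (ε * Real.log 2)) * Real.log y * (x / y) ^ ε := by
    have h5 : (x / y) ^ ε / ε ≤ 1 / (ε * Real.log 2) * Real.log y * (x / y) ^ ε := by
      have h6 : 1 ≤ Real.log y / Real.log 2 := (one_le_div hl2).2 hly
      calc (x / y) ^ ε / ε = 1 * ((x / y) ^ ε / ε) := (one_mul _).symm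
        _ ≤ Real.log y / Real.log 2 * ((x / y) ^ ε / ε) := by gcongr
        _ = _ := by field_simp
    have h6 : Real.log y ≤ Real.log y * (x / y) ^ ε :=
      le_mul_of_one_le_right (hl2.le.trans hly) h3
    rw [h2]
    calc _ ≤ Real.log y * (x / y) ^ ε + 1 / (ε * Real.log 2) * Real.log y * (x / y) ^ ε := by
          linarith
      _ = _ := by ring
  have h0 : 0 ≤ Real.log x := Real.log_nonneg (by linarith)
  calc Real.log x ^ α ≤ ((1 + 1 / (ε * Real.log 2)) * Real.log y * (x / y) ^ ε) ^ α := by gcongr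
    _ = (1 + 1 / (ε * Real.log 2)) ^ α * Real.log y ^ α * ((x / y) ^ ε) ^ α := by
        rw [mul_pow, mul_pow]
    _ ≤ _ := by
        have : ((x / y) ^ ε) ^ α ≤ √(x / y) := by
          rw [← Real.rpow_natCast, ← Real.rpow_mul (by linarith), Real.sqrt_eq_rpow]
          apply Real.rpow_le_rpow_of_exponent_le ht
          rw [hε, inv_mul_le_iff₀ (by positivity)]
          linarith
        have h9 : 0 ≤ Real.log y ^ α := pow_nonneg (by linarith) _
        gcongr

theorem sum_tail_le {d : ℕ} (hd : 1 ≤ d) (α : ℕ) : ∃ C : ℝ, 0 ≤ C ∧ ∀ r : ℝ, 0 ≤ r →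
    ∀ s : Finset (Fin d → ℤ), (∀ k ∈ s, r ≤ ‖k‖) →
      ∑ k ∈ s, ((‖k‖ + 2) ^ (d + 1))⁻¹ * Real.log (‖k‖ + 2) ^ α
        ≤ C * ((r + 2)⁻¹ * Real.log (r + 2) ^ α) := by
  obtain ⟨C, hC, hlog⟩ := log_pow_le_mul_sqrt α
  refine ⟨(2 * d * 2 ^ d) * (C * 4), by positivity, fun r hr s hs => ?_⟩
  have hL : 0 ≤ Real.log (r + 2) ^ α := pow_nonneg (Real.log_nonneg (by linarith)) _
  have h := sum_radial_le hd
    (fun m => (((m : ℝ) + 2) ^ (d + 1))⁻¹ * Real.log ((m : ℝ) + 2) ^ α) (fun m =>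
      mul_nonneg (by positivity)
        (pow_nonneg (Real.log_nonneg (by linarith [Nat.cast_nonneg (α := ℝ) m])) _)) s
  simp only [norm_eq_supAbs] at hs ⊢
  refine h.trans ?_
  rw [mul_assoc (2 * (d : ℝ) * 2 ^ d) (C * 4)]
  refine mul_le_mul_of_nonneg_left ?_ (by positivity)
  have hm : ∀ m ∈ s.image supAbs, r + 2 ≤ (m : ℝ) + 2 := by
    intro m hm
    obtain ⟨k, hk, rfl⟩ := Finset.mem_image.1 hm
    linarith [hs k hk]
  calc _ ≤ ∑ m ∈ s.image supAbs, (C * Real.log (r + 2) ^ α * (√(r + 2))⁻¹) *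
          (((m : ℝ) + 2)⁻¹ * (√((m : ℝ) + 2))⁻¹) := by
        refine Finset.sum_le_sum fun m hm' => ?_
        have h1 := hlog _ _ (by linarith : 2 ≤ r + 2) (hm m hm')
        obtain ⟨e, rfl⟩ : ∃ e, d = e + 1 := ⟨d - 1, by omega⟩
        set x := (m : ℝ) + 2 with hx
        have hx0 : 0 < x := by positivity
        have h2 : x ^ (e + 1 - 1) * ((x ^ (e + 1 + 1))⁻¹ * Real.log x ^ α)
            = x⁻¹ * x⁻¹ * Real.log x ^ α := by
          rw [Nat.add_sub_cancel, pow_succ, pow_succ]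
          field_simp
        rw [h2]
        calc x⁻¹ * x⁻¹ * Real.log x ^ α
            ≤ x⁻¹ * x⁻¹ * (C * Real.log (r + 2) ^ α * √(x / (r + 2))) := by gcongr
          _ = _ := by
            rw [Real.sqrt_div hx0.le]
            have h3 : x⁻¹ * √x = (√x)⁻¹ := by
              have := Real.mul_self_sqrt hx0.le
              have h4 : √x ≠ 0 := (Real.sqrt_pos.2 hx0).ne'
              field_simp
              rw [sq, this]
            rw [← h3]
            ring
    _ ≤ (C * Real.log (r + 2) ^ α * (√(r + 2))⁻¹) * (4 * (√(r + 2))⁻¹) := by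
        rw [← Finset.mul_sum]
        exact mul_le_mul_of_nonneg_left
          (sum_inv_mul_inv_sqrt_le (r + 2) (by linarith) _ hm) (by positivity)
    _ = _ := by
        have h1 : (√(r + 2))⁻¹ * (√(r + 2))⁻¹ = (r + 2)⁻¹ := by
          rw [← mul_inv, Real.mul_self_sqrt (by linarith)]
        rw [← h1]
        ring

/-- The time integral of the heat kernel bound, with a gain of two powers. The spare `b` powers are
bounded by `(1 + r) ^ b`, and the remaining cube telescopes against differences of `1 / (√(m+1) +
r)`. -/
theorem sum_inv_sqrt_add_pow_le (b : ℕ) (r : ℝ) (hr : 0 ≤ r) (n : ℕ) :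
    ∑ m ∈ Finset.range n, ((√((m : ℝ) + 1) + r) ^ (b + 3))⁻¹ ≤ 16 * ((1 + r) ^ (b + 1))⁻¹ := by
  have key : ∀ n : ℕ, ∑ m ∈ Finset.range n, ((√((m : ℝ) + 1) + r) ^ 3)⁻¹
      ≤ 16 * ((√(0 + 1) + r)⁻¹ - (√((n : ℝ) + 1) + r)⁻¹) := by
    intro n
    induction n with
    | zero => simp
    | succ n ih =>
      rw [Finset.sum_range_succ]
      push_cast
      set a := √((n : ℝ) + 1) with ha
      set c := √((n : ℝ) + 1 + 1) with hc
      have ha2 : a ^ 2 = n + 1 := Real.sq_sqrt (by positivity)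
      have hc2 : c ^ 2 = n + 1 + 1 := Real.sq_sqrt (by positivity)
      have ha0 : 0 < a := Real.sqrt_pos.2 (by positivity)
      have hac : a ≤ c := Real.sqrt_le_sqrt (by linarith)
      have hn : (0 : ℝ) ≤ n := Nat.cast_nonneg n
      have hca : c ≤ 2 * a := abs_le_of_sq_le_sq' (by nlinarith) (by linarith) |>.2
      have h1 : 1 = (c - a) * (c + a) := by nlinarith
      have h2 : ((a + r) ^ 3)⁻¹ ≤ 16 * ((a + r)⁻¹ - (c + r)⁻¹) := by
        rw [inv_sub_inv (by positivity) (by positivity), ← one_div, ← mul_div_assoc,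
          div_le_div_iff₀ (by positivity) (by positivity)]
        have h3 : c + r - (a + r) = c - a := by ring
        rw [h3]
        have h4 : 0 ≤ c - a := by linarith
        have h5 : (c + a) * (c + r) ≤ 16 * (a + r) ^ 2 := by nlinarith
        calc 1 * ((a + r) * (c + r)) = ((c - a) * (c + a)) * ((a + r) * (c + r)) := by rw [← h1]
          _ = ((c - a) * (a + r)) * ((c + a) * (c + r)) := by ring
          _ ≤ ((c - a) * (a + r)) * (16 * (a + r) ^ 2) := by gcongr
          _ = _ := by ring
      linarith
  have h1 : ∀ m : ℕ, ((√((m : ℝ) + 1) + r) ^ (b + 3))⁻¹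
      ≤ ((1 + r) ^ b)⁻¹ * ((√((m : ℝ) + 1) + r) ^ 3)⁻¹ := by
    intro m
    have : 1 ≤ √((m : ℝ) + 1) := by
      rw [Real.one_le_sqrt]; linarith [Nat.cast_nonneg (α := ℝ) m]
    rw [pow_add, mul_inv]
    gcongr
  calc _ ≤ ∑ m ∈ Finset.range n, ((1 + r) ^ b)⁻¹ * ((√((m : ℝ) + 1) + r) ^ 3)⁻¹ :=
        Finset.sum_le_sum fun m _ => h1 m
    _ ≤ ((1 + r) ^ b)⁻¹ * (16 * (√(0 + 1) + r)⁻¹) := by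
        rw [← Finset.mul_sum]
        gcongr
        refine (key n).trans ?_
        have : 0 ≤ (√((n : ℝ) + 1) + r)⁻¹ := by positivity
        linarith
    _ = _ := by
        rw [zero_add, Real.sqrt_one, pow_succ, mul_inv]
        ring

end

/-! ### Difference calculus on `ℤᵈ`, polynomials and Newton interpolation -/

section

open Finset

theorem fwdDiff_comm {G X : Type*} [AddCommGroup G] [AddCommGroup X] (h h' : G) (u : G → X) :
    fwdDiff h (fwdDiff h' u) = fwdDiff h' (fwdDiff h u) := by
  ext x
  simp only [fwdDiff, add_right_comm x h h']
  abel

/-- Iterated differences along a list of directions. -/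
def ldiff {G X : Type*} [AddCommGroup G] [AddCommGroup X] (L : List G) (u : G → X) : G → X :=
  L.foldr fwdDiff u

section ldiff

variable {G X : Type*} [AddCommGroup G] [AddCommGroup X]

@[simp] theorem ldiff_nil (u : G → X) : ldiff [] u = u := rfl

@[simp] theorem ldiff_cons (h : G) (L : List G) (u : G → X) :
    ldiff (h :: L) u = fwdDiff h (ldiff L u) := rfl

theorem iterDiff_eq_ldiff (j : ℕ) (ρ : Fin j → G) (u : G → X) :
    iterDiff j ρ u = ldiff (List.ofFn ρ) u := by
  induction j with
  | zero => rfl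
  | succ j ih =>
    rw [iterDiff, ih, List.ofFn_succ, ldiff_cons]
    rfl

end ldiff

/-- The `i`-th lattice unit vector. -/
def unitVec {d : ℕ} (i : Fin d) : Fin d → ℤ := Pi.single i 1

instance fwdDiff_leftCommutative {ι G X : Type*} [AddCommGroup G] [AddCommGroup X] (e : ι → G) :
    LeftCommutative fun (i : ι) (h : G → X) => fwdDiff (e i) h :=
  ⟨fun i j h => fwdDiff_comm (e i) (e j) h⟩

/-- Mixed unit differences, indexed by a multiset of coordinates. -/
def mdiff {d : ℕ} {X : Type*} [AddCommGroup X] (s : Multiset (Fin d)) (g : (Fin d → ℤ) → X) :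
    (Fin d → ℤ) → X :=
  s.foldr (fun i h => fwdDiff (unitVec i) h) g

section mdiff

variable {d : ℕ} {X : Type*} [AddCommGroup X]

theorem mdiff_coe (L : List (Fin d)) (g : (Fin d → ℤ) → X) :
    mdiff (L : Multiset (Fin d)) g = ldiff (L.map unitVec) g := by
  simp [mdiff, ldiff, List.foldr_map]

theorem mdiff_cons (i : Fin d) (s : Multiset (Fin d)) (g : (Fin d → ℤ) → X) :
    mdiff (i ::ₘ s) g = fwdDiff (unitVec i) (mdiff s g) := Multiset.foldr_cons _ _ _ _

theorem mdiff_fwdDiff (i : Fin d) (s : Multiset (Fin d)) (g : (Fin d → ℤ) → X) :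
    mdiff s (fwdDiff (unitVec i) g) = mdiff (i ::ₘ s) g := by
  induction s using Multiset.induction_on with
  | empty => rfl
  | cons a s ih => rw [mdiff_cons, ih, mdiff_cons, mdiff_cons, mdiff_cons, fwdDiff_comm]

end mdiff

/-- `PolyLT p q` says that `q` is a real polynomial of degree less than `p` on the lattice. -/
inductive PolyLT {d : ℕ} : ℕ → ((Fin d → ℤ) → ℝ) → Prop
  | zero (p : ℕ) : PolyLT p 0
  | const (p : ℕ) (c : ℝ) : PolyLT (p + 1) fun _ => c
  | coord_mul {p : ℕ} {q : (Fin d → ℤ) → ℝ} (i : Fin d) :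
      PolyLT p q → PolyLT (p + 1) fun k => (k i : ℝ) * q k
  | add {p : ℕ} {q q' : (Fin d → ℤ) → ℝ} : PolyLT p q → PolyLT p q' → PolyLT p (q + q')
  | smul {p : ℕ} {q : (Fin d → ℤ) → ℝ} (c : ℝ) : PolyLT p q → PolyLT p (c • q)

namespace PolyLT

variable {d : ℕ} {p : ℕ} {q : (Fin d → ℤ) → ℝ}

theorem succ (h : PolyLT p q) : PolyLT (p + 1) q := by
  induction h with
  | zero p => exact zero _
  | const p c => exact const _ c
  | coord_mul i _ ih => exact coord_mul i ih
  | add _ _ ih ih' => exact add ih ih'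
  | smul c _ ih => exact smul c ih

theorem mono (h : PolyLT p q) {p' : ℕ} (hp : p ≤ p') : PolyLT p' q := by
  induction p', hp using Nat.le_induction with
  | base => exact h
  | succ n _ ih => exact ih.succ

/-- The bound is multiplied by one weight so that degree `< p` means growth of order `p - 1` without
a truncated subtraction; this also covers `p = 0`. -/
theorem growth (h : PolyLT p q) :
    ∃ C : ℝ, 0 ≤ C ∧ ∀ k, (‖k‖ + 2) * |q k| ≤ C * (‖k‖ + 2) ^ p := by
  induction h with
  | zero p => exact ⟨0, le_rfl, fun k => by simp⟩
  | const p c =>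
    refine ⟨|c|, abs_nonneg _, fun k => ?_⟩
    rw [mul_comm]
    refine mul_le_mul_of_nonneg_left ?_ (abs_nonneg _)
    exact le_self_pow₀ (by linarith [norm_nonneg k]) (by omega)
  | @coord_mul p q i _ ih =>
    obtain ⟨C, hC, h⟩ := ih
    refine ⟨C, hC, fun k => ?_⟩
    have h1 : |(k i : ℝ)| ≤ ‖k‖ + 2 := by
      have := norm_le_pi_norm k i
      rw [Int.norm_eq_abs] at this
      linarith
    rw [abs_mul, pow_succ, ← mul_assoc]
    calc (‖k‖ + 2) * |(k i : ℝ)| * |q k| = ((‖k‖ + 2) * |q k|) * |(k i : ℝ)| := by ring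
      _ ≤ (C * (‖k‖ + 2) ^ p) * (‖k‖ + 2) :=
        mul_le_mul (h k) h1 (abs_nonneg _) (by positivity)
      _ = _ := by ring
  | @add p q q' _ _ ih ih' =>
    obtain ⟨C, hC, h⟩ := ih
    obtain ⟨C', hC', h'⟩ := ih'
    refine ⟨C + C', by positivity, fun k => ?_⟩
    rw [Pi.add_apply]
    calc (‖k‖ + 2) * |q k + q' k| ≤ (‖k‖ + 2) * (|q k| + |q' k|) := by
          gcongr
          exact abs_add_le _ _
      _ ≤ _ := by rw [mul_add, add_mul C]; exact add_le_add (h k) (h' k)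
  | smul c _ ih =>
    obtain ⟨C, hC, h⟩ := ih
    refine ⟨|c| * C, by positivity, fun k => ?_⟩
    rw [Pi.smul_apply, smul_eq_mul, abs_mul, mul_left_comm, mul_assoc]
    exact mul_le_mul_of_nonneg_left (h k) (abs_nonneg _)

theorem eq_zero (h : PolyLT 0 q) : q = 0 := by
  obtain ⟨p, hp⟩ : ∃ p, p = 0 := ⟨0, rfl⟩
  rw [← hp] at h
  induction h with
  | zero p => rfl
  | const p c => omega
  | coord_mul i _ _ => omega
  | add _ _ ih ih' => rw [ih hp, ih' hp, add_zero]
  | smul c _ ih => rw [ih hp, smul_zero]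

theorem fwdDiff (h : PolyLT p q) (σ : Fin d → ℤ) {n : ℕ} (hn : p = n + 1) :
    PolyLT n (fwdDiff σ q) := by
  induction h generalizing n with
  | zero p => simpa [_root_.fwdDiff, funext_iff, Pi.zero_def] using! zero (d := d) n
  | const p c => simpa using! zero (d := d) n
  | @coord_mul p q i hq ih =>
    obtain rfl : p = n := by omega
    rcases p with _ | p
    · have hq0 := hq.eq_zero
      subst hq0
      convert zero (d := d) 0
      ext k
      simp [_root_.fwdDiff]
    · have h1 := ih rfl
      -- Discrete Leibniz rule: `D_σ (k_i q) = k_i D_σ q + σ_i q + σ_i D_σ q`.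
      convert ((coord_mul i h1).add (smul (σ i : ℝ) hq)).add (smul (σ i : ℝ) h1.succ) using 1
      ext k
      simp [_root_.fwdDiff]
      ring
  | add _ _ ih ih' => rw [fwdDiff_add]; exact (ih hn).add (ih' hn)
  | smul c _ ih => rw [fwdDiff_const_smul]; exact (ih hn).smul c

theorem shift (h : PolyLT p q) (σ : Fin d → ℤ) : PolyLT p fun k => q (k + σ) := by
  rcases p with _ | p
  · rw [h.eq_zero]; exact zero 0
  · convert h.add (h.fwdDiff σ rfl).succ using 1
    ext k
    simp [_root_.fwdDiff]

end PolyLT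

/-- The Newton basis polynomial of a multiset of coordinates. -/
def newtonBasis {d : ℕ} (s : Multiset (Fin d)) (k : Fin d → ℤ) : ℝ :=
  ((∏ i, Ring.choose (k i) (s.count i) : ℤ) : ℝ)

section newtonBasis

variable {d : ℕ}

theorem newtonBasis_zero_left : newtonBasis (0 : Multiset (Fin d)) = fun _ => 1 := by
  ext k
  simp [newtonBasis]

theorem newtonBasis_zero_right {s : Multiset (Fin d)} (hs : s ≠ 0) : newtonBasis s 0 = 0 := by
  obtain ⟨i, hi⟩ := Multiset.exists_mem_of_ne_zero hs
  rw [newtonBasis, Finset.prod_eq_zero (Finset.mem_univ i), Int.cast_zero]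
  exact Ring.choose_zero_pos ℤ (Multiset.count_pos.2 hi)

theorem newtonBasis_cons (i : Fin d) (s : Multiset (Fin d)) (k : Fin d → ℤ) :
    ((s.count i : ℝ) + 1) * newtonBasis (i ::ₘ s) k = ((k i : ℝ) - s.count i) * newtonBasis s k := by
  have h := Ring.choose_smul_choose (k i) (Nat.le_succ (s.count i))
  rw [Nat.succ_sub (le_refl _), Nat.sub_self, Ring.choose_one_right, Nat.choose_succ_self_right,
    nsmul_eq_mul] at h
  have h' : ((s.count i : ℤ) + 1) * ∏ j, Ring.choose (k j) ((i ::ₘ s).count j)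
      = (k i - s.count i) * ∏ j, Ring.choose (k j) (s.count j) := by
    rw [← Finset.mul_prod_erase _ _ (Finset.mem_univ i),
      ← Finset.mul_prod_erase _ (fun j => Ring.choose (k j) (s.count j)) (Finset.mem_univ i),
      Multiset.count_cons_self]
    have h2 : ∏ j ∈ Finset.univ.erase i, Ring.choose (k j) ((i ::ₘ s).count j)
        = ∏ j ∈ Finset.univ.erase i, Ring.choose (k j) (s.count j) :=
      Finset.prod_congr rfl fun j hj => by
        rw [Multiset.count_cons_of_ne (Finset.ne_of_mem_erase hj)]
    rw [h2, ← mul_assoc, ← mul_assoc]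
    congr 1
    push_cast at h
    rw [mul_comm (k i - _)]
    exact h
  simp only [newtonBasis]
  exact_mod_cast h'

theorem polyLT_newtonBasis (s : Multiset (Fin d)) : PolyLT (s.card + 1) (newtonBasis s) := by
  induction s using Multiset.induction_on with
  | empty => rw [newtonBasis_zero_left]; exact PolyLT.const _ 1
  | cons i s ih =>
    rw [Multiset.card_cons]
    convert ((PolyLT.coord_mul i ih).add (PolyLT.smul (-(s.count i : ℝ)) ih.succ)).smul
      ((s.count i : ℝ) + 1)⁻¹ using 1
    ext k
    have h := newtonBasis_cons i s k
    have h0 : ((s.count i : ℝ) + 1) ≠ 0 := by positivity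
    simp only [Pi.smul_apply, Pi.add_apply, smul_eq_mul]
    rw [eq_inv_mul_iff_mul_eq₀ h0, h]
    ring

theorem fwdDiff_newtonBasis_of_mem {i : Fin d} {s : Multiset (Fin d)} (hi : i ∈ s) :
    fwdDiff (unitVec i) (newtonBasis s) = newtonBasis (s.erase i) := by
  ext k
  obtain ⟨c, hc⟩ : ∃ c, s.count i = c + 1 :=
    ⟨s.count i - 1, by have := Multiset.count_pos.2 hi; omega⟩
  simp only [fwdDiff, newtonBasis]
  rw [← Int.cast_sub]
  congr 1
  rw [← Finset.mul_prod_erase _ _ (Finset.mem_univ i),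
    ← Finset.mul_prod_erase _ (fun j => Ring.choose (k j) (s.count j)) (Finset.mem_univ i),
    ← Finset.mul_prod_erase _ (fun j => Ring.choose (k j) ((s.erase i).count j))
      (Finset.mem_univ i)]
  have h2 : ∏ j ∈ Finset.univ.erase i, Ring.choose ((k + unitVec i) j) (s.count j)
      = ∏ j ∈ Finset.univ.erase i, Ring.choose (k j) (s.count j) :=
    Finset.prod_congr rfl fun j hj => by
      rw [Pi.add_apply, unitVec, Pi.single_eq_of_ne (Finset.ne_of_mem_erase hj), add_zero]
  have h3 : ∏ j ∈ Finset.univ.erase i, Ring.choose (k j) ((s.erase i).count j)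
      = ∏ j ∈ Finset.univ.erase i, Ring.choose (k j) (s.count j) :=
    Finset.prod_congr rfl fun j hj => by
      rw [Multiset.count_erase_of_ne (Finset.ne_of_mem_erase hj)]
  rw [h2, h3, Multiset.count_erase_self, hc, Pi.add_apply, unitVec, Pi.single_eq_same,
    Ring.choose_succ_succ, Nat.add_sub_cancel]
  ring

theorem fwdDiff_newtonBasis_of_notMem {i : Fin d} {s : Multiset (Fin d)} (hi : i ∉ s) :
    fwdDiff (unitVec i) (newtonBasis s) = 0 := by
  ext k
  simp only [fwdDiff, newtonBasis, Pi.zero_apply]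
  rw [sub_eq_zero]
  congr 1
  refine Finset.prod_congr rfl fun j _ => ?_
  by_cases h : j = i
  · subst h
    rw [Multiset.count_eq_zero_of_notMem hi, Ring.choose_zero_right, Ring.choose_zero_right]
  · rw [Pi.add_apply, unitVec, Pi.single_eq_of_ne h, add_zero]

end newtonBasis

/-- The Newton polynomial of degree less than `p` of `g` at the origin. -/
noncomputable def newtonPoly {d : ℕ} {X : Type*} [AddCommGroup X] [Module ℝ X] (p : ℕ)
    (g : (Fin d → ℤ) → X) (k : Fin d → ℤ) : X :=
  ∑ n ∈ Finset.range p, ∑ s : Sym (Fin d) n,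
    newtonBasis (s : Multiset (Fin d)) k • mdiff (s : Multiset (Fin d)) g 0

/-- A unit difference removes one `i` from the multiset of a Newton basis function and annihilates
those without `i`. The surviving multisets are exactly `i ::ₛ s`, so the differenced Newton
polynomial is the Newton polynomial of the difference, one degree lower. -/
theorem fwdDiff_newtonPoly {d : ℕ} {X : Type*} [AddCommGroup X] [Module ℝ X] (p : ℕ)
    (g : (Fin d → ℤ) → X) (i : Fin d) (k : Fin d → ℤ) :
    fwdDiff (unitVec i) (newtonPoly (p + 1) g) k = newtonPoly p (fwdDiff (unitVec i) g) k := by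
  have h1 : fwdDiff (unitVec i) (newtonPoly (p + 1) g) k
      = ∑ n ∈ Finset.range (p + 1), ∑ s : Sym (Fin d) n,
        fwdDiff (unitVec i) (newtonBasis (s : Multiset (Fin d))) k
          • mdiff (s : Multiset (Fin d)) g 0 := by
    simp only [fwdDiff, newtonPoly, sub_smul, Finset.sum_sub_distrib]
  rw [h1, Finset.sum_range_succ', newtonPoly]
  have h2 : ∑ s : Sym (Fin d) 0, fwdDiff (unitVec i) (newtonBasis (s : Multiset (Fin d))) k
          • mdiff (s : Multiset (Fin d)) g 0 = 0 := by
    refine Finset.sum_eq_zero fun s _ => ?_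
    have : (s : Multiset (Fin d)) = 0 := Multiset.card_eq_zero.1 s.2
    rw [this, fwdDiff_newtonBasis_of_notMem (Multiset.notMem_zero i), Pi.zero_apply, zero_smul]
  rw [h2, add_zero]
  refine Finset.sum_congr rfl fun n _ => ?_
  have hinj : Function.Injective fun s : Sym (Fin d) n => i ::ₛ s := fun a b h =>
    Sym.coe_injective ((Multiset.cons_inj_right i).1 (congrArg Sym.toMultiset h))
  rw [← Finset.sum_subset (Finset.subset_univ (Finset.univ.image fun s : Sym (Fin d) n => i ::ₛ s)),
    Finset.sum_image fun a _ b _ h => hinj h]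
  · refine Finset.sum_congr rfl fun s _ => ?_
    rw [Sym.coe_cons, fwdDiff_newtonBasis_of_mem (Multiset.mem_cons_self i _),
      Multiset.erase_cons_head, mdiff_fwdDiff]
  · intro s _ hs
    rw [fwdDiff_newtonBasis_of_notMem, Pi.zero_apply, zero_smul]
    intro hi
    exact hs (Finset.mem_image.2 ⟨s.erase i hi, Finset.mem_univ _, Sym.cons_erase hi⟩)

theorem newtonPoly_succ_zero {d : ℕ} {X : Type*} [AddCommGroup X] [Module ℝ X] (p : ℕ)
    (g : (Fin d → ℤ) → X) : newtonPoly (p + 1) g 0 = g 0 := by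
  rw [newtonPoly, Finset.sum_range_succ', Finset.sum_eq_zero, zero_add]
  · rw [Fintype.sum_eq_single (∅ : Sym (Fin d) 0)]
    · change newtonBasis 0 0 • mdiff 0 g 0 = g 0
      rw [newtonBasis_zero_left, one_smul]
      rfl
    · intro s hs
      exact absurd (Subsingleton.elim _ _) hs
  · intro n _
    refine Finset.sum_eq_zero fun s _ => ?_
    rw [newtonBasis_zero_right, zero_smul]
    intro h
    have := s.2
    rw [Sym.val_eq_coe, h] at this
    simp at this

/-- Walk from the origin to `k` along unit steps inside the ball; the number of steps is the `ℓ¹`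
norm, at most `d * ‖k‖`. -/
theorem norm_le_of_fwdDiff_le {d : ℕ} {X : Type*} [NormedAddCommGroup X] (h : (Fin d → ℤ) → X)
    (h0 : h 0 = 0) (r M : ℝ) (hh : ∀ i k, ‖k‖ ≤ r → ‖fwdDiff (unitVec i) h k‖ ≤ M)
    (k : Fin d → ℤ) (hk : ‖k‖ ≤ r) : ‖h k‖ ≤ d * ‖k‖ * M := by
  have hr : 0 ≤ r := (norm_nonneg _).trans hk
  have key : ∀ n : ℕ, ∀ k : Fin d → ℤ, ‖k‖ ≤ r → ∑ i, (k i).natAbs = n → ‖h k‖ ≤ n * M := by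
    intro n
    induction n with
    | zero =>
      intro k _ hs
      have : k = 0 := by
        ext i
        have := (Finset.sum_eq_zero_iff.1 hs) i (Finset.mem_univ i)
        simpa using this
      rw [this, h0]
      simp
    | succ n ih =>
      intro k hk hs
      obtain ⟨i, hi⟩ : ∃ i, k i ≠ 0 := by
        by_contra hne
        push Not at hne
        simp [hne] at hs
      -- Moving one nonzero coordinate towards zero stays in the sup-norm ball and lowers the `ℓ¹`
      -- norm by one.
      have step : ∀ k' : Fin d → ℤ, (∀ j, j ≠ i → k' j = k j) →
          (k' i).natAbs + 1 = (k i).natAbs → ‖k'‖ ≤ r ∧ ‖h k'‖ ≤ n * M := by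
        intro k' h1 h2
        have h3 : ‖k'‖ ≤ r := by
          refine (pi_norm_le_iff_of_nonneg hr).2 fun j => ?_
          refine le_trans ?_ ((norm_le_pi_norm k j).trans hk)
          by_cases hj : j = i
          · subst hj
            rw [Int.norm_eq_abs, Int.norm_eq_abs, ← Int.cast_abs, ← Int.cast_abs]
            have h5 : |k' j| ≤ |k j| := by
              rw [Int.abs_eq_natAbs, Int.abs_eq_natAbs]
              omega
            exact_mod_cast h5
          · rw [h1 j hj]
        refine ⟨h3, ih k' h3 ?_⟩
        rw [← Finset.add_sum_erase _ _ (Finset.mem_univ i)] at hs ⊢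
        have h4 : ∑ j ∈ Finset.univ.erase i, (k' j).natAbs
            = ∑ j ∈ Finset.univ.erase i, (k j).natAbs :=
          Finset.sum_congr rfl fun j hj => by rw [h1 j (Finset.ne_of_mem_erase hj)]
        omega
      push_cast
      rcases lt_or_gt_of_ne hi with hneg | hpos
      · obtain ⟨h1, h2⟩ := step (k + unitVec i)
          (fun j hj => by simp [unitVec, Pi.single_eq_of_ne hj])
          (by simp only [unitVec, Pi.add_apply, Pi.single_eq_same]; omega)
        have h3 := hh i k hk
        have h4 : h k = h (k + unitVec i) - fwdDiff (unitVec i) h k := by simp [fwdDiff]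
        rw [h4]
        refine (norm_sub_le _ _).trans ?_
        linarith
      · obtain ⟨h1, h2⟩ := step (k - unitVec i)
          (fun j hj => by simp [unitVec, Pi.single_eq_of_ne hj])
          (by simp only [unitVec, Pi.sub_apply, Pi.single_eq_same]; omega)
        have h3 := hh i _ h1
        have h4 : h k = h (k - unitVec i) + fwdDiff (unitVec i) h (k - unitVec i) := by
          simp [fwdDiff]
        rw [h4]
        refine (norm_add_le _ _).trans ?_
        linarith
  rcases Nat.eq_zero_or_pos d with hd | hd
  · subst hd
    rw [Subsingleton.elim k 0, h0]
    simp
  have hM : 0 ≤ M := (norm_nonneg _).trans (hh ⟨0, hd⟩ k hk)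
  refine (key _ k hk rfl).trans (mul_le_mul_of_nonneg_right ?_ hM)
  have : ∑ i, (k i).natAbs ≤ d * supAbs k := by
    have h1 : ∑ i, (k i).natAbs ≤ ∑ _i : Fin d, supAbs k :=
      Finset.sum_le_sum fun i _ => Finset.le_sup (f := fun i => (k i).natAbs) (Finset.mem_univ i)
    simpa using h1
  rw [norm_eq_supAbs]
  exact_mod_cast this

/-- The discrete Taylor remainder. The error vanishes at `0`, and by `fwdDiff_newtonPoly` its unit
differences are errors of one order less, so each order costs one factor `d * ‖k‖`. -/
theorem norm_sub_newtonPoly_le {d : ℕ} {X : Type*} [NormedAddCommGroup X] [NormedSpace ℝ X] (p : ℕ)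
    (g : (Fin d → ℤ) → X) (r B : ℝ)
    (hB : ∀ s : Multiset (Fin d), s.card = p → ∀ k, ‖k‖ ≤ r → ‖mdiff s g k‖ ≤ B)
    (k : Fin d → ℤ) (hk : ‖k‖ ≤ r) : ‖g k - newtonPoly p g k‖ ≤ (d * ‖k‖) ^ p * B := by
  induction p generalizing g r k with
  | zero =>
    have := hB 0 rfl k hk
    simpa [newtonPoly, mdiff] using this
  | succ p ih =>
    have h := norm_le_of_fwdDiff_le (fun k => g k - newtonPoly (p + 1) g k)
      (by simp [newtonPoly_succ_zero]) ‖k‖ ((d * ‖k‖) ^ p * B) (fun i k' hk' => ?_) k le_rfl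
    · refine h.trans (le_of_eq ?_)
      ring
    · have h1 : fwdDiff (unitVec i) (fun k => g k - newtonPoly (p + 1) g k) k'
          = fwdDiff (unitVec i) g k' - newtonPoly p (fwdDiff (unitVec i) g) k' := by
        rw [← fwdDiff_newtonPoly]
        simp only [fwdDiff]
        abel
      have h2 : ∀ s : Multiset (Fin d), s.card = p → ∀ k, ‖k‖ ≤ r →
          ‖mdiff s (fwdDiff (unitVec i) g) k‖ ≤ B := by
        intro s hs k hk
        rw [mdiff_fwdDiff]
        exact hB _ (by rw [Multiset.card_cons, hs]) k hk
      rw [h1]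
      refine (ih _ r h2 k' (hk'.trans hk)).trans ?_
      have hB0 : 0 ≤ B := by
        have := h2 (Multiset.replicate p i) (Multiset.card_replicate _ _) k hk
        exact (norm_nonneg _).trans this
      gcongr

end

/-! ### Weighted sums over balls, exteriors and convolutions -/

section

open Finset

section weights

variable {d : ℕ}

theorem log_two_le_log_weight {x : ℝ} (hx : 0 ≤ x) : Real.log 2 ≤ Real.log (x + 2) :=
  Real.log_le_log (by norm_num) (by linarith)

theorem log_weight_pos {x : ℝ} (hx : 0 ≤ x) : 0 < Real.log (x + 2) :=
  Real.log_pos (by linarith)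

theorem inv_weight_le {x y : ℝ} (hx : 0 ≤ x) (h : x / 2 ≤ y) (n : ℕ) :
    ((y + 2) ^ n)⁻¹ ≤ 2 ^ n * ((x + 2) ^ n)⁻¹ := by
  have h1 : (x + 2) / 2 ≤ y + 2 := by linarith
  calc ((y + 2) ^ n)⁻¹ ≤ (((x + 2) / 2) ^ n)⁻¹ := by gcongr
    _ = _ := by rw [div_pow, inv_div, div_eq_mul_inv]

theorem log_pow_le_log_pow_succ {x : ℝ} (hx : 0 ≤ x) (α : ℕ) :
    Real.log (x + 2) ^ α ≤ (Real.log 2)⁻¹ * Real.log (x + 2) ^ (α + 1) := by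
  have h2 : 0 < Real.log 2 := Real.log_pos (by norm_num)
  have h3 := log_two_le_log_weight hx
  have h4 := (log_weight_pos hx).le
  rw [pow_succ, le_inv_mul_iff₀ h2, mul_comm]
  gcongr

theorem sum_center_le (hd : 1 ≤ d) (α : ℕ) : ∃ C : ℝ, 0 ≤ C ∧ ∀ r : ℝ, 0 ≤ r →
    ∀ s : Finset (Fin d → ℤ), (∀ k ∈ s, ‖k‖ ≤ r) →
      ∑ k ∈ s, ((‖k‖ + 2) ^ d)⁻¹ * Real.log (‖k‖ + 2) ^ α ≤ C * Real.log (r + 2) ^ (α + 1) := by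
  obtain ⟨C, hC, h⟩ := sum_inv_pow_ball_le hd
  refine ⟨C, hC, fun r hr s hs => ?_⟩
  calc _ ≤ ∑ k ∈ s, ((‖k‖ + 2) ^ d)⁻¹ * Real.log (r + 2) ^ α := by
        refine Finset.sum_le_sum fun k hk => ?_
        have h1 := hs k hk
        have h2 := (log_weight_pos (norm_nonneg k)).le
        have h3 : Real.log (‖k‖ + 2) ≤ Real.log (r + 2) :=
          Real.log_le_log (by positivity) (by linarith)
        gcongr
    _ ≤ (C * Real.log (r + 2)) * Real.log (r + 2) ^ α := by
        rw [← Finset.sum_mul]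
        exact mul_le_mul_of_nonneg_right (h r hr s hs) (pow_nonneg (log_weight_pos hr).le _)
    _ = _ := by ring

/-- Of the `e` surplus powers, `e - 1` are evaluated at the inner radius `r / 2`, and the last one
makes the tail summable by `sum_tail_le`. -/
theorem sum_outer_le (hd : 1 ≤ d) (α e : ℕ) (he : 1 ≤ e) : ∃ C : ℝ, 0 ≤ C ∧ ∀ r : ℝ, 0 ≤ r →
    ∀ s : Finset (Fin d → ℤ), (∀ k ∈ s, r / 2 ≤ ‖k‖) →
      ∑ k ∈ s, ((‖k‖ + 2) ^ (d + e))⁻¹ * Real.log (‖k‖ + 2) ^ α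
        ≤ C * (((r + 2) ^ e)⁻¹ * Real.log (r + 2) ^ α) := by
  obtain ⟨C, hC, h⟩ := sum_tail_le hd α
  refine ⟨2 ^ (e - 1) * (C * 2), by positivity, fun r hr s hs => ?_⟩
  have hlog : ∀ x : ℝ, 0 ≤ x → 0 ≤ Real.log (x + 2) := fun x hx => (log_weight_pos hx).le
  have hlr := hlog r hr
  calc _ ≤ ∑ k ∈ s, (2 ^ (e - 1) * ((r + 2) ^ (e - 1))⁻¹) *
          (((‖k‖ + 2) ^ (d + 1))⁻¹ * Real.log (‖k‖ + 2) ^ α) := by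
        refine Finset.sum_le_sum fun k hk => ?_
        have h1 : (‖k‖ + 2) ^ (d + e) = (‖k‖ + 2) ^ (e - 1) * (‖k‖ + 2) ^ (d + 1) := by
          rw [← pow_add]; congr 1; omega
        have h2 := hlog _ (norm_nonneg k)
        rw [h1, mul_inv, mul_assoc]
        exact mul_le_mul_of_nonneg_right (inv_weight_le hr (hs k hk) _) (by positivity)
    _ ≤ (2 ^ (e - 1) * ((r + 2) ^ (e - 1))⁻¹) *
          (C * ((r / 2 + 2)⁻¹ * Real.log (r / 2 + 2) ^ α)) := by
        rw [← Finset.mul_sum]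
        exact mul_le_mul_of_nonneg_left (h _ (by linarith) s hs) (by positivity)
    _ ≤ (2 ^ (e - 1) * ((r + 2) ^ (e - 1))⁻¹) *
          (C * ((2 * (r + 2)⁻¹) * Real.log (r + 2) ^ α)) := by
        have h1 : (r / 2 + 2)⁻¹ ≤ 2 * (r + 2)⁻¹ := by
          simpa using inv_weight_le hr (le_refl (r / 2)) 1
        have h2 : Real.log (r / 2 + 2) ≤ Real.log (r + 2) :=
          Real.log_le_log (by linarith) (by linarith)
        have h3 := hlog (r / 2) (by linarith)
        gcongr
    _ = _ := by
        have h1 : (r + 2) ^ e = (r + 2) ^ (e - 1) * (r + 2) := by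
          rw [← pow_succ]; congr 1; omega
        rw [h1, mul_inv]
        ring

theorem log_weight_mul_le {x y : ℝ} (hx : 0 ≤ x) (hy : 0 ≤ y) (h : y ≤ 3 * x) :
    Real.log (y + 2) ≤ 3 * Real.log (x + 2) := by
  have h1 : Real.log ((x + 2) ^ 3) = 3 * Real.log (x + 2) := by
    rw [Real.log_pow]; norm_num
  rw [← h1]
  apply Real.log_le_log (by linarith)
  nlinarith [mul_nonneg hx hx, mul_nonneg (mul_nonneg hx hx) hx]

/-- For `‖ℓ - k‖ ≤ 2‖ℓ‖` the source has size `‖ℓ‖^{-(d+p)}`, and the kernel is compared with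
`‖ℓ‖^{d-a} ‖ℓ - k‖^{-d}`, which uses `a ≤ d` and sums to a logarithm. Farther away `‖ℓ - k‖ ≥ ‖k‖ /
2`, so the product is bounded by a tail in `k` alone. -/
theorem sum_conv_outer_le (hd : 1 ≤ d) (a p α : ℕ) (ha : 1 ≤ a) (had : a ≤ d) :
    ∃ C : ℝ, 0 ≤ C ∧ ∀ ℓ : Fin d → ℤ, ∀ s : Finset (Fin d → ℤ), (∀ k ∈ s, ‖ℓ‖ / 2 ≤ ‖k‖) →
      ∑ k ∈ s, ((‖ℓ - k‖ + 2) ^ a)⁻¹ * (((‖k‖ + 2) ^ (d + p))⁻¹ * Real.log (‖k‖ + 2) ^ α)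
        ≤ C * (((‖ℓ‖ + 2) ^ (a + p))⁻¹ * Real.log (‖ℓ‖ + 2) ^ (α + 1)) := by
  obtain ⟨C₁, hC₁, h₁⟩ := sum_inv_pow_ball_le hd
  obtain ⟨C₂, hC₂, h₂⟩ := sum_outer_le hd α (a + p) (by omega)
  have hl2 : 0 < Real.log 2 := Real.log_pos (by norm_num)
  refine ⟨2 ^ (d + p) * 3 ^ α * 2 ^ (d - a) * (C₁ * 3) + 2 ^ a * (C₂ * (Real.log 2)⁻¹),
    by positivity, fun ℓ s hs => ?_⟩
  set r := ‖ℓ‖ with hrdef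
  have hr : 0 ≤ r := norm_nonneg _
  have hlr : 0 < Real.log (r + 2) := log_weight_pos hr
  classical
  rw [← Finset.sum_filter_add_sum_filter_not s (fun k => ‖ℓ - k‖ ≤ 2 * r), add_mul]
  refine add_le_add ?_ ?_
  · calc _ ≤ ∑ k ∈ s.filter (fun k => ‖ℓ - k‖ ≤ 2 * r),
          (2 ^ (d + p) * ((r + 2) ^ (d + p))⁻¹ * (3 * Real.log (r + 2)) ^ α *
            (2 ^ (d - a) * (r + 2) ^ (d - a))) * ((‖ℓ - k‖ + 2) ^ d)⁻¹ := by
          refine Finset.sum_le_sum fun k hk => ?_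
          obtain ⟨hks, hk2⟩ := Finset.mem_filter.1 hk
          have h1 := inv_weight_le hr (hs k hks) (d + p)
          have h2 : ‖k‖ ≤ 3 * r := by
            have : k = ℓ - (ℓ - k) := by abel
            calc ‖k‖ = ‖ℓ - (ℓ - k)‖ := by rw [← this]
              _ ≤ ‖ℓ‖ + ‖ℓ - k‖ := norm_sub_le _ _
              _ ≤ _ := by linarith
          have h3 := log_weight_mul_le hr (norm_nonneg k) h2
          have h4 : 0 ≤ Real.log (‖k‖ + 2) := (log_weight_pos (norm_nonneg k)).le
          have h5 : ((‖ℓ - k‖ + 2) ^ a)⁻¹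
              ≤ (2 ^ (d - a) * (r + 2) ^ (d - a)) * ((‖ℓ - k‖ + 2) ^ d)⁻¹ := by
            have h6 : (‖ℓ - k‖ + 2) ^ d = (‖ℓ - k‖ + 2) ^ (d - a) * (‖ℓ - k‖ + 2) ^ a := by
              rw [← pow_add]; congr 1; omega
            have h7 : (‖ℓ - k‖ + 2) ^ (d - a) ≤ (2 * (r + 2)) ^ (d - a) := by
              gcongr; linarith
            rw [h6, mul_inv, ← mul_assoc, ← mul_pow]
            refine le_mul_of_one_le_left (by positivity) ?_
            rw [← div_eq_mul_inv, one_le_div (by positivity)]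
            exact h7
          calc _ ≤ ((2 ^ (d - a) * (r + 2) ^ (d - a)) * ((‖ℓ - k‖ + 2) ^ d)⁻¹) *
                ((2 ^ (d + p) * ((r + 2) ^ (d + p))⁻¹) * (3 * Real.log (r + 2)) ^ α) := by gcongr
            _ = _ := by ring
      _ ≤ (2 ^ (d + p) * ((r + 2) ^ (d + p))⁻¹ * (3 * Real.log (r + 2)) ^ α *
            (2 ^ (d - a) * (r + 2) ^ (d - a))) * (C₁ * (3 * Real.log (r + 2))) := by
          rw [← Finset.mul_sum]
          refine mul_le_mul_of_nonneg_left ?_ (by positivity)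
          have h1 := h₁ (2 * r) (by linarith)
            ((s.filter (fun k => ‖ℓ - k‖ ≤ 2 * r)).image fun k => ℓ - k) (by
              intro m hm
              obtain ⟨k, hk, rfl⟩ := Finset.mem_image.1 hm
              exact (Finset.mem_filter.1 hk).2)
          rw [Finset.sum_image fun x _ y _ h => sub_right_injective h] at h1
          refine h1.trans (mul_le_mul_of_nonneg_left ?_ hC₁)
          exact log_weight_mul_le hr (by linarith) (by linarith)
      _ = _ := by
          have h6 : (r + 2) ^ (d + p) = (r + 2) ^ (d - a) * (r + 2) ^ (a + p) := by
            rw [← pow_add]; congr 1; omega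
          rw [h6, mul_inv, mul_pow, pow_succ (Real.log (r + 2))]
          field_simp
  · calc _ ≤ ∑ k ∈ s.filter (fun k => ¬ ‖ℓ - k‖ ≤ 2 * r),
          2 ^ a * (((‖k‖ + 2) ^ (d + (a + p)))⁻¹ * Real.log (‖k‖ + 2) ^ α) := by
          refine Finset.sum_le_sum fun k hk => ?_
          obtain ⟨hks, hk2⟩ := Finset.mem_filter.1 hk
          push Not at hk2
          have h2 : ‖k‖ / 2 ≤ ‖ℓ - k‖ := by
            have : k = ℓ - (ℓ - k) := by abel
            have h3 : ‖k‖ ≤ ‖ℓ‖ + ‖ℓ - k‖ := by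
              calc ‖k‖ = ‖ℓ - (ℓ - k)‖ := by rw [← this]
                _ ≤ ‖ℓ‖ + ‖ℓ - k‖ := norm_sub_le _ _
            linarith
          have h3 := inv_weight_le (norm_nonneg k) h2 a
          have h4 : 0 ≤ Real.log (‖k‖ + 2) := (log_weight_pos (norm_nonneg k)).le
          calc _ ≤ (2 ^ a * ((‖k‖ + 2) ^ a)⁻¹) *
                (((‖k‖ + 2) ^ (d + p))⁻¹ * Real.log (‖k‖ + 2) ^ α) := by gcongr
            _ = _ := by
              rw [show d + (a + p) = a + (d + p) by ring, pow_add _ a (d + p), mul_inv]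
              ring
      _ ≤ 2 ^ a * (C₂ * (((r + 2) ^ (a + p))⁻¹ * Real.log (r + 2) ^ α)) := by
          rw [← Finset.mul_sum]
          refine mul_le_mul_of_nonneg_left ?_ (by positivity)
          exact h₂ r hr _ fun k hk => hs k (Finset.mem_filter.1 hk).1
      _ ≤ 2 ^ a * (C₂ * (((r + 2) ^ (a + p))⁻¹ *
            ((Real.log 2)⁻¹ * Real.log (r + 2) ^ (α + 1)))) := by
          have := log_pow_le_log_pow_succ hr α
          gcongr
      _ = _ := by ring

end weights

end

/-! ### Convolution of a decaying kernel with a source of vanishing moments -/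

section

open Finset

theorem ldiff_sub_left {G X : Type*} [AddCommGroup G] [AddCommGroup X] (L : List G) (g : G → X)
    (ℓ k : G) : ldiff L (fun k => g (ℓ - k)) k = ldiff (L.map Neg.neg) g (ℓ - k) := by
  induction L generalizing k with
  | nil => rfl
  | cons h L ih =>
    rw [ldiff_cons, List.map_cons, ldiff_cons, fwdDiff, fwdDiff, ih, ih]
    congr 2
    abel

section convolution

variable {d : ℕ}

/-- The reflection `k ↦ ℓ - k` only negates the directions of the differences. There are finitely
many multisets of size `n`, so summing their constants over `Sym (Fin d) n` makes the bound uniform.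
-/
theorem exists_mdiff_bound {X : Type*} [NormedAddCommGroup X] (a : ℕ) (g : (Fin d → ℤ) → X)
    (hg : ∀ L : List (Fin d → ℤ), ∃ C : ℝ, ∀ m, ‖ldiff L g m‖ ≤ C * ((‖m‖ + 2) ^ (a + L.length))⁻¹)
    (n : ℕ) : ∃ c : ℝ, 0 ≤ c ∧ ∀ s : Multiset (Fin d), s.card = n → ∀ ℓ k,
      ‖mdiff s (fun k => g (ℓ - k)) k‖ ≤ c * ((‖ℓ - k‖ + 2) ^ (a + n))⁻¹ := by
  choose C hC using hg
  refine ⟨∑ s : Sym (Fin d) n, |C (((s : Multiset (Fin d)).toList.map unitVec).map Neg.neg)|,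
    by positivity, fun s hs ℓ k => ?_⟩
  have h1 : mdiff s (fun k => g (ℓ - k)) k
      = ldiff ((s.toList.map unitVec).map Neg.neg) g (ℓ - k) := by
    rw [← ldiff_sub_left, ← mdiff_coe, Multiset.coe_toList]
  rw [h1]
  have h2 := hC ((s.toList.map unitVec).map Neg.neg) (ℓ - k)
  rw [List.length_map, List.length_map, Multiset.length_toList, hs] at h2
  refine h2.trans (mul_le_mul_of_nonneg_right ?_ (by positivity))
  refine (le_abs_self _).trans ?_
  exact Finset.single_le_sum
    (f := fun s : Sym (Fin d) n =>
      |C (((s : Multiset (Fin d)).toList.map unitVec).map Neg.neg)|)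
    (fun _ _ => abs_nonneg _) (Finset.mem_univ (Sym.mk s hs))

theorem exists_newtonBasis_bound (n : ℕ) : ∃ c : ℝ, 0 ≤ c ∧
    ∀ s : Multiset (Fin d), s.card = n → ∀ k, |newtonBasis s k| ≤ c * (‖k‖ + 2) ^ n := by
  have h := fun s : Multiset (Fin d) => (polyLT_newtonBasis s).growth
  choose C hC0 hC using h
  refine ⟨∑ s : Sym (Fin d) n, C s, Finset.sum_nonneg fun s _ => hC0 s, fun s hs k => ?_⟩
  have h1 := hC s k
  have hw : 0 < ‖k‖ + 2 := by positivity
  rw [hs, pow_succ, ← mul_assoc, mul_comm (‖k‖ + 2)] at h1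
  refine (le_of_mul_le_mul_right h1 hw).trans (mul_le_mul_of_nonneg_right ?_ (by positivity))
  exact Finset.single_le_sum (f := fun s : Sym (Fin d) n => C s)
    (fun s _ => hC0 s) (Finset.mem_univ (Sym.mk s hs))

variable {F : Type*} [NormedAddCommGroup F] [NormedSpace ℂ F]

theorem norm_newtonPoly_apply_le (p : ℕ) (g : (Fin d → ℤ) → F →L[ℂ] F) (k : Fin d → ℤ) (y : F) :
    ‖newtonPoly p g k y‖ ≤ ∑ n ∈ Finset.range p, ∑ s : Sym (Fin d) n,
      |newtonBasis (s : Multiset (Fin d)) k| * ‖mdiff (s : Multiset (Fin d)) g 0‖ * ‖y‖ := by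
  simp only [newtonPoly, _root_.sum_apply]
  refine (norm_sum_le _ _).trans (Finset.sum_le_sum fun n _ => (norm_sum_le _ _).trans
    (Finset.sum_le_sum fun s _ => ?_))
  refine (ContinuousLinearMap.le_opNorm _ _).trans ?_
  rw [norm_smul, Real.norm_eq_abs]

/-- For `‖k‖ ≤ ‖ℓ‖ / 2` the Newton remainder is `O(‖k‖^p ‖ℓ‖^{-(a+p)})`, and against the source it
leaves `‖k‖^{-d}` with a logarithm, whence the extra power of the logarithm. For larger `k` the
kernel is handled by `sum_conv_outer_le`; the degree-`n` part of the polynomial is `O(‖k‖^n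
‖ℓ‖^{-(a+n)})`, and since `n < p` its tail gives the missing `‖ℓ‖^{-(p-n)}`. -/
theorem sum_norm_sub_newtonPoly_le (hd : 1 ≤ d) (a p α : ℕ) (ha : 1 ≤ a) (had : a ≤ d)
    (g : (Fin d → ℤ) → F →L[ℂ] F)
    (hg : ∀ L : List (Fin d → ℤ), ∃ C : ℝ, ∀ m,
      ‖ldiff L g m‖ ≤ C * ((‖m‖ + 2) ^ (a + L.length))⁻¹) :
    ∃ C : ℝ, 0 ≤ C ∧ ∀ (f : (Fin d → ℤ) → F) (K : ℝ), 0 ≤ K →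
      (∀ k, ‖f k‖ ≤ K * (((‖k‖ + 2) ^ (d + p))⁻¹ * Real.log (‖k‖ + 2) ^ α)) →
      ∀ (ℓ : Fin d → ℤ) (t : Finset (Fin d → ℤ)),
        ∑ k ∈ t, ‖(g (ℓ - k) - newtonPoly p (fun k => g (ℓ - k)) k) (f k)‖
          ≤ C * K * (((‖ℓ‖ + 2) ^ (a + p))⁻¹ * Real.log (‖ℓ‖ + 2) ^ (α + 1)) := by
  choose c hc0 hc using exists_mdiff_bound a g hg
  choose b hb0 hb using exists_newtonBasis_bound (d := d)
  obtain ⟨C₁, hC₁, h₁⟩ := sum_center_le hd α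
  obtain ⟨C₂, hC₂, h₂⟩ := sum_conv_outer_le hd a p α ha had
  -- The condition `n < p` is inside the existential so that constants can be chosen for every `n`;
  -- the default `0` for `n ≥ p` never enters.
  have h₃' : ∀ n, ∃ C : ℝ, 0 ≤ C ∧ (n < p → ∀ r : ℝ, 0 ≤ r →
    ∀ s : Finset (Fin d → ℤ), (∀ k ∈ s, r / 2 ≤ ‖k‖) →
      ∑ k ∈ s, ((‖k‖ + 2) ^ (d + (p - n)))⁻¹ * Real.log (‖k‖ + 2) ^ α
        ≤ C * (((r + 2) ^ (p - n))⁻¹ * Real.log (r + 2) ^ α)) := by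
    intro n
    by_cases hn : n < p
    · obtain ⟨C, hC, h⟩ := sum_outer_le hd α (p - n) (by omega)
      exact ⟨C, hC, fun _ => h⟩
    · exact ⟨0, le_rfl, fun h => absurd h hn⟩
  choose C₃ hC₃ h₃ using h₃'
  have hl2 : 0 < Real.log 2 := Real.log_pos (by norm_num)
  refine ⟨d ^ p * c p * 2 ^ (a + p) * C₁ + (c 0 * C₂ + ∑ n ∈ Finset.range p,
    Fintype.card (Sym (Fin d) n) * (b n * c n * (C₃ n * (Real.log 2)⁻¹))),
    add_nonneg (by have := hc0 p; positivity) (add_nonneg (mul_nonneg (hc0 0) hC₂)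
      (Finset.sum_nonneg fun n _ => by have := hc0 n; have := hb0 n; have := hC₃ n; positivity)),
    fun f K hK hf ℓ t => ?_⟩
  set r := ‖ℓ‖ with hrdef
  have hr : 0 ≤ r := norm_nonneg _
  have hlr : 0 < Real.log (r + 2) := log_weight_pos hr
  set Θ := ((r + 2) ^ (a + p))⁻¹ * Real.log (r + 2) ^ (α + 1) with hΘ
  have hΘ0 : 0 ≤ Θ := by positivity
  classical
  rw [← Finset.sum_filter_add_sum_filter_not t (fun k => ‖k‖ ≤ r / 2), add_mul, add_mul]
  have hlog0 : ∀ k : Fin d → ℤ, 0 ≤ Real.log (‖k‖ + 2) := fun k =>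
    (log_weight_pos (norm_nonneg k)).le
  refine add_le_add ?_ ?_
  · calc _ ≤ ∑ k ∈ t.filter (fun k => ‖k‖ ≤ r / 2),
          (d ^ p * (c p * (2 ^ (a + p) * ((r + 2) ^ (a + p))⁻¹)) * K) *
            (((‖k‖ + 2) ^ d)⁻¹ * Real.log (‖k‖ + 2) ^ α) := by
          refine Finset.sum_le_sum fun k hk => ?_
          have hk2 := (Finset.mem_filter.1 hk).2
          have h1 := norm_sub_newtonPoly_le p (fun k => g (ℓ - k)) (r / 2)
            (c p * (2 ^ (a + p) * ((r + 2) ^ (a + p))⁻¹)) (by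
              intro s hs m hm
              refine (hc p s hs ℓ m).trans (mul_le_mul_of_nonneg_left ?_ (hc0 p))
              refine inv_weight_le hr ?_ _
              have := norm_sub_norm_le ℓ m
              linarith) k hk2
          refine (ContinuousLinearMap.le_opNorm _ _).trans ?_
          have h2 : (d * ‖k‖) ^ p ≤ (d : ℝ) ^ p * (‖k‖ + 2) ^ p := by
            rw [mul_pow]
            gcongr
            linarith
          have hcp := hc0 p
          have hlk := hlog0 k
          calc _ ≤ ((d : ℝ) ^ p * (‖k‖ + 2) ^ p * (c p * (2 ^ (a + p) * ((r + 2) ^ (a + p))⁻¹))) *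
                (K * (((‖k‖ + 2) ^ (d + p))⁻¹ * Real.log (‖k‖ + 2) ^ α)) := by
                refine mul_le_mul (h1.trans ?_) (hf k) (norm_nonneg _) (by positivity)
                gcongr
            _ = _ := by
              rw [pow_add _ d p, mul_inv]
              field_simp
      _ ≤ (d ^ p * (c p * (2 ^ (a + p) * ((r + 2) ^ (a + p))⁻¹)) * K) *
            (C₁ * Real.log (r + 2) ^ (α + 1)) := by
          rw [← Finset.mul_sum]
          have hcp := hc0 p
          refine mul_le_mul_of_nonneg_left (h₁ r hr _ fun k hk => ?_) (by positivity)
          have hk2 := (Finset.mem_filter.1 hk).2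
          linarith
      _ = _ := by rw [hΘ]; ring
  · set t₂ := t.filter (fun k => ¬ ‖k‖ ≤ r / 2) with ht₂
    have ht : ∀ k ∈ t₂, r / 2 ≤ ‖k‖ := fun k hk => (not_le.1 (Finset.mem_filter.1 hk).2).le
    calc _ ≤ ∑ k ∈ t₂, (c 0 * K * (((‖ℓ - k‖ + 2) ^ a)⁻¹ *
            (((‖k‖ + 2) ^ (d + p))⁻¹ * Real.log (‖k‖ + 2) ^ α)) +
          ∑ n ∈ Finset.range p, ∑ s : Sym (Fin d) n,
            (b n * c n * ((r + 2) ^ (a + n))⁻¹ * K) *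
              (((‖k‖ + 2) ^ (d + (p - n)))⁻¹ * Real.log (‖k‖ + 2) ^ α)) := by
          refine Finset.sum_le_sum fun k hk => ?_
          rw [sub_apply]
          refine (norm_sub_le _ _).trans (add_le_add ?_ ?_)
          · refine (ContinuousLinearMap.le_opNorm _ _).trans ?_
            have h1 : ‖g (ℓ - k)‖ ≤ c 0 * ((‖ℓ - k‖ + 2) ^ a)⁻¹ := hc 0 0 rfl ℓ k
            have hcp := hc0 0
            calc _ ≤ (c 0 * ((‖ℓ - k‖ + 2) ^ a)⁻¹) *
                  (K * (((‖k‖ + 2) ^ (d + p))⁻¹ * Real.log (‖k‖ + 2) ^ α)) :=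
                  mul_le_mul h1 (hf k) (norm_nonneg _) (by positivity)
              _ = _ := by ring
          · refine (norm_newtonPoly_apply_le _ _ _ _).trans ?_
            refine Finset.sum_le_sum fun n hn => Finset.sum_le_sum fun s _ => ?_
            have hn' : n < p := Finset.mem_range.1 hn
            have h1 := hb n s s.2 k
            have h2 : ‖mdiff (s : Multiset (Fin d)) (fun k => g (ℓ - k)) 0‖
                ≤ c n * ((r + 2) ^ (a + n))⁻¹ := by simpa using hc n s s.2 ℓ 0
            have hbn := hb0 n
            have hcn := hc0 n
            have hlk := hlog0 k
            calc _ ≤ (b n * (‖k‖ + 2) ^ n) * (c n * ((r + 2) ^ (a + n))⁻¹) *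
                  (K * (((‖k‖ + 2) ^ (d + p))⁻¹ * Real.log (‖k‖ + 2) ^ α)) := by
                  gcongr
                  exact hf k
              _ = _ := by
                have h3 : (‖k‖ + 2) ^ (d + p) = (‖k‖ + 2) ^ n * (‖k‖ + 2) ^ (d + (p - n)) := by
                  rw [← pow_add]; congr 1; omega
                rw [h3, mul_inv]
                field_simp
      _ ≤ c 0 * K * (C₂ * Θ) + ∑ n ∈ Finset.range p, ∑ s : Sym (Fin d) n,
            (b n * c n * (C₃ n * (Real.log 2)⁻¹)) * K * Θ := by
          rw [Finset.sum_add_distrib, ← Finset.mul_sum]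
          refine add_le_add (mul_le_mul_of_nonneg_left (h₂ ℓ t₂ ht) (mul_nonneg (hc0 0) hK)) ?_
          rw [Finset.sum_comm]
          refine Finset.sum_le_sum fun n hn => ?_
          rw [Finset.sum_comm]
          refine Finset.sum_le_sum fun s _ => ?_
          have hn' : n < p := Finset.mem_range.1 hn
          have hbn := hb0 n
          have hcn := hc0 n
          have hC3 := hC₃ n
          rw [← Finset.mul_sum]
          calc _ ≤ (b n * c n * ((r + 2) ^ (a + n))⁻¹ * K) *
                (C₃ n * (((r + 2) ^ (p - n))⁻¹ *
                  ((Real.log 2)⁻¹ * Real.log (r + 2) ^ (α + 1)))) := by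
                refine mul_le_mul_of_nonneg_left ((h₃ n hn' r hr t₂ ht).trans ?_) (by positivity)
                have := log_pow_le_log_pow_succ hr α
                gcongr
            _ = _ := by
                have h3 : (r + 2) ^ (a + p) = (r + 2) ^ (a + n) * (r + 2) ^ (p - n) := by
                  rw [← pow_add]; congr 1; omega
                rw [hΘ, h3, mul_inv]
                ring
      _ = _ := by
          simp only [Finset.sum_const, Finset.card_univ, nsmul_eq_mul]
          rw [add_mul, add_mul, Finset.sum_mul, Finset.sum_mul]
          congr 1
          · ring
          · exact Finset.sum_congr rfl fun n _ => by ring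

theorem summable_weight (hd : 1 ≤ d) (α : ℕ) : Summable fun k : Fin d → ℤ =>
    ((‖k‖ + 2) ^ (d + 1))⁻¹ * Real.log (‖k‖ + 2) ^ α := by
  obtain ⟨C, -, h⟩ := sum_tail_le hd α
  exact summable_of_sum_le (fun k => mul_nonneg (by positivity)
    (pow_nonneg (log_weight_pos (norm_nonneg k)).le _))
    fun s => h 0 le_rfl s fun k _ => norm_nonneg k

theorem PolyLT.summable_smul {F : Type*} [NormedAddCommGroup F] (hd : 1 ≤ d) {p α : ℕ} {q : (Fin d → ℤ) → ℝ} (hq : PolyLT p q)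
    {K : ℝ} {f : (Fin d → ℤ) → F}
    (hf : ∀ k, ‖f k‖ ≤ K * (((‖k‖ + 2) ^ (d + p))⁻¹ * Real.log (‖k‖ + 2) ^ α)) :
    Summable fun k => ‖q k‖ * ‖f k‖ := by
  obtain ⟨C, hC, h⟩ := hq.growth
  refine Summable.of_nonneg_of_le (fun k => by positivity) (fun k => ?_)
    ((summable_weight hd α).mul_left (C * K))
  have hw : 0 < ‖k‖ + 2 := by positivity
  have h1 : |q k| ≤ C * ((‖k‖ + 2) ^ p * (‖k‖ + 2)⁻¹) := by
    rw [← mul_assoc, ← div_eq_mul_inv, le_div_iff₀ hw, mul_comm]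
    exact h k
  calc _ ≤ (C * ((‖k‖ + 2) ^ p * (‖k‖ + 2)⁻¹)) *
        (K * (((‖k‖ + 2) ^ (d + p))⁻¹ * Real.log (‖k‖ + 2) ^ α)) :=
        mul_le_mul h1 (hf k) (norm_nonneg _) (by positivity)
    _ = _ := by
      rw [pow_add _ d p, pow_succ _ d, mul_inv, mul_inv]
      field_simp

/-- Each term of the Newton polynomial is a fixed operator times a scalar polynomial of degree `<
p`; the operator moves outside the sum, and what remains is a vanishing moment. -/
theorem tsum_newtonPoly_apply_eq_zero (hd : 1 ≤ d) [CompleteSpace F] (p α : ℕ) {K : ℝ}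
    {f : (Fin d → ℤ) → F}
    (hf : ∀ k, ‖f k‖ ≤ K * (((‖k‖ + 2) ^ (d + p))⁻¹ * Real.log (‖k‖ + 2) ^ α))
    (hmom : ∀ q, PolyLT p q → ∑' k, q k • f k = 0) (g : (Fin d → ℤ) → F →L[ℂ] F) :
    HasSum (fun k => newtonPoly p g k (f k)) 0 := by
  have h1 : ∀ n ∈ Finset.range p, ∀ s ∈ (Finset.univ : Finset (Sym (Fin d) n)), HasSum
      (fun k => (newtonBasis (s : Multiset (Fin d)) k • mdiff (s : Multiset (Fin d)) g 0) (f k))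
      0 := by
    intro n hn s _
    have hq : PolyLT p (newtonBasis (s : Multiset (Fin d))) :=
      (polyLT_newtonBasis _).mono (by
        rw [show (s : Multiset (Fin d)).card = n from s.2]
        exact Finset.mem_range.1 hn)
    have hs : Summable fun k => newtonBasis (s : Multiset (Fin d)) k • f k :=
      Summable.of_norm (by simpa only [norm_smul] using hq.summable_smul hd hf)
    have h2 := hs.hasSum
    rw [hmom _ hq] at h2
    have h3 := h2.mapL (mdiff (s : Multiset (Fin d)) g 0)
    rw [map_zero] at h3
    refine h3.congr_fun fun k => ?_
    rw [smul_apply]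
    exact ((mdiff (s : Multiset (Fin d)) g 0).map_smul_of_tower _ _).symm
  have h4 := hasSum_sum fun n hn => hasSum_sum (h1 n hn)
  simpa [newtonPoly, _root_.sum_apply] using h4

/-- Decay of the convolution of a kernel with a source whose low moments vanish. -/
theorem convolution_decay (hd : 1 ≤ d) [CompleteSpace F] (a p α : ℕ) (ha : 1 ≤ a) (had : a ≤ d)
    (g : (Fin d → ℤ) → F →L[ℂ] F)
    (hg : ∀ L : List (Fin d → ℤ), ∃ C : ℝ, ∀ m,
      ‖ldiff L g m‖ ≤ C * ((‖m‖ + 2) ^ (a + L.length))⁻¹) :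
    ∃ C : ℝ, 0 ≤ C ∧ ∀ (f : (Fin d → ℤ) → F) (K : ℝ), 0 ≤ K →
      (∀ k, ‖f k‖ ≤ K * (((‖k‖ + 2) ^ (d + p))⁻¹ * Real.log (‖k‖ + 2) ^ α)) →
      (∀ q, PolyLT p q → ∑' k, q k • f k = 0) →
      ∀ ℓ : Fin d → ℤ, ‖∑' k, g (ℓ - k) (f k)‖
          ≤ C * K * (((‖ℓ‖ + 2) ^ (a + p))⁻¹ * Real.log (‖ℓ‖ + 2) ^ (α + 1)) := by
  obtain ⟨C, hC, h⟩ := sum_norm_sub_newtonPoly_le hd a p α ha had g hg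
  refine ⟨C, hC, fun f K hK hf hmom ℓ => ?_⟩
  have hb := h f K hK hf ℓ
  have hs : Summable fun k => ‖(g (ℓ - k) - newtonPoly p (fun k => g (ℓ - k)) k) (f k)‖ :=
    summable_of_sum_le (fun _ => norm_nonneg _) hb
  -- Adding back the polynomial part, whose sum is zero, turns the remainder sum into the
  -- convolution.
  have h1 := hs.of_norm.hasSum.add
    (tsum_newtonPoly_apply_eq_zero hd p α hf hmom (fun k => g (ℓ - k)))
  simp only [sub_apply, sub_add_cancel, add_zero] at h1
  rw [h1.tsum_eq]
  simp only [sub_apply] at hs hb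
  exact (norm_tsum_le_tsum_norm hs).trans (hs.tsum_le_of_sum_le hb)

end convolution

end

/-! ### Fourier representation on shifted contours -/

section

open MeasureTheory Finset

section fourier

variable {d : ℕ}

/-- The exponential character `ℓ ↦ exp ((2πix - η)·ℓ)`. -/
noncomputable def expChar (x η : Fin d → ℝ) (ℓ : Fin d → ℤ) : ℂ :=
  Complex.exp (∑ i, (2 * Real.pi * Complex.I * x i - η i) * ℓ i)

theorem expChar_add (x η : Fin d → ℝ) (ℓ m : Fin d → ℤ) :
    expChar x η (ℓ + m) = expChar x η ℓ * expChar x η m := by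
  rw [expChar, expChar, expChar, ← Complex.exp_add, ← Finset.sum_add_distrib]
  congr 1
  refine Finset.sum_congr rfl fun i _ => ?_
  rw [Pi.add_apply, Int.cast_add, mul_add]

theorem expChar_zero (x η : Fin d → ℝ) : expChar x η 0 = 1 := by
  simp [expChar]

theorem continuous_expChar (η : Fin d → ℝ) (ℓ : Fin d → ℤ) :
    Continuous fun x => expChar x η ℓ := by
  unfold expChar
  fun_prop

theorem norm_expChar (x η : Fin d → ℝ) (ℓ : Fin d → ℤ) :
    ‖expChar x η ℓ‖ = Real.exp (-∑ i, η i * ℓ i) := by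
  rw [expChar, Complex.norm_exp]
  congr 1
  rw [Complex.re_sum, ← Finset.sum_neg_distrib]
  refine Finset.sum_congr rfl fun i _ => ?_
  simp [Complex.mul_re, Complex.mul_im]

/-- Lebesgue measure on the unit cube of frequencies. -/
noncomputable def cubeMeasure (d : ℕ) : Measure (Fin d → ℝ) :=
  Measure.pi fun _ => volume.restrict (Set.Ioc (-(1 / 2) : ℝ) (1 / 2))

theorem cubeMeasure_eq_restrict :
    cubeMeasure d = volume.restrict (Set.univ.pi fun _ => Set.Ioc (-(1 / 2) : ℝ) (1 / 2)) := by
  rw [cubeMeasure, volume_pi, Measure.restrict_pi_pi]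

theorem ae_cubeMeasure_norm_le : ∀ᵐ x ∂cubeMeasure d, ‖x‖ ≤ 1 / 2 := by
  rw [cubeMeasure_eq_restrict]
  refine (ae_restrict_mem (MeasurableSet.univ_pi fun _ => measurableSet_Ioc)).mono fun x hx => ?_
  refine (pi_norm_le_iff_of_nonneg (by norm_num)).2 fun i => ?_
  have := hx i (Set.mem_univ i)
  rw [Real.norm_eq_abs, abs_le]
  exact ⟨this.1.le, this.2⟩

theorem integrable_cubeMeasure {E : Type*} [NormedAddCommGroup E] {h : (Fin d → ℝ) → E}
    (hh : Continuous h) : Integrable h (cubeMeasure d) := by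
  rw [cubeMeasure_eq_restrict]
  have h1 : IsCompact (Set.univ.pi fun _ : Fin d => Set.Icc (-(1 / 2) : ℝ) (1 / 2)) :=
    isCompact_univ_pi fun _ => isCompact_Icc
  exact (hh.continuousOn.integrableOn_compact h1).mono_set
    (Set.pi_mono fun _ _ => Set.Ioc_subset_Icc_self)

theorem integral_expChar_one {n : ℤ} (hn : n ≠ 0) (η : ℝ) :
    ∫ t in Set.Ioc (-(1 / 2) : ℝ) (1 / 2),
      Complex.exp ((2 * Real.pi * Complex.I * t - η) * n) = 0 := by
  rw [← intervalIntegral.integral_of_le (by norm_num)]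
  have h1 : ∀ t : ℝ, Complex.exp ((2 * Real.pi * Complex.I * t - η) * n)
      = Complex.exp (-η * n) * Complex.exp ((2 * Real.pi * Complex.I * n) * t) := by
    intro t
    rw [← Complex.exp_add]
    congr 1
    ring
  simp only [h1]
  rw [intervalIntegral.integral_const_mul, integral_exp_mul_complex]
  · have h2 : Complex.exp (2 * Real.pi * Complex.I * n * ((1 / 2 : ℝ) : ℂ))
        = Complex.exp (2 * Real.pi * Complex.I * n * ((-(1 / 2) : ℝ) : ℂ)) := by
      rw [Complex.exp_eq_exp_iff_exists_int]
      refine ⟨n, ?_⟩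
      push_cast
      ring
    rw [h2]
    simp
  · have := Complex.two_pi_I_ne_zero
    exact mul_ne_zero this (by exact_mod_cast hn)

/-- Orthogonality holds for every tilt `η`: at `ℓ = 0` the tilt disappears, elsewhere integration
over a full period gives zero. The same lattice function is therefore represented on all contours,
without any contour deformation. -/
theorem integral_expChar (η : Fin d → ℝ) (ℓ : Fin d → ℤ) :
    ∫ x, expChar x η ℓ ∂cubeMeasure d = if ℓ = 0 then 1 else 0 := by
  have h1 : ∀ x : Fin d → ℝ, expChar x η ℓ
      = ∏ i, Complex.exp ((2 * Real.pi * Complex.I * x i - η i) * ℓ i) := fun x => by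
    rw [expChar, Complex.exp_sum]
  simp only [h1]
  rw [cubeMeasure, integral_fintype_prod_eq_prod (𝕜 := ℂ)
    (fun i (t : ℝ) => Complex.exp ((2 * Real.pi * Complex.I * t - η i) * ℓ i))]
  split_ifs with h
  · refine Finset.prod_eq_one fun i _ => ?_
    simp [h]
    norm_num
  · obtain ⟨i, hi⟩ := Function.ne_iff.1 h
    exact Finset.prod_eq_zero (Finset.mem_univ i) (integral_expChar_one hi _)

/-- Since `∑ x_i² ≤ d ‖x‖²` for the sup norm, the integrand is dominated by a product of
one-dimensional Gaussians of parameter `b / d`. -/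
theorem integral_gaussian_cube_le {b : ℝ} (hb : 0 < b) :
    ∫ x, Real.exp (-b * ‖x‖ ^ 2) ∂cubeMeasure d ≤ √(Real.pi * d / b) ^ d := by
  rcases Nat.eq_zero_or_pos d with hd | hd
  · subst hd
    have : ∀ x : Fin 0 → ℝ, Real.exp (-b * ‖x‖ ^ 2) = 1 := fun x => by
      rw [Subsingleton.elim x 0]; simp
    simp only [this]
    simp [cubeMeasure, Measure.real]
  have hd' : (0 : ℝ) < d := by exact_mod_cast hd
  have h1 : ∀ x : Fin d → ℝ, Real.exp (-b * ‖x‖ ^ 2) ≤ ∏ i, Real.exp (-(b / d) * x i ^ 2) := by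
    intro x
    rw [← Real.exp_sum, ← Finset.mul_sum]
    apply Real.exp_le_exp.2
    have h2 : ∑ i, x i ^ 2 ≤ d * ‖x‖ ^ 2 := by
      have h3 : ∀ i ∈ Finset.univ, x i ^ 2 ≤ ‖x‖ ^ 2 := fun i _ => by
        rw [← sq_abs]
        exact pow_le_pow_left₀ (abs_nonneg _) (norm_le_pi_norm x i) 2
      simpa using Finset.sum_le_sum h3
    have h4 : b / d * ∑ i, x i ^ 2 ≤ b / d * (d * ‖x‖ ^ 2) := by gcongr
    have h5 : b / d * (d * ‖x‖ ^ 2) = b * ‖x‖ ^ 2 := by field_simp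
    linarith
  have hint : ∀ c : ℝ, 0 < c → Integrable fun t : ℝ => Real.exp (-c * t ^ 2) :=
    fun c hc => integrable_exp_neg_mul_sq hc
  calc _ ≤ ∫ x, ∏ i, Real.exp (-(b / d) * x i ^ 2) ∂cubeMeasure d := by
        refine integral_mono (integrable_cubeMeasure (by fun_prop))
          (integrable_cubeMeasure (by fun_prop)) h1
    _ = ∏ _i : Fin d, ∫ t in Set.Ioc (-(1 / 2) : ℝ) (1 / 2), Real.exp (-(b / d) * t ^ 2) := by
        rw [cubeMeasure, integral_fintype_prod_eq_prod (𝕜 := ℝ)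
          (fun _ (t : ℝ) => Real.exp (-(b / d) * t ^ 2))]
    _ ≤ ∏ _i : Fin d, √(Real.pi * d / b) := by
        refine Finset.prod_le_prod (fun _ _ => integral_nonneg fun _ => (Real.exp_pos _).le)
          fun _ _ => ?_
        rw [show Real.pi * d / b = Real.pi / (b / d) by field_simp, ← integral_gaussian]
        exact setIntegral_le_integral (hint _ (by positivity))
          (ae_of_all _ fun _ => (Real.exp_pos _).le)
    _ = _ := by simp

/-- `h` is the inverse Fourier transform of the continuous symbol `Q` along the contour shifted
by `η`. -/
def IsFourierRep {E : Type*} [NormedAddCommGroup E] [NormedSpace ℂ E] (η : Fin d → ℝ)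
    (Q : (Fin d → ℝ) → E) (h : (Fin d → ℤ) → E) : Prop :=
  Continuous Q ∧ ∀ ℓ, h ℓ = ∫ x, expChar x η ℓ • Q x ∂cubeMeasure d

namespace IsFourierRep

variable {E : Type*} [NormedAddCommGroup E] [NormedSpace ℂ E] {η : Fin d → ℝ}
  {Q Q' : (Fin d → ℝ) → E} {h h' : (Fin d → ℤ) → E}

theorem integrable (H : IsFourierRep η Q h) (ℓ : Fin d → ℤ) :
    Integrable (fun x => expChar x η ℓ • Q x) (cubeMeasure d) :=
  integrable_cubeMeasure ((continuous_expChar η ℓ).smul H.1)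

theorem sub (H : IsFourierRep η Q h) (H' : IsFourierRep η Q' h') :
    IsFourierRep η (fun x => Q x - Q' x) fun ℓ => h ℓ - h' ℓ := by
  refine ⟨H.1.sub H'.1, fun ℓ => ?_⟩
  simp only [smul_sub]
  rw [integral_sub (H.integrable ℓ) (H'.integrable ℓ), ← H.2, ← H'.2]

theorem sum {ι : Type*} (s : Finset ι) {Q : ι → (Fin d → ℝ) → E} {h : ι → (Fin d → ℤ) → E}
    (H : ∀ i, IsFourierRep η (Q i) (h i)) :
    IsFourierRep η (fun x => ∑ i ∈ s, Q i x) fun ℓ => ∑ i ∈ s, h i ℓ := by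
  refine ⟨continuous_finsetSum _ fun i _ => (H i).1, fun ℓ => ?_⟩
  simp only [Finset.smul_sum]
  rw [integral_finsetSum _ fun i _ => (H i).integrable ℓ]
  exact Finset.sum_congr rfl fun i _ => (H i).2 ℓ

theorem mapL [CompleteSpace E] (T : E →L[ℂ] E) (H : IsFourierRep η Q h) :
    IsFourierRep η (fun x => T (Q x)) fun ℓ => T (h ℓ) := by
  refine ⟨T.continuous.comp H.1, fun ℓ => ?_⟩
  change T (h ℓ) = ∫ x, expChar x η ℓ • T (Q x) ∂cubeMeasure d
  rw [H.2, ← T.integral_comp_comm (H.integrable ℓ)]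
  simp only [map_smul]

theorem fwdDiff (H : IsFourierRep η Q h) (s : Fin d → ℤ) :
    IsFourierRep η (fun x => (expChar x η s - 1) • Q x) (fwdDiff s h) := by
  refine ⟨((continuous_expChar η s).sub continuous_const).smul H.1, fun ℓ => ?_⟩
  rw [_root_.fwdDiff, H.2, H.2, ← integral_sub (H.integrable _) (H.integrable _)]
  congr 1
  ext x
  rw [expChar_add, smul_smul, mul_sub, mul_one, sub_smul]

theorem ldiff (H : IsFourierRep η Q h) (L : List (Fin d → ℤ)) :
    IsFourierRep η (fun x => (L.map fun s => expChar x η s - 1).prod • Q x) (ldiff L h) := by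
  induction L with
  | nil => simpa using H
  | cons s L ih => simpa [mul_smul] using ih.fwdDiff s

end IsFourierRep

end fourier

end

/-! ### The symbol on shifted contours and the contraction estimate -/

section

open MeasureTheory Finset

section kernel

variable {d : ℕ} {ι : Type*} [Fintype ι] {F : Type*} [NormedAddCommGroup F]
  [InnerProductSpace ℂ F]

/-- The lattice operator `∑ A_{ρσ} D_{-σ} D_ρ`. -/
noncomputable def latOp (r : ι → Fin d → ℤ) (A : ι → ι → F →L[ℂ] F) (v : (Fin d → ℤ) → F)
    (ℓ : Fin d → ℤ) : F :=
  ∑ ρ, ∑ σ, A ρ σ (fwdDiff (-(r σ)) (fwdDiff (r ρ) v) ℓ)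

/-- The kernel of `(1 - τ L)ⁿ`. -/
noncomputable def iterKernel (r : ι → Fin d → ℤ) (A : ι → ι → F →L[ℂ] F) (τ : ℝ) :
    ℕ → (Fin d → ℤ) → F →L[ℂ] F
  | 0, ℓ => if ℓ = 0 then 1 else 0
  | n + 1, ℓ => iterKernel r A τ n ℓ - (τ : ℂ) • ∑ ρ, ∑ σ,
      A ρ σ * fwdDiff (-(r σ)) (fwdDiff (r ρ) (iterKernel r A τ n)) ℓ

/-- The Fourier symbol of `latOp` on the shifted contour. -/
noncomputable def latSymbol (r : ι → Fin d → ℤ) (A : ι → ι → F →L[ℂ] F) (x η : Fin d → ℝ) :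
    F →L[ℂ] F :=
  ∑ ρ, ∑ σ, ((expChar x η (-(r σ)) - 1) * (expChar x η (r ρ) - 1)) • A ρ σ

/-- The recursion of `iterKernel` multiplies the symbol by `1 - τ L̂`, starting from the delta
kernel. The tilt `η` is free, so it may later be chosen depending on both `n` and `ℓ`. -/
theorem isFourierRep_iterKernel [CompleteSpace F] (r : ι → Fin d → ℤ) (A : ι → ι → F →L[ℂ] F)
    (τ : ℝ) (η : Fin d → ℝ) (n : ℕ) :
    IsFourierRep η (fun x => (1 - (τ : ℂ) • latSymbol r A x η) ^ n) (iterKernel r A τ n) := by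
  induction n with
  | zero =>
    refine ⟨by simpa using continuous_const, fun ℓ => ?_⟩
    simp only [pow_zero]
    rw [integral_smul_const, integral_expChar, iterKernel]
    split_ifs <;> simp
  | succ n ih =>
    have h1 := ih.sub (IsFourierRep.mapL ((τ : ℂ) • ContinuousLinearMap.id ℂ (F →L[ℂ] F))
      (IsFourierRep.sum Finset.univ fun ρ => IsFourierRep.sum Finset.univ fun σ =>
        (((ih.fwdDiff (r ρ)).fwdDiff (-(r σ))).mapL
          (ContinuousLinearMap.mul ℂ (F →L[ℂ] F) (A ρ σ)))))
    convert h1 using 1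
    · ext1 x
      rw [pow_succ', sub_mul, one_mul, smul_mul_assoc, latSymbol, Finset.sum_mul]
      congr 2
      refine Finset.sum_congr rfl fun ρ _ => ?_
      rw [Finset.sum_mul]
      refine Finset.sum_congr rfl fun σ _ => ?_
      rw [ContinuousLinearMap.mul_apply', smul_smul, smul_mul_assoc, mul_smul_comm]
    · ext1 ℓ
      rfl

theorem exists_norm_expChar_sub_one_le (s : Fin d → ℤ) : ∃ C : ℝ, 0 ≤ C ∧ ∀ x η : Fin d → ℝ,
    ‖x‖ ≤ 1 → ‖η‖ ≤ 1 → ‖expChar x η s - 1‖ ≤ C * (‖x‖ + ‖η‖) := by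
  set S : ℝ := ∑ i, |(s i : ℝ)| with hS
  have hS0 : 0 ≤ S := Finset.sum_nonneg fun i _ => abs_nonneg _
  have hpi := Real.pi_pos
  refine ⟨(2 * Real.pi + 1) * S * Real.exp ((2 * Real.pi + 1) * S * 2), by positivity,
    fun x η hx hη => ?_⟩
  set w := ∑ i, (2 * Real.pi * Complex.I * x i - η i) * (s i : ℂ) with hw
  have hwn : ‖w‖ ≤ (2 * Real.pi + 1) * S * (‖x‖ + ‖η‖) := by
    rw [hS, Finset.mul_sum, Finset.sum_mul]
    refine (norm_sum_le _ _).trans (Finset.sum_le_sum fun i _ => ?_)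
    rw [norm_mul]
    have h1 : ‖(2 * Real.pi * Complex.I * x i - η i : ℂ)‖ ≤ (2 * Real.pi + 1) * (‖x‖ + ‖η‖) := by
      refine (norm_sub_le _ _).trans ?_
      have h2 : ‖(2 * Real.pi * Complex.I * x i : ℂ)‖ = 2 * Real.pi * |x i| := by
        simp [abs_of_pos hpi]
      have h3 : ‖(η i : ℂ)‖ = |η i| := by simp
      rw [h2, h3]
      have h4 : |x i| ≤ ‖x‖ := norm_le_pi_norm x i
      have h5 : |η i| ≤ ‖η‖ := norm_le_pi_norm η i
      have h6 : 2 * Real.pi * |x i| ≤ 2 * Real.pi * ‖x‖ := by gcongr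
      have h7 : 0 ≤ 2 * Real.pi * ‖η‖ := by positivity
      have h8 := norm_nonneg x
      linarith
    have h2 : ‖(s i : ℂ)‖ = |(s i : ℝ)| := by simp
    rw [h2]
    calc _ ≤ (2 * Real.pi + 1) * (‖x‖ + ‖η‖) * |(s i : ℝ)| := by gcongr
      _ = _ := by ring
  have h1 : ‖Complex.exp w - 1‖ ≤ ‖w‖ * Real.exp ‖w‖ := by
    simpa using Complex.norm_exp_sub_sum_le_norm_mul_exp w 1
  refine h1.trans ?_
  have h2 : ‖w‖ ≤ (2 * Real.pi + 1) * S * 2 := by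
    refine hwn.trans ?_
    gcongr
    linarith
  calc ‖w‖ * Real.exp ‖w‖
      ≤ ((2 * Real.pi + 1) * S * (‖x‖ + ‖η‖)) * Real.exp ((2 * Real.pi + 1) * S * 2) := by gcongr
    _ = _ := by ring

theorem exists_norm_expChar_sub_le (s : Fin d → ℤ) : ∃ C : ℝ, 0 ≤ C ∧ ∀ x η : Fin d → ℝ,
    ‖η‖ ≤ 1 → ‖expChar x η s - expChar x 0 s‖ ≤ C * ‖η‖ := by
  obtain ⟨C, hC, h⟩ := exists_norm_expChar_sub_one_le s
  refine ⟨C, hC, fun x η hη => ?_⟩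
  have h1 : expChar x η s = expChar x 0 s * expChar 0 η s := by
    rw [expChar, expChar, expChar, ← Complex.exp_add, ← Finset.sum_add_distrib]
    congr 1
    refine Finset.sum_congr rfl fun i _ => ?_
    simp
    ring
  have h2 : expChar x η s - expChar x 0 s = expChar x 0 s * (expChar 0 η s - 1) := by
    rw [h1]; ring
  have h3 := h 0 η (by simp) hη
  rw [h2, norm_mul, norm_expChar]
  simpa using h3

/-- Each term is a product of two factors vanishing at frequency zero. Hence the symbol is quadratic
there, and changing the tilt replaces only one of the two small factors by `‖η‖`. -/
theorem exists_norm_latSymbol_le (r : ι → Fin d → ℤ) (A : ι → ι → F →L[ℂ] F) :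
    ∃ C : ℝ, 0 ≤ C ∧ ∀ x η : Fin d → ℝ, ‖x‖ ≤ 1 → ‖η‖ ≤ 1 →
      ‖latSymbol r A x η‖ ≤ C * (‖x‖ + ‖η‖) ^ 2 ∧
      ‖latSymbol r A x η - latSymbol r A x 0‖ ≤ C * (‖η‖ * (‖x‖ + ‖η‖)) := by
  choose c hc0 hc using fun s : Fin d → ℤ => exists_norm_expChar_sub_one_le s
  choose e he0 he using fun s : Fin d → ℤ => exists_norm_expChar_sub_le s
  refine ⟨(∑ ρ, ∑ σ, c (-(r σ)) * c (r ρ) * ‖A ρ σ‖) +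
    ∑ ρ, ∑ σ, (e (-(r σ)) * c (r ρ) + c (-(r σ)) * e (r ρ)) * ‖A ρ σ‖, ?_, fun x η hx hη => ?_⟩
  · refine add_nonneg (Finset.sum_nonneg fun ρ _ => Finset.sum_nonneg fun σ _ => ?_)
      (Finset.sum_nonneg fun ρ _ => Finset.sum_nonneg fun σ _ => ?_)
    · have := hc0 (-(r σ)); have := hc0 (r ρ); positivity
    · have := hc0 (-(r σ)); have := hc0 (r ρ); have := he0 (-(r σ)); have := he0 (r ρ); positivity
  have hs1 : 0 ≤ ∑ ρ, ∑ σ, c (-(r σ)) * c (r ρ) * ‖A ρ σ‖ :=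
    Finset.sum_nonneg fun ρ _ => Finset.sum_nonneg fun σ _ => by
      have := hc0 (-(r σ)); have := hc0 (r ρ); positivity
  have hs2 : 0 ≤ ∑ ρ, ∑ σ, (e (-(r σ)) * c (r ρ) + c (-(r σ)) * e (r ρ)) * ‖A ρ σ‖ :=
    Finset.sum_nonneg fun ρ _ => Finset.sum_nonneg fun σ _ => by
      have := hc0 (-(r σ)); have := hc0 (r ρ); have := he0 (-(r σ)); have := he0 (r ρ); positivity
  have hx0 := norm_nonneg x
  have hη0 := norm_nonneg η
  constructor
  · refine le_trans ?_ (mul_le_mul_of_nonneg_right (le_add_of_nonneg_right hs2) (by positivity))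
    rw [latSymbol, Finset.sum_mul]
    refine (norm_sum_le _ _).trans (Finset.sum_le_sum fun ρ _ => ?_)
    rw [Finset.sum_mul]
    refine (norm_sum_le _ _).trans (Finset.sum_le_sum fun σ _ => ?_)
    rw [norm_smul, norm_mul]
    have h1 := hc (-(r σ)) x η hx hη
    have h2 := hc (r ρ) x η hx hη
    have h3 := hc0 (-(r σ))
    have h4 := hc0 (r ρ)
    calc _ ≤ (c (-(r σ)) * (‖x‖ + ‖η‖)) * (c (r ρ) * (‖x‖ + ‖η‖)) * ‖A ρ σ‖ := by gcongr
      _ = _ := by ring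
  · refine le_trans ?_ (mul_le_mul_of_nonneg_right (le_add_of_nonneg_left hs1) (by positivity))
    rw [latSymbol, latSymbol, ← Finset.sum_sub_distrib, Finset.sum_mul]
    refine (norm_sum_le _ _).trans (Finset.sum_le_sum fun ρ _ => ?_)
    rw [← Finset.sum_sub_distrib, Finset.sum_mul]
    refine (norm_sum_le _ _).trans (Finset.sum_le_sum fun σ _ => ?_)
    rw [← sub_smul, norm_smul]
    set a := expChar x η (-(r σ))
    set b := expChar x η (r ρ)
    set a' := expChar x 0 (-(r σ))
    set b' := expChar x 0 (r ρ)
    have h0 : (a - 1) * (b - 1) - (a' - 1) * (b' - 1) = (a - a') * (b - 1) + (a' - 1) * (b - b') := by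
      ring
    have h1 : ‖a - a'‖ ≤ e (-(r σ)) * ‖η‖ := he _ x η hη
    have h2 : ‖b - b'‖ ≤ e (r ρ) * ‖η‖ := he _ x η hη
    have h3 : ‖b - 1‖ ≤ c (r ρ) * (‖x‖ + ‖η‖) := hc _ x η hx hη
    have h4 : ‖a' - 1‖ ≤ c (-(r σ)) * (‖x‖ + ‖η‖) := by
      refine (hc (-(r σ)) x 0 hx (by simp)).trans
        (mul_le_mul_of_nonneg_left ?_ (hc0 _))
      simp
    have h5 := hc0 (-(r σ))
    have h6 := hc0 (r ρ)
    have h7 := he0 (-(r σ))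
    have h8 := he0 (r ρ)
    rw [h0]
    calc _ ≤ ((e (-(r σ)) * ‖η‖) * (c (r ρ) * (‖x‖ + ‖η‖)) +
          (c (-(r σ)) * (‖x‖ + ‖η‖)) * (e (r ρ) * ‖η‖)) * ‖A ρ σ‖ := by
          refine mul_le_mul_of_nonneg_right ((norm_add_le _ _).trans ?_) (norm_nonneg _)
          rw [norm_mul, norm_mul]
          gcongr
      _ = _ := by ring

/-- Coercivity of the symbol on the unit cube of frequencies. -/
def SymbolCoercive (r : ι → Fin d → ℤ) (A : ι → ι → F →L[ℂ] F) : Prop :=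
  ∃ c : ℝ, 0 < c ∧ ∀ x : Fin d → ℝ, ‖x‖ ≤ 1 / 2 → ∀ a : F,
    c * ‖x‖ ^ 2 * ‖a‖ ^ 2 ≤ (inner ℂ a (latSymbol r A x 0 a)).re

/-- Expand `‖a - τ L̂ a‖²`: coercivity makes the linear term at most `-2τc‖x‖²` up to tilt errors,
and `τ` is small enough to absorb the quadratic term. Only the real part of `⟨a, L̂ a⟩` matters, so
the shifted symbol need not be self-adjoint. -/
theorem exists_contraction {r : ι → Fin d → ℤ} {A : ι → ι → F →L[ℂ] F}
    (hco : SymbolCoercive r A) : ∃ τ c C : ℝ, 0 < τ ∧ 0 < c ∧ 0 ≤ C ∧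
      ∀ x η : Fin d → ℝ, ‖x‖ ≤ 1 / 2 → ‖η‖ ≤ 1 →
        ‖1 - (τ : ℂ) • latSymbol r A x η‖ ≤ Real.exp (-c * ‖x‖ ^ 2 + C * ‖η‖ ^ 2) := by
  obtain ⟨c, hc, hcoer⟩ := hco
  obtain ⟨D, hD, hbound⟩ := exists_norm_latSymbol_le r A
  -- Since `(‖x‖ + ‖η‖)² ≤ 9/4`, one has `‖L̂ a‖² ≤ (9/2) D² (‖x‖² + ‖η‖²) ‖a‖²`; this `τ` turns the
  -- quadratic term into at most `τ (c/2) (‖x‖² + ‖η‖²) ‖a‖²`.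
  set τ := c / (9 * D ^ 2 + 1) with hτ
  have hτ0 : 0 < τ := by positivity
  have hτD : τ * D ^ 2 * (9 / 2) ≤ c / 2 := by
    rw [hτ, div_mul_eq_mul_div, div_mul_eq_mul_div, div_le_div_iff₀ (by positivity) (by positivity)]
    nlinarith
  -- The coefficients of `‖η‖²` come from the tilt error, from Young's inequality for the cross term
  -- `2D‖η‖‖x‖`, and from the quadratic term. The outer halves come from taking the square root.
  refine ⟨τ, τ * c / 2, τ * (2 * D + 2 * D ^ 2 / c + c / 2) / 2, hτ0, by positivity,
    by positivity, fun x η hx hη => ?_⟩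
  obtain ⟨h1, h2⟩ := hbound x η (by linarith) hη
  refine ContinuousLinearMap.opNorm_le_bound _ (Real.exp_pos _).le fun a => ?_
  set y := ‖x‖ with hy
  set t := ‖η‖ with ht
  have hy0 : 0 ≤ y := norm_nonneg _
  have ht0 : 0 ≤ t := norm_nonneg _
  set b := latSymbol r A x η a with hb
  have hb1 : ‖b‖ ≤ D * (y + t) ^ 2 * ‖a‖ :=
    (ContinuousLinearMap.le_opNorm _ _).trans (by gcongr)
  have hb2 : (c * y ^ 2 - D * (t * (y + t))) * ‖a‖ ^ 2 ≤ (inner ℂ a b).re := by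
    have h3 := hcoer x hx a
    have h4 : b = latSymbol r A x 0 a + (latSymbol r A x η - latSymbol r A x 0) a := by
      rw [sub_apply]; abel
    have h5 : -(D * (t * (y + t)) * ‖a‖ ^ 2)
        ≤ (inner ℂ a ((latSymbol r A x η - latSymbol r A x 0) a)).re := by
      have h6 := (Complex.abs_re_le_norm
        (inner ℂ a ((latSymbol r A x η - latSymbol r A x 0) a))).trans (norm_inner_le_norm _ _)
      have h7 : ‖(latSymbol r A x η - latSymbol r A x 0) a‖ ≤ D * (t * (y + t)) * ‖a‖ :=
        (ContinuousLinearMap.le_opNorm _ _).trans (by gcongr)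
      have h8 : ‖a‖ * ‖(latSymbol r A x η - latSymbol r A x 0) a‖
          ≤ ‖a‖ * (D * (t * (y + t)) * ‖a‖) := by gcongr
      have h9 := (abs_le.1 (h6.trans h8)).1
      calc _ = -(‖a‖ * (D * (t * (y + t)) * ‖a‖)) := by ring
        _ ≤ _ := h9
    rw [h4, inner_add_right, Complex.add_re]
    linarith
  have hsq : ‖a - (τ : ℂ) • b‖ ^ 2 = ‖a‖ ^ 2 - 2 * τ * (inner ℂ a b).re + τ ^ 2 * ‖b‖ ^ 2 := by
    have := @norm_sub_sq ℂ F _ _ _ a ((τ : ℂ) • b)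
    rw [this, inner_smul_right, norm_smul, mul_pow]
    simp
    ring
  have hexp : 1 - τ * c * y ^ 2 + τ * (2 * D + 2 * D ^ 2 / c + c / 2) * t ^ 2
      ≤ Real.exp (-(τ * c / 2) * y ^ 2 + τ * (2 * D + 2 * D ^ 2 / c + c / 2) / 2 * t ^ 2) ^ 2 := by
    rw [← Real.exp_nat_mul]
    refine le_trans (le_of_eq ?_) (Real.add_one_le_exp _)
    push_cast
    ring
  have hmain : ‖a - (τ : ℂ) • b‖ ^ 2 ≤ (Real.exp (-(τ * c / 2) * y ^ 2 +
      τ * (2 * D + 2 * D ^ 2 / c + c / 2) / 2 * t ^ 2) * ‖a‖) ^ 2 := by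
    rw [mul_pow]
    refine le_trans ?_ (mul_le_mul_of_nonneg_right hexp (sq_nonneg _))
    have h3 : ‖b‖ ^ 2 ≤ D ^ 2 * (9 / 2 * (y ^ 2 + t ^ 2)) * ‖a‖ ^ 2 := by
      have h4 : (y + t) ^ 2 ≤ 2 * (y ^ 2 + t ^ 2) := by nlinarith [sq_nonneg (y - t)]
      have h5 : (y + t) ^ 2 ≤ 9 / 4 := by nlinarith
      calc ‖b‖ ^ 2 ≤ (D * (y + t) ^ 2 * ‖a‖) ^ 2 := by gcongr
        _ = D ^ 2 * ((y + t) ^ 2 * (y + t) ^ 2) * ‖a‖ ^ 2 := by ring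
        _ ≤ D ^ 2 * ((9 / 4) * (2 * (y ^ 2 + t ^ 2))) * ‖a‖ ^ 2 := by gcongr
        _ = _ := by ring
    have h4 : τ ^ 2 * ‖b‖ ^ 2 ≤ τ * (c / 2) * (y ^ 2 + t ^ 2) * ‖a‖ ^ 2 := by
      calc τ ^ 2 * ‖b‖ ^ 2 ≤ τ ^ 2 * (D ^ 2 * (9 / 2 * (y ^ 2 + t ^ 2)) * ‖a‖ ^ 2) := by gcongr
        _ = τ * (τ * D ^ 2 * (9 / 2)) * (y ^ 2 + t ^ 2) * ‖a‖ ^ 2 := by ring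
        _ ≤ _ := by gcongr
    have h5 : 2 * D * (t * y) ≤ c / 2 * y ^ 2 + 2 * D ^ 2 / c * t ^ 2 := by
      have h6 : c / 2 * y ^ 2 + 2 * D ^ 2 / c * t ^ 2 - 2 * D * (t * y)
          = (c * y - 2 * D * t) ^ 2 / (2 * c) := by
        field_simp
        ring
      have h7 : 0 ≤ (c * y - 2 * D * t) ^ 2 / (2 * c) := by positivity
      linarith
    have h6 : 2 * τ * ((c * y ^ 2 - D * (t * (y + t))) * ‖a‖ ^ 2)
        ≤ 2 * τ * (inner ℂ a b).re := by gcongr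
    have h7 : τ * (2 * D * (t * y)) * ‖a‖ ^ 2
        ≤ τ * (c / 2 * y ^ 2 + 2 * D ^ 2 / c * t ^ 2) * ‖a‖ ^ 2 := by gcongr
    rw [hsq]
    linarith
  have h8 := abs_le_of_sq_le_sq hmain (by positivity)
  rw [abs_of_nonneg (norm_nonneg _)] at h8
  simpa [hb] using h8

end kernel

end

/-! ### Heat kernel bounds by tilting -/

section

open MeasureTheory Finset

section kernelBound

variable {d : ℕ} {ι : Type*} [Fintype ι] {F : Type*} [NormedAddCommGroup F]
  [InnerProductSpace ℂ F]

/-- Sup-`ℓ¹` duality: the tilt is concentrated on a coordinate where `|ℓ i|` is maximal, with its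
sign. The character then has modulus `exp (-t‖ℓ‖)`. -/
theorem exists_tilt (hd : 1 ≤ d) (ℓ : Fin d → ℤ) {t : ℝ} (ht : 0 ≤ t) :
    ∃ η : Fin d → ℝ, ‖η‖ ≤ t ∧ ∑ i, η i * ℓ i = t * ‖ℓ‖ := by
  have : Nonempty (Fin d) := ⟨⟨0, hd⟩⟩
  obtain ⟨i, -, hi⟩ := Finset.exists_mem_eq_sup (Finset.univ : Finset (Fin d))
    Finset.univ_nonempty fun i => (ℓ i).natAbs
  refine ⟨Pi.single i (t * SignType.sign (ℓ i : ℝ)), ?_, ?_⟩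
  · refine (pi_norm_le_iff_of_nonneg ht).2 fun j => ?_
    by_cases hj : j = i
    · subst hj
      rw [Pi.single_eq_same, norm_mul, Real.norm_of_nonneg ht]
      refine mul_le_of_le_one_right ht ?_
      rcases lt_trichotomy (ℓ j : ℝ) 0 with h | h | h
      · simp [sign_neg h]
      · simp [h]
      · simp [sign_pos h]
    · rw [Pi.single_eq_of_ne hj, norm_zero]
      exact ht
  · rw [Finset.sum_eq_single i]
    · rw [Pi.single_eq_same, norm_eq_supAbs, supAbs, hi, mul_assoc, sign_mul_self,
        ← Int.cast_abs, Int.abs_eq_natAbs]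
      simp
    · intro j _ hj
      rw [Pi.single_eq_of_ne hj, zero_mul]
    · simp

theorem exists_norm_prod_expChar_le (L : List (Fin d → ℤ)) : ∃ C : ℝ, 0 ≤ C ∧
    ∀ x η : Fin d → ℝ, ‖x‖ ≤ 1 → ‖η‖ ≤ 1 →
      ‖(L.map fun s => expChar x η s - 1).prod‖ ≤ C * (‖x‖ + ‖η‖) ^ L.length := by
  induction L with
  | nil => exact ⟨1, zero_le_one, fun x η _ _ => by simp⟩
  | cons s L ih =>
    obtain ⟨C, hC, h⟩ := ih
    obtain ⟨c, hc, h'⟩ := exists_norm_expChar_sub_one_le s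
    refine ⟨c * C, by positivity, fun x η hx hη => ?_⟩
    rw [List.map_cons, List.prod_cons, norm_mul, List.length_cons, pow_succ]
    calc _ ≤ (c * (‖x‖ + ‖η‖)) * (C * (‖x‖ + ‖η‖) ^ L.length) :=
          mul_le_mul (h' x η hx hη) (h x η hx hη) (norm_nonneg _) (by positivity)
      _ = _ := by ring

theorem one_add_pow_le_exp_sq (j : ℕ) {c : ℝ} (hc : 0 < c) (y : ℝ) (hy : 0 ≤ y) :
    (1 + y) ^ j ≤ Real.exp (j ^ 2 / (2 * c)) * Real.exp (c / 2 * y ^ 2) := by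
  have h1 : 1 + y ≤ Real.exp y := by rw [add_comm]; exact Real.add_one_le_exp y
  calc (1 + y) ^ j ≤ Real.exp y ^ j := by gcongr
    _ = Real.exp (j * y) := (Real.exp_nat_mul _ _).symm
    _ ≤ Real.exp (j ^ 2 / (2 * c) + c / 2 * y ^ 2) := by
      apply Real.exp_le_exp.2
      have h2 : (j : ℝ) ^ 2 / (2 * c) + c / 2 * y ^ 2 - j * y = (c * y - j) ^ 2 / (2 * c) := by
        field_simp
        ring
      have h3 : 0 ≤ (c * y - j) ^ 2 / (2 * c) := by positivity
      linarith
    _ = _ := Real.exp_add _ _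

theorem exp_neg_le_inv_pow (b : ℕ) (u : ℝ) (hu : 0 ≤ u) :
    Real.exp (-u) ≤ b.factorial * Real.exp 1 * ((1 + u) ^ b)⁻¹ := by
  have h1 := Real.pow_div_factorial_le_exp (1 + u) (by linarith) b
  have hb : (0 : ℝ) < b.factorial := by exact_mod_cast b.factorial_pos
  rw [div_le_iff₀ hb, Real.exp_add] at h1
  rw [Real.exp_neg, ← div_eq_mul_inv, ← one_div, div_le_div_iff₀ (Real.exp_pos _) (by positivity)]
  linarith

/-- With a tilt of size `t = 1/√(n+1)` the growth factor `exp (D n t²)` stays bounded while the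
character contributes `exp (-t‖ℓ‖)`. Each difference contributes `‖x‖ + t`, hence a factor `t` after
half of the Gaussian absorbs `(1 + ‖x‖/t)^j`; integration over frequencies contributes `t^d`.
Trading the exponential for `(1 + t‖ℓ‖)^{-(d+j)}` gives the stated form. -/
theorem exists_iterKernel_bound [CompleteSpace F] (hd : 1 ≤ d) {r : ι → Fin d → ℤ}
    {A : ι → ι → F →L[ℂ] F} (hco : SymbolCoercive r A) :
    ∃ τ : ℝ, 0 < τ ∧ ∀ L : List (Fin d → ℤ), ∃ C : ℝ, 0 ≤ C ∧ ∀ (n : ℕ) (ℓ : Fin d → ℤ),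
      ‖ldiff L (iterKernel r A τ n) ℓ‖ ≤ C * ((√((n : ℝ) + 1) + ‖ℓ‖) ^ (d + L.length))⁻¹ := by
  obtain ⟨τ, c, D, hτ, hc, hD, hcontr⟩ := exists_contraction hco
  refine ⟨τ, hτ, fun L => ?_⟩
  obtain ⟨C₁, hC₁, hprod⟩ := exists_norm_prod_expChar_le L
  set j := L.length with hj
  set C₂ := Real.exp ((j : ℝ) ^ 2 / (2 * c)) with hC₂
  have hpi := Real.pi_pos
  refine ⟨(d + j).factorial * Real.exp 1 * (C₁ * Real.exp (c + D) * C₂ *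
    √(Real.pi * d / (c / 2)) ^ d), by positivity, fun n ℓ => ?_⟩
  set q := √((n : ℝ) + 1) with hq
  have hn0 : (0 : ℝ) ≤ n := Nat.cast_nonneg n
  have hq1 : 1 ≤ q := Real.one_le_sqrt.2 (by linarith)
  have hq2 : q ^ 2 = n + 1 := Real.sq_sqrt (by linarith)
  have hq0 : 0 < q := by linarith
  set t := q⁻¹ with ht
  have ht0 : 0 < t := inv_pos.2 hq0
  have ht1 : t ≤ 1 := inv_le_one_of_one_le₀ hq1
  have htq : t * q = 1 := inv_mul_cancel₀ hq0.ne'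
  obtain ⟨η, hη, hηℓ⟩ := exists_tilt hd ℓ ht0.le
  have hη1 : ‖η‖ ≤ 1 := hη.trans ht1
  have hpt : ∀ x : Fin d → ℝ, ‖x‖ ≤ 1 / 2 →
      ‖expChar x η ℓ • ((L.map fun s => expChar x η s - 1).prod •
        (1 - (τ : ℂ) • latSymbol r A x η) ^ n)‖ ≤
      (Real.exp (-(t * ‖ℓ‖)) * (C₁ * t ^ j * Real.exp (c + D) * C₂)) *
        Real.exp (-(c / 2 * (n + 1)) * ‖x‖ ^ 2) := by
    intro x hx
    have hx1 : ‖x‖ ≤ 1 := by linarith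
    set y := ‖x‖ with hy
    have hy0 : 0 ≤ y := norm_nonneg _
    have h1 := hprod x η hx1 hη1
    -- The factor `exp c` pays for `n + 1` in place of `n` in the Gaussian, and `exp D` pays for the
    -- tilt.
    have h2 : ‖(1 - (τ : ℂ) • latSymbol r A x η) ^ n‖
        ≤ Real.exp (c + D) * Real.exp (-(c * (n + 1)) * y ^ 2) := by
      rcases Nat.eq_zero_or_pos n with hn | hn
      · subst hn
        rw [pow_zero, ← Real.exp_add]
        refine ContinuousLinearMap.norm_id_le.trans (Real.one_le_exp ?_)
        push_cast
        nlinarith [mul_nonneg hc.le (by nlinarith : 0 ≤ 1 - y ^ 2)]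
      · refine (norm_pow_le' _ hn).trans ?_
        refine (pow_le_pow_left₀ (norm_nonneg _) (hcontr x η hx hη1) n).trans ?_
        rw [← Real.exp_nat_mul, ← Real.exp_add]
        apply Real.exp_le_exp.2
        have h3 : (n : ℝ) * ‖η‖ ^ 2 ≤ 1 := by
          calc (n : ℝ) * ‖η‖ ^ 2 ≤ q ^ 2 * t ^ 2 := by
                gcongr
                linarith
            _ = 1 := by rw [← mul_pow, mul_comm, htq, one_pow]
        have h4 : D * ((n : ℝ) * ‖η‖ ^ 2) ≤ D * 1 := by gcongr
        have h5 : c * y ^ 2 ≤ c * 1 := by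
          gcongr
          nlinarith
        linarith
    have h3 : (y + ‖η‖) ^ j ≤ t ^ j * (C₂ * Real.exp (c / 2 * (n + 1) * y ^ 2)) := by
      have h4 := one_add_pow_le_exp_sq j hc (q * y) (by positivity)
      calc (y + ‖η‖) ^ j ≤ (y + t) ^ j := by gcongr
        _ = t ^ j * (1 + q * y) ^ j := by
          rw [← mul_pow]
          congr 1
          rw [mul_add, ← mul_assoc, htq]
          ring
        _ ≤ _ := by
          rw [mul_pow, hq2, ← mul_assoc] at h4
          gcongr
    have h5 : ‖expChar x η ℓ‖ = Real.exp (-(t * ‖ℓ‖)) := by rw [norm_expChar, hηℓ]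
    rw [norm_smul, norm_smul, h5]
    calc _ ≤ Real.exp (-(t * ‖ℓ‖)) * ((C₁ * (t ^ j * (C₂ * Real.exp (c / 2 * (n + 1) * y ^ 2)))) *
          (Real.exp (c + D) * Real.exp (-(c * (n + 1)) * y ^ 2))) := by
          gcongr
          exact h1.trans (by gcongr)
      _ = (Real.exp (-(t * ‖ℓ‖)) * (C₁ * t ^ j * Real.exp (c + D) * C₂)) *
          (Real.exp (c / 2 * (n + 1) * y ^ 2) * Real.exp (-(c * (n + 1)) * y ^ 2)) := by ring
      _ = _ := by
        rw [← Real.exp_add]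
        congr 2
        ring
  have hrep := (isFourierRep_iterKernel r A τ η n).ldiff L
  rw [hrep.2]
  have h1 : ‖∫ x, expChar x η ℓ • ((L.map fun s => expChar x η s - 1).prod •
        (1 - (τ : ℂ) • latSymbol r A x η) ^ n) ∂cubeMeasure d‖ ≤
      ∫ x, (Real.exp (-(t * ‖ℓ‖)) * (C₁ * t ^ j * Real.exp (c + D) * C₂)) *
        Real.exp (-(c / 2 * (n + 1)) * ‖x‖ ^ 2) ∂cubeMeasure d := by
    refine norm_integral_le_of_norm_le (integrable_cubeMeasure (by fun_prop)) ?_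
    filter_upwards [ae_cubeMeasure_norm_le] with x hx using hpt x hx
  refine h1.trans ?_
  rw [integral_const_mul]
  have h2 : ∫ x, Real.exp (-(c / 2 * (n + 1)) * ‖x‖ ^ 2) ∂cubeMeasure d
      ≤ (√(Real.pi * d / (c / 2)) * t) ^ d := by
    refine (integral_gaussian_cube_le (by positivity)).trans (le_of_eq ?_)
    congr 1
    rw [← div_div, Real.sqrt_div (by positivity), ← hq, div_eq_mul_inv]
  have h3 := exp_neg_le_inv_pow (d + j) (t * ‖ℓ‖) (by positivity)
  calc _ ≤ (((d + j).factorial * Real.exp 1 * ((1 + t * ‖ℓ‖) ^ (d + j))⁻¹) *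
        (C₁ * t ^ j * Real.exp (c + D) * C₂)) * (√(Real.pi * d / (c / 2)) * t) ^ d := by gcongr
    _ = _ := by
      have h4 : (q + ‖ℓ‖) = q * (1 + t * ‖ℓ‖) := by
        rw [mul_add, ← mul_assoc, mul_comm q t, htq]
        ring
      rw [h4, mul_pow q, mul_inv, ← inv_pow q, ← ht, mul_pow _ t d, pow_add t]
      ring

end kernelBound

end

/-! ### The Green's function representation and decay of orders one and two -/

section

open MeasureTheory Finset Filter Topology

section ldiffAlgebra

variable {G X : Type*} [AddCommGroup G] [AddCommGroup X]

theorem fwdDiff_sub' (s : G) (u v : G → X) :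
    fwdDiff s (fun ℓ => u ℓ - v ℓ) = fun ℓ => fwdDiff s u ℓ - fwdDiff s v ℓ := by
  ext ℓ
  simp only [fwdDiff]
  abel

theorem ldiff_sub' (L : List G) (u v : G → X) :
    ldiff L (fun ℓ => u ℓ - v ℓ) = fun ℓ => ldiff L u ℓ - ldiff L v ℓ := by
  induction L with
  | nil => rfl
  | cons s L ih => rw [ldiff_cons, ih, fwdDiff_sub', ldiff_cons, ldiff_cons]

theorem ldiff_smul' {R : Type*} [Monoid R] [DistribMulAction R X] (L : List G) (c : R) (u : G → X) :
    ldiff L (fun ℓ => c • u ℓ) = fun ℓ => c • ldiff L u ℓ := by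
  induction L with
  | nil => rfl
  | cons s L ih =>
    rw [ldiff_cons, ih, ldiff_cons]
    ext ℓ
    simp only [fwdDiff, smul_sub]

end ldiffAlgebra

section representation

variable {d : ℕ} {ι : Type*} [Fintype ι] {F : Type*} [NormedAddCommGroup F]
  [InnerProductSpace ℂ F]

/-- `w` is the (pointwise convergent) convolution of the kernel `k` with `v`. -/
def HasConv (k : (Fin d → ℤ) → F →L[ℂ] F) (v w : (Fin d → ℤ) → F) : Prop :=
  ∀ ℓ, HasSum (fun m => k (ℓ - m) (v m)) (w ℓ)

namespace HasConv

variable {k k' : (Fin d → ℤ) → F →L[ℂ] F} {v w w' : (Fin d → ℤ) → F}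

theorem fwdDiff (h : HasConv k v w) (s : Fin d → ℤ) :
    HasConv (fwdDiff s k) v (fwdDiff s w) := by
  intro ℓ
  change HasSum _ (w (ℓ + s) - w ℓ)
  convert (h (ℓ + s)).sub (h ℓ) using 2 with m
  simp [_root_.fwdDiff, sub_add_eq_add_sub]

theorem ldiff (h : HasConv k v w) (L : List (Fin d → ℤ)) :
    HasConv (ldiff L k) v (ldiff L w) := by
  induction L with
  | nil => exact h
  | cons s L ih => exact ih.fwdDiff s

theorem sub (h : HasConv k v w) (h' : HasConv k' v w') :
    HasConv (fun ℓ => k ℓ - k' ℓ) v fun ℓ => w ℓ - w' ℓ :=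
  fun ℓ => (h ℓ).sub (h' ℓ)

theorem smul (h : HasConv k v w) (c : ℂ) : HasConv (fun ℓ => c • k ℓ) v fun ℓ => c • w ℓ :=
  fun ℓ => (h ℓ).const_smul c

theorem mapL (h : HasConv k v w) (T : F →L[ℂ] F) :
    HasConv (fun ℓ => T * k ℓ) v fun ℓ => T (w ℓ) :=
  fun ℓ => (h ℓ).mapL T

theorem sum {ι : Type*} (s : Finset ι) {k : ι → (Fin d → ℤ) → F →L[ℂ] F}
    {w : ι → (Fin d → ℤ) → F} (h : ∀ i, HasConv (k i) v (w i)) :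
    HasConv (fun ℓ => ∑ i ∈ s, k i ℓ) v fun ℓ => ∑ i ∈ s, w i ℓ := by
  intro ℓ
  simp only [_root_.sum_apply]
  exact hasSum_sum fun i _ => h i ℓ

end HasConv

variable (r : ι → Fin d → ℤ) (A : ι → ι → F →L[ℂ] F) (τ : ℝ)

/-- The operator `1 - τ L`. -/
noncomputable def stepOp (v : (Fin d → ℤ) → F) (ℓ : Fin d → ℤ) : F :=
  v ℓ - (τ : ℂ) • latOp r A v ℓ

/-- No growth condition on `v` is needed: the kernel arises from the delta by finitely many shifts,
so pointwise convergence is preserved by the recursion. -/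
theorem hasConv_iterKernel (v : (Fin d → ℤ) → F) (n : ℕ) :
    HasConv (iterKernel r A τ n) v ((stepOp r A τ)^[n] v) := by
  induction n with
  | zero =>
    intro ℓ
    convert hasSum_single ℓ fun m hm => ?_ using 1
    · simp [iterKernel]
    · have : ℓ - m ≠ 0 := sub_ne_zero.2 hm.symm
      simp [iterKernel, this]
  | succ n ih =>
    rw [Function.iterate_succ_apply']
    exact ih.sub ((HasConv.sum Finset.univ fun ρ => HasConv.sum Finset.univ fun σ =>
      ((ih.fwdDiff (r ρ)).fwdDiff (-(r σ))).mapL (A ρ σ)).smul (τ : ℂ))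

theorem latOp_fwdDiff (s : Fin d → ℤ) (v : (Fin d → ℤ) → F) :
    latOp r A (fwdDiff s v) = fwdDiff s (latOp r A v) := by
  ext ℓ
  simp only [latOp]
  simp only [fwdDiff_comm _ s]
  simp only [fwdDiff, latOp, map_sub, Finset.sum_sub_distrib]

theorem latOp_ldiff (L : List (Fin d → ℤ)) (v : (Fin d → ℤ) → F) :
    latOp r A (ldiff L v) = ldiff L (latOp r A v) := by
  induction L with
  | nil => rfl
  | cons s L ih => rw [ldiff_cons, latOp_fwdDiff, ih, ldiff_cons]

theorem latOp_sub (v w : (Fin d → ℤ) → F) (ℓ : Fin d → ℤ) :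
    latOp r A (fun ℓ => v ℓ - w ℓ) ℓ = latOp r A v ℓ - latOp r A w ℓ := by
  simp only [latOp, fwdDiff_sub', map_sub, Finset.sum_sub_distrib]

theorem latOp_smul (c : ℂ) (v : (Fin d → ℤ) → F) (ℓ : Fin d → ℤ) :
    latOp r A (fun ℓ => c • v ℓ) ℓ = c • latOp r A v ℓ := by
  have h := fun (s : Fin d → ℤ) (v : (Fin d → ℤ) → F) => ldiff_smul' [s] c v
  simp only [ldiff_cons, ldiff_nil] at h
  simp only [latOp, h, map_smul, Finset.smul_sum]

theorem stepOp_ldiff (L : List (Fin d → ℤ)) (v : (Fin d → ℤ) → F) :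
    stepOp r A τ (ldiff L v) = ldiff L (stepOp r A τ v) := by
  have h : stepOp r A τ v = fun ℓ => v ℓ - (τ : ℂ) • latOp r A v ℓ := rfl
  rw [h, ldiff_sub', ldiff_smul']
  ext ℓ
  rw [stepOp, latOp_ldiff]

theorem stepOp_iterate_ldiff (L : List (Fin d → ℤ)) (v : (Fin d → ℤ) → F) (n : ℕ) :
    (stepOp r A τ)^[n] (ldiff L v) = ldiff L ((stepOp r A τ)^[n] v) := by
  have h : Function.Semiconj (ldiff L) (stepOp r A τ) (stepOp r A τ) :=
    fun v => (stepOp_ldiff r A τ L v).symm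
  exact ((h.iterate_right n) v).symm

theorem latOp_stepOp_iterate (v : (Fin d → ℤ) → F) (n : ℕ) :
    latOp r A ((stepOp r A τ)^[n] v) = (stepOp r A τ)^[n] (latOp r A v) := by
  have h : Function.Semiconj (latOp r A) (stepOp r A τ) (stepOp r A τ) := by
    intro v
    have h : stepOp r A τ v = fun ℓ => v ℓ - (τ : ℂ) • latOp r A v ℓ := rfl
    ext ℓ
    rw [h, latOp_sub, latOp_smul, stepOp]
  exact (h.iterate_right n) v

/-- The telescoping Neumann identity `1 - (1 - τL)^m = τ ∑ (1 - τL)^n L`. -/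
theorem sub_stepOp_iterate (v : (Fin d → ℤ) → F) (m : ℕ) (ℓ : Fin d → ℤ) :
    v ℓ - (stepOp r A τ)^[m] v ℓ
      = ∑ n ∈ Finset.range m, (τ : ℂ) • (stepOp r A τ)^[n] (latOp r A v) ℓ := by
  induction m with
  | zero => simp
  | succ m ih =>
    rw [Finset.sum_range_succ, ← ih, ← latOp_stepOp_iterate, Function.iterate_succ_apply', stepOp]
    abel

theorem sum_ldiff_iterKernel (v : (Fin d → ℤ) → F) (L : List (Fin d → ℤ)) (m : ℕ)
    (ℓ : Fin d → ℤ) :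
    HasSum (fun k => (∑ n ∈ Finset.range m, (τ : ℂ) • ldiff L (iterKernel r A τ n) (ℓ - k))
      (latOp r A v k)) (ldiff L v ℓ - (stepOp r A τ)^[m] (ldiff L v) ℓ) := by
  rw [sub_stepOp_iterate, latOp_ldiff]
  simp only [stepOp_iterate_ldiff]
  exact HasConv.sum (Finset.range m) (fun n =>
    ((hasConv_iterKernel r A τ (latOp r A v) n).ldiff L).smul (τ : ℂ)) ℓ

/-- The differences of the lattice Green's function. -/
noncomputable def greenDiff (L : List (Fin d → ℤ)) (ℓ : Fin d → ℤ) : F →L[ℂ] F :=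
  ∑' n, (τ : ℂ) • ldiff L (iterKernel r A τ n) ℓ

theorem inv_one_add_pow_le (x : ℝ) (hx : 0 ≤ x) (b : ℕ) :
    ((1 + x) ^ b)⁻¹ ≤ 2 ^ b * ((x + 2) ^ b)⁻¹ := by
  have h : (x + 2) ^ b ≤ (2 * (1 + x)) ^ b := by
    gcongr
    linarith
  rw [← div_eq_mul_inv, ← one_div, div_le_div_iff₀ (by positivity) (by positivity), one_mul,
    ← mul_pow]
  exact h

variable {r A τ}

/-- At least one difference is required so that `d + L.length ≥ 3`; for `d = 2` the bound without
differences is only `O(1/n)`. This is why differences are taken before summing in `greenDiff`. The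
partial sums are bounded as well, to serve as dominating functions. -/
theorem greenDiff_bounds (hd : 2 ≤ d) (hτ : 0 < τ)
    (hker : ∀ L : List (Fin d → ℤ), ∃ C : ℝ, 0 ≤ C ∧ ∀ (n : ℕ) (ℓ : Fin d → ℤ),
      ‖ldiff L (iterKernel r A τ n) ℓ‖ ≤ C * ((√((n : ℝ) + 1) + ‖ℓ‖) ^ (d + L.length))⁻¹)
    (L : List (Fin d → ℤ)) (hL : 1 ≤ L.length) :
    ∃ C : ℝ, 0 ≤ C ∧ ∀ ℓ, Summable (fun n => ‖(τ : ℂ) • ldiff L (iterKernel r A τ n) ℓ‖) ∧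
      ∀ m, ∑ n ∈ Finset.range m, ‖(τ : ℂ) • ldiff L (iterKernel r A τ n) ℓ‖
        ≤ C * ((‖ℓ‖ + 2) ^ (d - 2 + L.length))⁻¹ := by
  obtain ⟨C, hC, h⟩ := hker L
  obtain ⟨b, hb⟩ : ∃ b, d + L.length = b + 3 := ⟨d + L.length - 3, by omega⟩
  have hb' : d - 2 + L.length = b + 1 := by omega
  refine ⟨τ * C * 16 * 2 ^ (b + 1), by positivity, fun ℓ => ?_⟩
  have h1 : ∀ m, ∑ n ∈ Finset.range m, ‖(τ : ℂ) • ldiff L (iterKernel r A τ n) ℓ‖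
        ≤ τ * C * 16 * 2 ^ (b + 1) * ((‖ℓ‖ + 2) ^ (d - 2 + L.length))⁻¹ := by
    intro m
    calc _ ≤ ∑ n ∈ Finset.range m, (τ * C) * ((√((n : ℝ) + 1) + ‖ℓ‖) ^ (b + 3))⁻¹ := by
          refine Finset.sum_le_sum fun n _ => ?_
          have h2 := h n ℓ
          rw [hb] at h2
          rw [norm_smul, Complex.norm_real, Real.norm_of_nonneg hτ.le, mul_assoc]
          gcongr
      _ ≤ (τ * C) * (16 * (2 ^ (b + 1) * ((‖ℓ‖ + 2) ^ (b + 1))⁻¹)) := by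
          rw [← Finset.mul_sum]
          have h2 := sum_inv_sqrt_add_pow_le b ‖ℓ‖ (norm_nonneg _) m
          have h3 := inv_one_add_pow_le ‖ℓ‖ (norm_nonneg _) (b + 1)
          gcongr
          exact h2.trans (by gcongr)
      _ = _ := by rw [hb']; ring
  exact ⟨summable_of_sum_range_le (fun _ => norm_nonneg _) h1, h1⟩

variable [CompleteSpace F]

theorem ldiff_greenDiff
    (L : List (Fin d → ℤ)) (hL : ∀ L' : List (Fin d → ℤ), ∀ ℓ,
      Summable fun n => ‖(τ : ℂ) • ldiff (L' ++ L) (iterKernel r A τ n) ℓ‖)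
    (L' : List (Fin d → ℤ)) :
    ldiff L' (greenDiff r A τ L) = greenDiff r A τ (L' ++ L) := by
  induction L' with
  | nil => rfl
  | cons s L' ih =>
    ext1 ℓ
    rw [ldiff_cons, ih, fwdDiff, greenDiff, greenDiff,
      ← (hL L' (ℓ + s)).of_norm.tsum_sub (hL L' ℓ).of_norm, greenDiff]
    refine tsum_congr fun n => ?_
    rw [← smul_sub]
    rfl

/-- The weight is square summable because `2d ≥ d + 1`; the product is then bounded by the two
squares. -/
theorem summable_inv_pow_mul_of_sq {F : Type*} [NormedAddCommGroup F] (hd : 1 ≤ d) (ℓ : Fin d → ℤ) {w : (Fin d → ℤ) → F}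
    (hw : Summable fun k => ‖w k‖ ^ 2) :
    Summable fun k => ((1 + ‖ℓ - k‖) ^ d)⁻¹ * ‖w k‖ := by
  have h1 : Summable fun k : Fin d → ℤ => (2 ^ (d + 1)) * ((‖k‖ + 2) ^ (d + 1))⁻¹ := by
    have := (summable_weight hd 0).mul_left (2 ^ (d + 1))
    simpa using this
  have h2 : Summable fun k : Fin d → ℤ => (2 ^ (d + 1)) * ((‖ℓ - k‖ + 2) ^ (d + 1))⁻¹ :=
    (Equiv.subLeft ℓ).summable_iff.2 h1
  refine Summable.of_nonneg_of_le (fun k => by positivity) (fun k => ?_) (h2.add hw)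
  have h3 : (((1 + ‖ℓ - k‖) ^ d)⁻¹) ^ 2 ≤ (2 ^ (d + 1)) * ((‖ℓ - k‖ + 2) ^ (d + 1))⁻¹ := by
    refine le_trans ?_ (inv_one_add_pow_le _ (norm_nonneg _) (d + 1))
    rw [inv_pow, ← pow_mul]
    gcongr
    · linarith [norm_nonneg (ℓ - k)]
    · omega
  have h4 := two_mul_le_add_sq (((1 + ‖ℓ - k‖) ^ d)⁻¹) ‖w k‖
  have h5 : 0 ≤ ((1 + ‖ℓ - k‖) ^ d)⁻¹ * ‖w k‖ := by positivity
  linarith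

/-- This plays the role of a Liouville theorem. The kernels tend to zero pointwise and are dominated
by `(1 + ‖ℓ - k‖)^{-d}`, which pairs with square-summable `w`. -/
theorem tendsto_stepOp_iterate (hd : 1 ≤ d)
    (hker : ∃ C : ℝ, 0 ≤ C ∧ ∀ (n : ℕ) (ℓ : Fin d → ℤ),
      ‖iterKernel r A τ n ℓ‖ ≤ C * ((√((n : ℝ) + 1) + ‖ℓ‖) ^ d)⁻¹)
    {w : (Fin d → ℤ) → F} (hw : Summable fun k => ‖w k‖ ^ 2) (ℓ : Fin d → ℤ) :
    Tendsto (fun n => (stepOp r A τ)^[n] w ℓ) atTop (𝓝 0) := by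
  obtain ⟨C, hC, h⟩ := hker
  have h1 : ∀ n, (stepOp r A τ)^[n] w ℓ = ∑' k, iterKernel r A τ n (ℓ - k) (w k) :=
    fun n => (hasConv_iterKernel r A τ w n ℓ).tsum_eq.symm
  simp only [h1]
  rw [show (0 : F) = ∑' _ : Fin d → ℤ, (0 : F) by simp]
  refine tendsto_tsum_of_dominated_convergence
    ((summable_inv_pow_mul_of_sq hd ℓ hw).mul_left C) (fun k => ?_)
    (Eventually.of_forall fun n k => ?_)
  · have h2 : Tendsto (fun n : ℕ => C * (√((n : ℝ) + 1))⁻¹ * ‖w k‖) atTop (𝓝 (C * 0 * ‖w k‖)) := by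
      refine (Tendsto.const_mul C ?_).mul_const _
      refine tendsto_inv_atTop_zero.comp ?_
      exact Real.tendsto_sqrt_atTop.comp
        (tendsto_atTop_add_const_right _ _ tendsto_natCast_atTop_atTop)
    rw [mul_zero, zero_mul] at h2
    refine squeeze_zero_norm (fun n => ?_) h2
    refine (ContinuousLinearMap.le_opNorm _ _).trans ?_
    refine mul_le_mul_of_nonneg_right ((h n _).trans ?_) (norm_nonneg _)
    have hq : 1 ≤ √((n : ℝ) + 1) := Real.one_le_sqrt.2 (by linarith [Nat.cast_nonneg (α := ℝ) n])
    have h3 : √((n : ℝ) + 1) ≤ (√((n : ℝ) + 1) + ‖ℓ - k‖) ^ d := by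
      have h4 := norm_nonneg (ℓ - k)
      refine le_trans ?_ (le_self_pow₀ (by linarith) (by omega))
      linarith
    gcongr
  · refine (ContinuousLinearMap.le_opNorm _ _).trans ?_
    rw [← mul_assoc]
    refine mul_le_mul_of_nonneg_right ((h n _).trans ?_) (norm_nonneg _)
    have hq : 1 ≤ √((n : ℝ) + 1) := Real.one_le_sqrt.2 (by linarith [Nat.cast_nonneg (α := ℝ) n])
    gcongr

/-- Green's function representation of the differences of a finite-energy lattice function. -/
theorem ldiff_eq_tsum_greenDiff (hd : 2 ≤ d) (hτ : 0 < τ)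
    (hker : ∀ L : List (Fin d → ℤ), ∃ C : ℝ, 0 ≤ C ∧ ∀ (n : ℕ) (ℓ : Fin d → ℤ),
      ‖ldiff L (iterKernel r A τ n) ℓ‖ ≤ C * ((√((n : ℝ) + 1) + ‖ℓ‖) ^ (d + L.length))⁻¹)
    (L : List (Fin d → ℤ)) (hL : 1 ≤ L.length) {u : (Fin d → ℤ) → F}
    (hu : Summable fun k => ‖ldiff L u k‖ ^ 2) {K : ℝ} {α : ℕ}
    (hf : ∀ k, ‖latOp r A u k‖ ≤ K * (((‖k‖ + 2) ^ d)⁻¹ * Real.log (‖k‖ + 2) ^ α))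
    (ℓ : Fin d → ℤ) :
    ldiff L u ℓ = ∑' k, greenDiff r A τ L (ℓ - k) (latOp r A u k) := by
  obtain ⟨C, hC, hb⟩ := greenDiff_bounds hd hτ hker L hL
  have h1 : Tendsto (fun m => ldiff L u ℓ - (stepOp r A τ)^[m] (ldiff L u) ℓ) atTop
      (𝓝 (ldiff L u ℓ - 0)) :=
    tendsto_const_nhds.sub (tendsto_stepOp_iterate (by omega) (by simpa using hker []) hu ℓ)
  rw [sub_zero] at h1
  have h2 : ∀ m, ldiff L u ℓ - (stepOp r A τ)^[m] (ldiff L u) ℓ = ∑' k,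
      (∑ n ∈ Finset.range m, (τ : ℂ) • ldiff L (iterKernel r A τ n) (ℓ - k)) (latOp r A u k) :=
    fun m => (sum_ldiff_iterKernel r A τ u L m ℓ).tsum_eq.symm
  simp only [h2] at h1
  refine tendsto_nhds_unique h1 ?_
  refine tendsto_tsum_of_dominated_convergence
    (bound := fun k => (C * (1 + ‖ℓ‖) * K) *
      (((‖k‖ + 2) ^ (d + 1))⁻¹ * Real.log (‖k‖ + 2) ^ α))
    ((summable_weight (by omega) α).mul_left _) (fun k => ?_)
    (Eventually.of_forall fun m k => ?_)
  · have h3 := (hb (ℓ - k)).1.of_norm.hasSum.tendsto_sum_nat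
    exact ((ContinuousLinearMap.apply ℂ F (latOp r A u k)).continuous.tendsto _).comp h3
  -- One power of kernel decay suffices, moved from `ℓ - k` to `k` by `‖k‖ + 2 ≤ (1 + ‖ℓ‖) (‖ℓ - k‖
  -- + 2)`; together with the source it gives a summable bound of order `d + 1`.
  · have h3 : ‖∑ n ∈ Finset.range m, (τ : ℂ) • ldiff L (iterKernel r A τ n) (ℓ - k)‖
        ≤ C * (1 + ‖ℓ‖) * (‖k‖ + 2)⁻¹ := by
      refine (norm_sum_le _ _).trans (((hb (ℓ - k)).2 m).trans ?_)
      rw [mul_assoc]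
      refine mul_le_mul_of_nonneg_left ?_ hC
      have h5 := norm_nonneg (ℓ - k)
      have h6 : ‖k‖ ≤ ‖ℓ‖ + ‖ℓ - k‖ := by
        calc ‖k‖ = ‖ℓ - (ℓ - k)‖ := by congr 1; abel
          _ ≤ _ := norm_sub_le _ _
      have h4 : ((‖ℓ - k‖ + 2) ^ (d - 2 + L.length))⁻¹ ≤ (‖ℓ - k‖ + 2)⁻¹ := by
        gcongr
        exact le_self_pow₀ (by linarith) (by omega)
      refine h4.trans ?_
      rw [← div_eq_mul_inv, ← one_div, div_le_div_iff₀ (by positivity) (by positivity)]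
      nlinarith [norm_nonneg ℓ, mul_nonneg (norm_nonneg ℓ) h5]
    refine (ContinuousLinearMap.le_opNorm _ _).trans ?_
    calc _ ≤ (C * (1 + ‖ℓ‖) * (‖k‖ + 2)⁻¹) *
          (K * (((‖k‖ + 2) ^ d)⁻¹ * Real.log (‖k‖ + 2) ^ α)) :=
          mul_le_mul h3 (hf k) (norm_nonneg _) (by positivity)
      _ = _ := by
        rw [pow_succ, mul_inv]
        ring

/-- Decay of first and second differences. -/
theorem ldiff_decay_of_length_le_two (hd : 2 ≤ d) (hco : SymbolCoercive r A)
    (L : List (Fin d → ℤ)) (hL : 1 ≤ L.length) (hL2 : L.length ≤ 2) (p α : ℕ) :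
    ∃ C : ℝ, 0 ≤ C ∧ ∀ u : (Fin d → ℤ) → F, (Summable fun k => ‖ldiff L u k‖ ^ 2) →
      ∀ K : ℝ, 0 ≤ K →
      (∀ k, ‖latOp r A u k‖ ≤ K * (((‖k‖ + 2) ^ (d + p))⁻¹ * Real.log (‖k‖ + 2) ^ α)) →
      (∀ q, PolyLT p q → ∑' k, q k • latOp r A u k = 0) →
      ∀ ℓ, ‖ldiff L u ℓ‖ ≤ C * K *
        (((‖ℓ‖ + 2) ^ (d - 2 + L.length + p))⁻¹ * Real.log (‖ℓ‖ + 2) ^ (α + 1)) := by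
  obtain ⟨τ, hτ, hker⟩ := exists_iterKernel_bound (by omega) hco
  have hg : ∀ L' : List (Fin d → ℤ), ∃ C : ℝ, ∀ m, ‖ldiff L' (greenDiff r A τ L) m‖
      ≤ C * ((‖m‖ + 2) ^ (d - 2 + L.length + L'.length))⁻¹ := by
    intro L'
    have hlen : ∀ L' : List (Fin d → ℤ), 1 ≤ (L' ++ L).length := fun L' => by
      rw [List.length_append]; omega
    obtain ⟨C, hC, hb⟩ := greenDiff_bounds hd hτ hker (L' ++ L) (hlen L')
    refine ⟨C, fun m => ?_⟩
    rw [ldiff_greenDiff L fun L' ℓ => ?_]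
    · have h1 : d - 2 + L.length + L'.length = d - 2 + (L' ++ L).length := by
        rw [List.length_append]; omega
      rw [h1, greenDiff]
      exact (norm_tsum_le_tsum_norm (hb m).1).trans
        ((hb m).1.tsum_le_of_sum_range_le (hb m).2)
    · obtain ⟨C, hC, hb⟩ := greenDiff_bounds hd hτ hker (L' ++ L) (hlen L')
      exact (hb ℓ).1
  -- The kernel order `d - 2 + L.length` lies between `1` and `d` because `L` has length one or two.
  obtain ⟨C, hC, h⟩ := convolution_decay (by omega) (d - 2 + L.length) p α (by omega) (by omega)
    (greenDiff r A τ L) hg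
  refine ⟨C, hC, fun u hu K hK hf hmom ℓ => ?_⟩
  rw [ldiff_eq_tsum_greenDiff hd hτ hker L hL hu (K := K) (α := α) (fun k => (hf k).trans ?_) ℓ]
  · exact h _ K hK hf hmom ℓ
  · have h1 : (0 : ℝ) ≤ Real.log (‖k‖ + 2) := (log_weight_pos (norm_nonneg k)).le
    have h2 : (‖k‖ + 2) ^ d ≤ (‖k‖ + 2) ^ (d + p) :=
      pow_le_pow_right₀ (by linarith [norm_nonneg k]) (by omega)
    gcongr

end representation

end

/-! ### Coercivity of the symbol from truncated plane waves -/

section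

open Finset Filter Topology

section coercivity

variable {d : ℕ}

theorem expChar_zero_neg (x : Fin d → ℝ) (s : Fin d → ℤ) :
    expChar x 0 (-s) = (starRingEnd ℂ) (expChar x 0 s) := by
  rw [expChar, expChar, ← Complex.exp_conj, map_sum]
  congr 1
  refine Finset.sum_congr rfl fun i _ => ?_
  simp [Complex.conj_ofNat]

theorem norm_expChar_zero (x : Fin d → ℝ) (s : Fin d → ℤ) : ‖expChar x 0 s‖ = 1 := by
  simp [norm_expChar]

/-- Here `|e^{2πi x} - 1| = 2 |sin πx|`, and Jordan's inequality applies because `π|x| ≤ π/2`. -/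
theorem four_mul_abs_le_norm_expChar_sub_one (x : Fin d → ℝ) (hx : ‖x‖ ≤ 1 / 2) (i : Fin d) :
    4 * |x i| ≤ ‖expChar x 0 (unitVec i) - 1‖ := by
  have h1 : expChar x 0 (unitVec i) = Complex.exp (Complex.I * ((2 * Real.pi * x i : ℝ) : ℂ)) := by
    rw [expChar, Finset.sum_eq_single i]
    · simp [unitVec]
      ring_nf
    · intro j _ hj
      simp [unitVec, Pi.single_eq_of_ne hj]
    · simp
  have hxi : |x i| ≤ 1 / 2 := (norm_le_pi_norm x i).trans hx
  have hpi := Real.pi_pos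
  rw [h1, Complex.norm_exp_I_mul_ofReal_sub_one, norm_mul, Real.norm_eq_abs, Real.norm_eq_abs,
    abs_of_pos (by norm_num : (0 : ℝ) < 2), show 2 * Real.pi * x i / 2 = Real.pi * x i by ring]
  have h2 : 2 / Real.pi * (Real.pi * |x i|) ≤ Real.sin (Real.pi * |x i|) :=
    Real.mul_le_sin (by positivity) (by nlinarith)
  have h3 : 2 / Real.pi * (Real.pi * |x i|) = 2 * |x i| := by field_simp
  have h4 : Real.sin (Real.pi * |x i|) ≤ |Real.sin (Real.pi * x i)| := by
    rcases abs_cases (x i) with ⟨h, _⟩ | ⟨h, _⟩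
    · rw [h]; exact le_abs_self _
    · rw [h, mul_neg, Real.sin_neg]; exact neg_le_abs _
  linarith

/-- For a unitary character the distance to `1` is subadditive in the argument and invariant under
negation, so generators control every lattice vector. This is how the generation hypothesis enters:
no nonzero frequency in the cube is invisible to the stencil. -/
theorem exists_norm_expChar_sub_one_le_sum {ι : Type*} [Fintype ι] {r : ι → Fin d → ℤ}
    {s : Fin d → ℤ} (hs : s ∈ AddSubgroup.closure (Set.range r)) :
    ∃ C : ℝ, 0 ≤ C ∧ ∀ x : Fin d → ℝ,
      ‖expChar x 0 s - 1‖ ≤ C * ∑ ρ, ‖expChar x 0 (r ρ) - 1‖ := by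
  induction hs using AddSubgroup.closure_induction with
  | mem s hs =>
    obtain ⟨ρ, rfl⟩ := hs
    refine ⟨1, zero_le_one, fun x => ?_⟩
    rw [one_mul]
    exact Finset.single_le_sum (f := fun ρ => ‖expChar x 0 (r ρ) - 1‖)
      (fun _ _ => norm_nonneg _) (Finset.mem_univ ρ)
  | zero => exact ⟨0, le_rfl, fun x => by simp [expChar_zero]⟩
  | add s t _ _ ih ih' =>
    obtain ⟨C, hC, h⟩ := ih
    obtain ⟨C', hC', h'⟩ := ih'
    refine ⟨C + C', by positivity, fun x => ?_⟩
    have h1 : expChar x 0 (s + t) - 1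
        = expChar x 0 t * (expChar x 0 s - 1) + (expChar x 0 t - 1) := by
      rw [expChar_add]; ring
    rw [h1, add_mul]
    refine (norm_add_le _ _).trans (add_le_add ?_ (h' x))
    rw [norm_mul, norm_expChar_zero, one_mul]
    exact h x
  | neg s _ ih =>
    obtain ⟨C, hC, h⟩ := ih
    refine ⟨C, hC, fun x => ?_⟩
    have h1 : expChar x 0 (-s) - 1 = (starRingEnd ℂ) (expChar x 0 s - 1) := by
      rw [expChar_zero_neg]; simp
    rw [h1, Complex.norm_conj]
    exact h x

theorem exists_norm_sq_le_sum_expChar {ι : Type*} [Fintype ι] {r : ι → Fin d → ℤ}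
    (hr : AddSubgroup.closure (Set.range r) = ⊤) :
    ∃ C : ℝ, 0 ≤ C ∧ ∀ x : Fin d → ℝ, ‖x‖ ≤ 1 / 2 →
      ‖x‖ ^ 2 ≤ C * ∑ ρ, ‖expChar x 0 (r ρ) - 1‖ ^ 2 := by
  have h := fun i : Fin d => exists_norm_expChar_sub_one_le_sum (r := r) (s := unitVec i)
    (by rw [hr]; trivial)
  choose C hC h using h
  have hC0 : 0 ≤ ∑ i, C i := Finset.sum_nonneg fun i _ => hC i
  refine ⟨(∑ i, C i) ^ 2 * Fintype.card ι, by positivity, fun x hx => ?_⟩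
  set S := ∑ ρ, ‖expChar x 0 (r ρ) - 1‖ with hS
  have hS0 : 0 ≤ S := Finset.sum_nonneg fun _ _ => norm_nonneg _
  have h1 : ‖x‖ ≤ (∑ i, C i) * S := by
    refine (pi_norm_le_iff_of_nonneg (by positivity)).2 fun i => ?_
    have h2 := four_mul_abs_le_norm_expChar_sub_one x hx i
    have h3 : C i * S ≤ (∑ i, C i) * S := mul_le_mul_of_nonneg_right
      (Finset.single_le_sum (fun i _ => hC i) (Finset.mem_univ i)) hS0
    rw [Real.norm_eq_abs]
    linarith [h i x, abs_nonneg (x i)]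
  have h2 : S ^ 2 ≤ Fintype.card ι * ∑ ρ, ‖expChar x 0 (r ρ) - 1‖ ^ 2 := by
    simpa using sq_sum_le_card_mul_sum_sq (s := Finset.univ)
      (f := fun ρ => ‖expChar x 0 (r ρ) - 1‖)
  calc ‖x‖ ^ 2 ≤ ((∑ i, C i) * S) ^ 2 := by gcongr
    _ = (∑ i, C i) ^ 2 * S ^ 2 := by ring
    _ ≤ (∑ i, C i) ^ 2 * (Fintype.card ι * ∑ ρ, ‖expChar x 0 (r ρ) - 1‖ ^ 2) := by gcongr
    _ = _ := by ring

/-- The discrete cube `{0, …, n}ᵈ`. -/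
noncomputable def cube (d n : ℕ) : Finset (Fin d → ℤ) := Finset.Icc 0 fun _ => (n : ℤ)

/-- The indicator function of the discrete cube. -/
noncomputable def cubeInd (d n : ℕ) (ℓ : Fin d → ℤ) : ℂ := if ℓ ∈ cube d n then 1 else 0

theorem mem_cube {n : ℕ} {ℓ : Fin d → ℤ} : ℓ ∈ cube d n ↔ ∀ i, 0 ≤ ℓ i ∧ ℓ i ≤ n := by
  rw [cube, Finset.mem_Icc, Pi.le_def, Pi.le_def, ← forall_and]
  rfl

/-- The autocorrelation of the indicator of the discrete cube. -/
noncomputable def cubeCorr (d n : ℕ) (δ : Fin d → ℤ) : ℕ := ((cube d n).filter fun ℓ => ℓ + δ ∈ cube d n).card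

theorem hasSum_cubeInd_mul (n : ℕ) (ρ σ : Fin d → ℤ) :
    HasSum (fun ℓ => cubeInd d n (ℓ + σ) * cubeInd d n (ℓ + ρ)) (cubeCorr d n (σ - ρ) : ℂ) := by
  rw [← (Equiv.subRight ρ).hasSum_iff]
  have h1 : (fun ℓ => cubeInd d n (ℓ + σ) * cubeInd d n (ℓ + ρ)) ∘ Equiv.subRight ρ
      = fun ℓ => if ℓ ∈ (cube d n).filter (fun ℓ => ℓ + (σ - ρ) ∈ cube d n) then (1 : ℂ) else 0 := by
    ext ℓ
    have h2 : ℓ - ρ + σ = ℓ + (σ - ρ) := by abel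
    simp only [Function.comp_apply, Equiv.subRight_apply, sub_add_cancel, h2, cubeInd,
      Finset.mem_filter]
    by_cases h3 : ℓ ∈ cube d n <;> by_cases h4 : ℓ + (σ - ρ) ∈ cube d n <;> simp [h3, h4]
  rw [h1, cubeCorr]
  have h2 : HasSum (fun ℓ => if ℓ ∈ (cube d n).filter (fun ℓ => ℓ + (σ - ρ) ∈ cube d n)
      then (1 : ℂ) else 0) (∑ ℓ ∈ (cube d n).filter (fun ℓ => ℓ + (σ - ρ) ∈ cube d n),
        if ℓ ∈ (cube d n).filter (fun ℓ => ℓ + (σ - ρ) ∈ cube d n) then (1 : ℂ) else 0) :=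
    hasSum_sum_of_ne_finset_zero fun ℓ hℓ => if_neg hℓ
  convert h2 using 1
  rw [Finset.sum_ite_mem]
  simp

theorem cubeCorr_le (n : ℕ) (δ : Fin d → ℤ) : cubeCorr d n δ ≤ (n + 1) ^ d := by
  refine (Finset.card_filter_le _ _).trans (le_of_eq ?_)
  rw [cube, Pi.card_Icc]
  simp [Int.card_Icc]

theorem le_cubeCorr (n : ℕ) (δ : Fin d → ℤ) (hn : 2 * supAbs δ ≤ n) :
    (n + 1 - 2 * supAbs δ) ^ d ≤ cubeCorr d n δ := by
  have h1 : (Finset.Icc (fun _ : Fin d => (supAbs δ : ℤ)) fun _ => (n : ℤ) - supAbs δ).card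
      = (n + 1 - 2 * supAbs δ) ^ d := by
    rw [Pi.card_Icc]
    simp only [Int.card_Icc, Finset.prod_const, Finset.card_univ, Fintype.card_fin]
    congr 1
    omega
  rw [← h1]
  refine Finset.card_le_card fun ℓ hℓ => ?_
  rw [Finset.mem_Icc, Pi.le_def, Pi.le_def] at hℓ
  have h2 := (supAbs_le_iff δ _).1 le_rfl
  rw [Finset.mem_filter, mem_cube, mem_cube]
  refine ⟨fun i => ?_, fun i => ?_⟩
  · have h3 := hℓ.1 i
    have h4 := hℓ.2 i
    omega
  · have h3 := hℓ.1 i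
    have h4 := hℓ.2 i
    have h5 := h2 i
    rw [Pi.add_apply]
    omega

/-- Cubes are a Følner sequence: a fixed shift moves only a boundary layer of width `supAbs δ` out
of the cube. -/
theorem tendsto_cubeCorr (δ : Fin d → ℤ) :
    Tendsto (fun n : ℕ => (cubeCorr d n δ : ℝ) / ((n : ℝ) + 1) ^ d) atTop (𝓝 1) := by
  have h1 : Tendsto (fun n : ℕ => (1 - 2 * (supAbs δ : ℝ) / ((n : ℝ) + 1)) ^ d) atTop (𝓝 1) := by
    have h2 : Tendsto (fun n : ℕ => 2 * (supAbs δ : ℝ) / ((n : ℝ) + 1)) atTop (𝓝 0) :=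
      tendsto_const_nhds.div_atTop
        (tendsto_atTop_add_const_right _ _ tendsto_natCast_atTop_atTop)
    simpa using ((tendsto_const_nhds (x := (1 : ℝ))).sub h2).pow d
  refine tendsto_of_tendsto_of_tendsto_of_le_of_le' h1 tendsto_const_nhds ?_
    (Eventually.of_forall fun n => ?_)
  · filter_upwards [eventually_ge_atTop (2 * supAbs δ)] with n hn
    have h2 := le_cubeCorr n δ hn
    have h3 : (((n + 1 - 2 * supAbs δ) ^ d : ℕ) : ℝ) ≤ cubeCorr d n δ := by exact_mod_cast h2
    rw [Nat.cast_pow, Nat.cast_sub (by omega)] at h3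
    push_cast at h3
    have h4 : 1 - 2 * (supAbs δ : ℝ) / ((n : ℝ) + 1) = ((n : ℝ) + 1 - 2 * supAbs δ) / (n + 1) := by
      field_simp
    rw [h4, div_pow]
    gcongr
  · rw [div_le_one (by positivity)]
    exact_mod_cast cubeCorr_le n δ

theorem hasSum_planeWave (x : Fin d → ℝ) (n : ℕ) (ρ σ : Fin d → ℤ) :
    HasSum (fun ℓ => (starRingEnd ℂ) (fwdDiff σ (fun m => cubeInd d n m * expChar x 0 m) ℓ) *
        fwdDiff ρ (fun m => cubeInd d n m * expChar x 0 m) ℓ)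
      ((starRingEnd ℂ) (expChar x 0 σ) * expChar x 0 ρ * cubeCorr d n (σ - ρ)
        - (starRingEnd ℂ) (expChar x 0 σ) * cubeCorr d n (σ - 0)
        - expChar x 0 ρ * cubeCorr d n (0 - ρ) + cubeCorr d n (0 - 0)) := by
  have h := ((((hasSum_cubeInd_mul n ρ σ).mul_left
    ((starRingEnd ℂ) (expChar x 0 σ) * expChar x 0 ρ)).sub
    ((hasSum_cubeInd_mul n 0 σ).mul_left ((starRingEnd ℂ) (expChar x 0 σ)))).sub
    ((hasSum_cubeInd_mul n ρ 0).mul_left (expChar x 0 ρ))).add (hasSum_cubeInd_mul n 0 0)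
  refine h.congr_fun fun ℓ => ?_
  have hc : ∀ m, (starRingEnd ℂ) (cubeInd d n m) = cubeInd d n m := by
    intro m
    unfold cubeInd
    split_ifs <;> simp
  have h1 : (starRingEnd ℂ) (expChar x 0 ℓ) * expChar x 0 ℓ = 1 := by
    rw [← Complex.normSq_eq_conj_mul_self, Complex.normSq_eq_norm_sq, norm_expChar_zero]
    simp
  simp only [fwdDiff, expChar_add, map_sub, map_mul, hc, add_zero]
  -- The phases at `ℓ` cancel, leaving four correlations of indicators.
  linear_combination (cubeInd d n (ℓ + σ) * (starRingEnd ℂ) (expChar x 0 σ) - cubeInd d n ℓ) *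
    (cubeInd d n (ℓ + ρ) * expChar x 0 ρ - cubeInd d n ℓ) * h1

/-- All four normalised correlations tend to `1`, so the limit factorises into the terms of the
symbol. -/
theorem tendsto_planeWave (x : Fin d → ℝ) (ρ σ : Fin d → ℤ) :
    Tendsto (fun n : ℕ => (∑' ℓ,
        (starRingEnd ℂ) (fwdDiff σ (fun m => cubeInd d n m * expChar x 0 m) ℓ) *
          fwdDiff ρ (fun m => cubeInd d n m * expChar x 0 m) ℓ) / (((n : ℝ) + 1) ^ d : ℝ)) atTop
      (𝓝 ((expChar x 0 (-σ) - 1) * (expChar x 0 ρ - 1))) := by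
  have hT : ∀ δ : Fin d → ℤ, Tendsto (fun n : ℕ =>
      (((cubeCorr d n δ : ℝ) / ((n : ℝ) + 1) ^ d : ℝ) : ℂ)) atTop (𝓝 ((1 : ℝ) : ℂ)) :=
    fun δ => (Complex.continuous_ofReal.tendsto _).comp (tendsto_cubeCorr δ)
  have h := ((((hT (σ - ρ)).const_mul ((starRingEnd ℂ) (expChar x 0 σ) * expChar x 0 ρ)).sub
    ((hT (σ - 0)).const_mul ((starRingEnd ℂ) (expChar x 0 σ)))).sub
    ((hT (0 - ρ)).const_mul (expChar x 0 ρ))).add (hT (0 - 0))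
  refine (h.congr fun n => ?_).trans (le_of_eq ?_)
  · rw [(hasSum_planeWave x n ρ σ).tsum_eq]
    push_cast
    ring
  · rw [expChar_zero_neg]
    congr 1
    push_cast
    ring

/-- Stability tested with truncated plane waves gives coercivity of the symbol. -/
theorem symbolCoercive_of_stable {ι : Type*} [Fintype ι] {F : Type*} [NormedAddCommGroup F]
    [InnerProductSpace ℂ F] {r : ι → Fin d → ℤ} {A : ι → ι → F →L[ℂ] F}
    (hr : AddSubgroup.closure (Set.range r) = ⊤) {c₀ : ℝ} (hc₀ : 0 < c₀)
    (hstab : ∀ s : (Fin d → ℤ) → ℂ, (Function.support s).Finite → ∀ a : F,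
      c₀ * (‖a‖ ^ 2 * ∑ ρ, (∑' ℓ, (starRingEnd ℂ) (fwdDiff (r ρ) s ℓ) * fwdDiff (r ρ) s ℓ).re) ≤
        (∑ ρ, ∑ σ, (∑' ℓ, (starRingEnd ℂ) (fwdDiff (r σ) s ℓ) * fwdDiff (r ρ) s ℓ) *
          inner ℂ a (A ρ σ a)).re) :
    SymbolCoercive r A := by
  obtain ⟨C, hC, hgen⟩ := exists_norm_sq_le_sum_expChar hr
  -- The `+ 1` avoids division by a vanishing `C`.
  refine ⟨c₀ / (C + 1), by positivity, fun x hx a => ?_⟩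
  have hfin : ∀ n, (Function.support fun m => cubeInd d n m * expChar x 0 m).Finite := by
    intro n
    refine (cube d n).finite_toSet.subset fun ℓ hℓ => ?_
    by_contra h
    have h' : ℓ ∉ cube d n := h
    exact hℓ (by simp [cubeInd, h'])
  have hlim1 : Tendsto (fun n : ℕ => c₀ * (‖a‖ ^ 2 * ∑ ρ, ((∑' ℓ,
        (starRingEnd ℂ) (fwdDiff (r ρ) (fun m => cubeInd d n m * expChar x 0 m) ℓ) *
          fwdDiff (r ρ) (fun m => cubeInd d n m * expChar x 0 m) ℓ) /
            (((n : ℝ) + 1) ^ d : ℝ)).re)) atTop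
      (𝓝 (c₀ * (‖a‖ ^ 2 * ∑ ρ, ((expChar x 0 (-(r ρ)) - 1) * (expChar x 0 (r ρ) - 1)).re))) :=
    (Tendsto.const_mul _ (tendsto_finsetSum _ fun ρ _ =>
      (Complex.continuous_re.tendsto _).comp (tendsto_planeWave x (r ρ) (r ρ)))).const_mul _
  have hlim2 : Tendsto (fun n : ℕ => (∑ ρ, ∑ σ, ((∑' ℓ,
        (starRingEnd ℂ) (fwdDiff (r σ) (fun m => cubeInd d n m * expChar x 0 m) ℓ) *
          fwdDiff (r ρ) (fun m => cubeInd d n m * expChar x 0 m) ℓ) /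
            (((n : ℝ) + 1) ^ d : ℝ)) * inner ℂ a (A ρ σ a)).re) atTop
      (𝓝 (∑ ρ, ∑ σ, ((expChar x 0 (-(r σ)) - 1) * (expChar x 0 (r ρ) - 1)) *
        inner ℂ a (A ρ σ a)).re) :=
    (Complex.continuous_re.tendsto _).comp (tendsto_finsetSum _ fun ρ _ =>
      tendsto_finsetSum _ fun σ _ => (tendsto_planeWave x (r ρ) (r σ)).mul_const _)
  -- Stability of the truncated wave, divided by the volume `(n+1)^d`, passes to the limit.
  have hle := le_of_tendsto_of_tendsto' hlim1 hlim2 fun n => by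
    have h := hstab _ (hfin n) a
    have hp : (0 : ℝ) < ((n : ℝ) + 1) ^ d := by positivity
    have h1 : ∀ z : ℂ, (z / (((n : ℝ) + 1) ^ d : ℝ)).re = z.re / ((n : ℝ) + 1) ^ d :=
      fun z => Complex.div_ofReal_re _ _
    simp only [h1, div_mul_eq_mul_div, ← Finset.sum_div]
    rw [mul_div_assoc', mul_div_assoc']
    gcongr
  have hsym : (∑ ρ, ∑ σ, ((expChar x 0 (-(r σ)) - 1) * (expChar x 0 (r ρ) - 1)) *
        inner ℂ a (A ρ σ a)) = inner ℂ a (latSymbol r A x 0 a) := by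
    simp only [latSymbol, _root_.sum_apply, inner_sum, _root_.smul_apply, inner_smul_right]
  have hre : ∀ ρ, ((expChar x 0 (-(r ρ)) - 1) * (expChar x 0 (r ρ) - 1)).re
      = ‖expChar x 0 (r ρ) - 1‖ ^ 2 := by
    intro ρ
    have h1 : expChar x 0 (-(r ρ)) - 1 = (starRingEnd ℂ) (expChar x 0 (r ρ) - 1) := by
      rw [expChar_zero_neg]; simp
    rw [h1, ← Complex.normSq_eq_conj_mul_self, Complex.normSq_eq_norm_sq, Complex.ofReal_re]
  simp only [hre] at hle
  rw [hsym] at hle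
  refine le_trans ?_ hle
  have h2 := hgen x hx
  have hS : 0 ≤ ∑ ρ, ‖expChar x 0 (r ρ) - 1‖ ^ 2 := Finset.sum_nonneg fun _ _ => sq_nonneg _
  have h3 : ‖x‖ ^ 2 / (C + 1) ≤ ∑ ρ, ‖expChar x 0 (r ρ) - 1‖ ^ 2 := by
    rw [div_le_iff₀ (by positivity)]
    linarith
  calc c₀ / (C + 1) * ‖x‖ ^ 2 * ‖a‖ ^ 2 = c₀ * (‖a‖ ^ 2 * (‖x‖ ^ 2 / (C + 1))) := by ring
    _ ≤ _ := by gcongr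

end coercivity

end

/-! ### Summation by parts and decay of all orders -/

section

open Finset Filter Topology

section summationByParts

variable {d : ℕ} {F : Type*} [NormedAddCommGroup F] [NormedSpace ℝ F]

/-- With decay of order `d` only, `h` need not be summable and the two halves of the difference
cannot be summed separately. A slowly varying cutoff is inserted, the difference is moved onto it,
and the power gained there permits dominated convergence to zero. -/
theorem tsum_fwdDiff_eq_zero (hd : 1 ≤ d) {K : ℝ} {α : ℕ} {h : (Fin d → ℤ) → F}
    (hh : ∀ k, ‖h k‖ ≤ K * (((‖k‖ + 2) ^ d)⁻¹ * Real.log (‖k‖ + 2) ^ α)) (σ : Fin d → ℤ)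
    (hs : Summable fun k => ‖fwdDiff σ h k‖) [CompleteSpace F] : ∑' k, fwdDiff σ h k = 0 := by
  -- It decays like `1/‖ℓ‖` for fixed `n`, which makes `χ n • h` summable; its differences are at
  -- most `‖σ‖ / (n + 1 + ‖ℓ‖)`, hence dominated uniformly in `n`.
  set χ : ℕ → (Fin d → ℤ) → ℝ := fun n ℓ => ((n : ℝ) + 1) / (n + 1 + ‖ℓ‖) with hχ
  have hn0 : ∀ n : ℕ, (0 : ℝ) ≤ n := fun n => Nat.cast_nonneg n
  have hχ0 : ∀ n ℓ, 0 ≤ χ n ℓ := fun n ℓ => by simp only [hχ]; positivity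
  have hχ1 : ∀ n ℓ, χ n ℓ ≤ 1 := fun n ℓ => by
    simp only [hχ]
    rw [div_le_one (by positivity)]
    linarith [norm_nonneg ℓ]
  have hlim : ∀ c : ℝ, Tendsto (fun n : ℕ => c / ((n : ℝ) + 1)) atTop (𝓝 0) := fun c =>
    tendsto_const_nhds.div_atTop (tendsto_atTop_add_const_right _ _ tendsto_natCast_atTop_atTop)
  have hχlim : ∀ ℓ, Tendsto (fun n => χ n ℓ) atTop (𝓝 1) := by
    intro ℓ
    have h1 : Tendsto (fun n : ℕ => (1 + ‖ℓ‖ / ((n : ℝ) + 1))⁻¹) atTop (𝓝 (1 + 0)⁻¹) :=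
      (tendsto_const_nhds.add (hlim ‖ℓ‖)).inv₀ (by norm_num)
    rw [add_zero, inv_one] at h1
    refine h1.congr fun n => ?_
    have := hn0 n
    simp only [hχ]
    field_simp
  have hχs : ∀ n, Summable fun ℓ => χ n ℓ • h ℓ := by
    intro n
    refine Summable.of_norm_bounded (g := fun ℓ => (2 * ((n : ℝ) + 1) * K) *
      (((‖ℓ‖ + 2) ^ (d + 1))⁻¹ * Real.log (‖ℓ‖ + 2) ^ α))
      ((summable_weight hd α).mul_left _) fun ℓ => ?_
    have h1 : χ n ℓ ≤ 2 * ((n : ℝ) + 1) * (‖ℓ‖ + 2)⁻¹ := by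
      have h2 := hn0 n
      have h3 := norm_nonneg ℓ
      simp only [hχ]
      rw [← div_eq_mul_inv, div_le_div_iff₀ (by positivity) (by positivity)]
      nlinarith [mul_nonneg h2 h3]
    rw [norm_smul, Real.norm_of_nonneg (hχ0 n ℓ)]
    have h4 := hn0 n
    calc _ ≤ (2 * ((n : ℝ) + 1) * (‖ℓ‖ + 2)⁻¹) *
          (K * (((‖ℓ‖ + 2) ^ d)⁻¹ * Real.log (‖ℓ‖ + 2) ^ α)) :=
          mul_le_mul h1 (hh ℓ) (norm_nonneg _) (by positivity)
      _ = _ := by rw [pow_succ, mul_inv]; ring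
  have hdiff : ∀ n ℓ, |χ n (ℓ - σ) - χ n ℓ| ≤ ‖σ‖ / (n + 1 + ‖ℓ‖) := by
    intro n ℓ
    have h2 := hn0 n
    have h3 : χ n (ℓ - σ) - χ n ℓ
        = χ n (ℓ - σ) * ((‖ℓ‖ - ‖ℓ - σ‖) / (n + 1 + ‖ℓ‖)) := by
      simp only [hχ]
      field_simp
      ring
    rw [h3, abs_mul, abs_of_nonneg (hχ0 _ _), abs_div,
      abs_of_pos (by positivity : (0 : ℝ) < n + 1 + ‖ℓ‖)]
    have h4 : |‖ℓ‖ - ‖ℓ - σ‖| ≤ ‖σ‖ := by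
      simpa using abs_norm_sub_norm_le ℓ (ℓ - σ)
    calc _ ≤ 1 * (‖σ‖ / (n + 1 + ‖ℓ‖)) := by
          gcongr
          exact hχ1 _ _
      _ = _ := one_mul _
  have hparts : ∀ n, ∑' ℓ, χ n ℓ • fwdDiff σ h ℓ = ∑' ℓ, (χ n (ℓ - σ) - χ n ℓ) • h ℓ := by
    intro n
    have hs1 : Summable fun ℓ => χ n ℓ • fwdDiff σ h ℓ := by
      refine Summable.of_norm_bounded hs fun ℓ => ?_
      rw [norm_smul, Real.norm_of_nonneg (hχ0 n ℓ)]
      exact mul_le_of_le_one_left (norm_nonneg _) (hχ1 n ℓ)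
    have hs2 : Summable fun ℓ => χ n ℓ • h (ℓ + σ) := by
      convert hs1.add (hχs n) using 2 with ℓ
      rw [fwdDiff, ← smul_add, sub_add_cancel]
    have hs3 : Summable fun ℓ => χ n (ℓ - σ) • h ℓ := by
      rw [← (Equiv.addRight σ).summable_iff]
      simpa [Function.comp_def] using hs2
    have h1 : ∑' ℓ, χ n (ℓ - σ) • h ℓ = ∑' ℓ, χ n ℓ • h (ℓ + σ) := by
      rw [← (Equiv.addRight σ).tsum_eq]
      simp
    simp only [sub_smul]
    rw [hs3.tsum_sub (hχs n), h1, ← hs2.tsum_sub (hχs n)]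
    exact tsum_congr fun ℓ => by rw [fwdDiff, smul_sub]
  have hl1 : Tendsto (fun n => ∑' ℓ, χ n ℓ • fwdDiff σ h ℓ) atTop (𝓝 (∑' ℓ, fwdDiff σ h ℓ)) := by
    refine tendsto_tsum_of_dominated_convergence hs (fun ℓ => ?_)
      (Eventually.of_forall fun n ℓ => ?_)
    · simpa using (hχlim ℓ).smul_const (fwdDiff σ h ℓ)
    · rw [norm_smul, Real.norm_of_nonneg (hχ0 n ℓ)]
      exact mul_le_of_le_one_left (norm_nonneg _) (hχ1 n ℓ)
  have hl2 : Tendsto (fun n => ∑' ℓ, (χ n (ℓ - σ) - χ n ℓ) • h ℓ) atTop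
      (𝓝 (∑' _ : Fin d → ℤ, (0 : F))) := by
    refine tendsto_tsum_of_dominated_convergence (bound := fun ℓ => (2 * ‖σ‖ * K) *
      (((‖ℓ‖ + 2) ^ (d + 1))⁻¹ * Real.log (‖ℓ‖ + 2) ^ α))
      ((summable_weight hd α).mul_left _) (fun ℓ => ?_) (Eventually.of_forall fun n ℓ => ?_)
    · have h1 : Tendsto (fun n => χ n (ℓ - σ) - χ n ℓ) atTop (𝓝 (1 - 1)) :=
        (hχlim _).sub (hχlim _)
      simpa using h1.smul_const (h ℓ)
    · rw [norm_smul, Real.norm_eq_abs]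
      have h1 : |χ n (ℓ - σ) - χ n ℓ| ≤ 2 * ‖σ‖ * (‖ℓ‖ + 2)⁻¹ := by
        have h2 := hn0 n
        refine (hdiff n ℓ).trans ?_
        rw [← div_eq_mul_inv, div_le_div_iff₀ (by positivity) (by positivity)]
        nlinarith [norm_nonneg σ, norm_nonneg ℓ, mul_nonneg (norm_nonneg σ) h2,
          mul_nonneg (norm_nonneg σ) (norm_nonneg ℓ)]
      calc _ ≤ (2 * ‖σ‖ * (‖ℓ‖ + 2)⁻¹) *
            (K * (((‖ℓ‖ + 2) ^ d)⁻¹ * Real.log (‖ℓ‖ + 2) ^ α)) :=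
            mul_le_mul h1 (hh ℓ) (norm_nonneg _) (by positivity)
        _ = _ := by rw [pow_succ, mul_inv]; ring
  rw [tsum_zero] at hl2
  simp only [hparts] at hl1
  exact tendsto_nhds_unique hl1 hl2

/-- With `q₁ = q(· - σ)` the Leibniz rule reads `D_σ (q₁ f) = q D_σ f + (D_σ q₁) f`. The left side
sums to zero by the borderline lemma above, and `D_σ q₁` has degree `< p`, so a difference gains one
vanishing moment. -/
theorem moments_fwdDiff (hd : 1 ≤ d) [CompleteSpace F] {p α : ℕ} {K : ℝ} {f : (Fin d → ℤ) → F}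
    (σ : Fin d → ℤ)
    (hf : ∀ k, ‖f k‖ ≤ K * (((‖k‖ + 2) ^ (d + p))⁻¹ * Real.log (‖k‖ + 2) ^ α))
    (hf' : ∀ k, ‖fwdDiff σ f k‖ ≤ K * (((‖k‖ + 2) ^ (d + (p + 1)))⁻¹ * Real.log (‖k‖ + 2) ^ α))
    (hmom : ∀ q, PolyLT p q → ∑' k, q k • f k = 0) (q : (Fin d → ℤ) → ℝ)
    (hq : PolyLT (p + 1) q) : ∑' k, q k • fwdDiff σ f k = 0 := by
  set q₁ : (Fin d → ℤ) → ℝ := fun k => q (k + -σ) with hq₁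
  have hq₁p : PolyLT (p + 1) q₁ := hq.shift (-σ)
  have hq₂ : PolyLT p (fwdDiff σ q₁) := hq₁p.fwdDiff σ rfl
  have hq₂' : ∀ k, fwdDiff σ q₁ k = q k - q₁ k := fun k => by simp [fwdDiff, hq₁]
  have hs1 : Summable fun k => ‖q k • fwdDiff σ f k‖ := by
    simpa only [norm_smul] using hq.summable_smul hd hf'
  have hs2 : Summable fun k => ‖fwdDiff σ q₁ k • f k‖ := by
    simpa only [norm_smul] using hq₂.summable_smul hd hf
  have hD : ∀ k, fwdDiff σ (fun k => q₁ k • f k) k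
      = q k • fwdDiff σ f k + fwdDiff σ q₁ k • f k := by
    intro k
    rw [hq₂']
    simp only [fwdDiff, hq₁, add_neg_cancel_right, smul_sub, sub_smul]
    abel
  obtain ⟨C, hC, hg⟩ := hq₁p.growth
  have h0 := tsum_fwdDiff_eq_zero hd (K := C * K) (α := α) (h := fun k => q₁ k • f k)
    (fun k => by
      have hw : 0 < ‖k‖ + 2 := by positivity
      have h1 := hg k
      rw [pow_succ, ← mul_assoc, mul_comm (‖k‖ + 2)] at h1
      have h2 := le_of_mul_le_mul_right h1 hw
      rw [norm_smul, Real.norm_eq_abs]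
      calc _ ≤ (C * (‖k‖ + 2) ^ p) * (K * (((‖k‖ + 2) ^ (d + p))⁻¹ * Real.log (‖k‖ + 2) ^ α)) :=
            mul_le_mul h2 (hf k) (norm_nonneg _) (by positivity)
        _ = _ := by
          rw [pow_add, mul_inv]
          field_simp) σ (by
      simp only [hD]
      exact Summable.of_nonneg_of_le (fun _ => norm_nonneg _) (fun _ => norm_add_le _ _)
        (hs1.add hs2))
  simp only [hD] at h0
  rw [hs1.of_norm.tsum_add hs2.of_norm, hmom _ hq₂, add_zero] at h0
  exact h0

theorem moments_ldiff (hd : 1 ≤ d) [CompleteSpace F] {ι : Type*} (r : ι → Fin d → ℤ) {p α M : ℕ}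
    {K : ℝ} {f : (Fin d → ℤ) → F}
    (hf : ∀ L : List ι, L.length ≤ M → ∀ k, ‖ldiff (L.map r) f k‖
      ≤ K * (((‖k‖ + 2) ^ (d + (p + L.length)))⁻¹ * Real.log (‖k‖ + 2) ^ α))
    (hmom : ∀ q, PolyLT p q → ∑' k, q k • f k = 0) (L : List ι) (hL : L.length ≤ M) :
    ∀ q, PolyLT (p + L.length) q → ∑' k, q k • ldiff (L.map r) f k = 0 := by
  induction L with
  | nil => simpa using hmom
  | cons ρ L ih =>
    rw [List.length_cons] at hL
    exact moments_fwdDiff hd (r ρ) (hf L (by omega)) (hf (ρ :: L) hL) (ih (by omega))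

end summationByParts

section decay

variable {d : ℕ} {ι : Type*} {F : Type*} [NormedAddCommGroup F]

theorem summable_sq_fwdDiff {w : (Fin d → ℤ) → F} (hw : Summable fun k => ‖w k‖ ^ 2)
    (s : Fin d → ℤ) : Summable fun k => ‖fwdDiff s w k‖ ^ 2 := by
  have h1 : Summable fun k => ‖w (k + s)‖ ^ 2 := 
    hw.comp_injective (add_left_injective s)
  refine Summable.of_nonneg_of_le (fun _ => sq_nonneg _) (fun k => ?_)
    ((h1.add hw).mul_left 2)
  have h2 := norm_sub_le (w (k + s)) (w k)
  calc ‖fwdDiff s w k‖ ^ 2 ≤ (‖w (k + s)‖ + ‖w k‖) ^ 2 := by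
        gcongr
        exact h2
    _ ≤ _ := by nlinarith [sq_nonneg (‖w (k + s)‖ - ‖w k‖)]

theorem summable_sq_ldiff {r : ι → Fin d → ℤ} {u : (Fin d → ℤ) → F}
    (hu : ∀ ρ, Summable fun k => ‖fwdDiff (r ρ) u k‖ ^ 2) (L : List ι) (hL : 1 ≤ L.length) :
    Summable fun k => ‖ldiff (L.map r) u k‖ ^ 2 := by
  induction L with
  | nil => simp at hL
  | cons ρ L ih =>
    rcases Nat.eq_zero_or_pos L.length with h | h
    · rw [List.length_eq_zero_iff] at h
      subst h
      exact hu ρ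
    · exact summable_sq_fwdDiff (ih h) (r ρ)

/-- Decay of lattice differences of all orders. -/
theorem ldiff_decay [Fintype ι] [InnerProductSpace ℂ F] [CompleteSpace F] (hd : 2 ≤ d) {r : ι → Fin d → ℤ}
    {A : ι → ι → F →L[ℂ] F} (hco : SymbolCoercive r A) (p α : ℕ) (L : List ι)
    (hL : 1 ≤ L.length) :
    ∃ C : ℝ, 0 ≤ C ∧ ∀ u : (Fin d → ℤ) → F,
      (∀ ρ, Summable fun k => ‖fwdDiff (r ρ) u k‖ ^ 2) → ∀ K : ℝ, 0 ≤ K →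
      (∀ k, ‖latOp r A u k‖ ≤ K * (((‖k‖ + 2) ^ (d + p))⁻¹ * Real.log (‖k‖ + 2) ^ α)) →
      (∀ q, PolyLT p q → ∑' k, q k • latOp r A u k = 0) →
      (∀ L' : List ι, 1 ≤ L'.length → L'.length + 2 ≤ L.length → ∀ k,
        ‖ldiff (L'.map r) (latOp r A u) k‖
          ≤ K * (((‖k‖ + 2) ^ (d + (p + L'.length)))⁻¹ * Real.log (‖k‖ + 2) ^ α)) →
      ∀ ℓ, ‖ldiff (L.map r) u ℓ‖ ≤ C * K *
        (((‖ℓ‖ + 2) ^ (d - 2 + L.length + p))⁻¹ * Real.log (‖ℓ‖ + 2) ^ (α + 1)) := by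
  rcases le_or_gt L.length 2 with h2 | h2
  · obtain ⟨C, hC, h⟩ := ldiff_decay_of_length_le_two hd hco (L.map r) (by simpa using hL)
      (by simpa using h2) p α
    refine ⟨C, hC, fun u hu K hK hf hmom _ ℓ => ?_⟩
    simpa using h u (summable_sq_ldiff hu L hL) K hK hf hmom ℓ
  -- Two differences are kept for the second-order estimate; the others go onto `u`, and `p` rises
  -- by `L'.length`.
  · obtain ⟨a, b, L', rfl⟩ : ∃ a b L', L = a :: b :: L' := by
      match L, h2 with
      | a :: b :: L', _ => exact ⟨a, b, L', rfl⟩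
    simp only [List.length_cons] at h2
    obtain ⟨C, hC, h⟩ := ldiff_decay_of_length_le_two hd hco [r a, r b] (by simp) (by simp)
      (p + L'.length) α
    refine ⟨C, hC, fun u hu K hK hf hmom hdiff ℓ => ?_⟩
    have hdec : ∀ L'' : List ι, L''.length ≤ L'.length → ∀ k,
        ‖ldiff (L''.map r) (latOp r A u) k‖
          ≤ K * (((‖k‖ + 2) ^ (d + (p + L''.length)))⁻¹ * Real.log (‖k‖ + 2) ^ α) := by
      intro L'' hL'' k
      rcases Nat.eq_zero_or_pos L''.length with h0 | h0
      · rw [List.length_eq_zero_iff] at h0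
        subst h0
        exact hf k
      · exact hdiff L'' h0 (by simpa using hL'') k
    have hlat := latOp_ldiff r A (L'.map r) u
    have h1 := h (ldiff (L'.map r) u) (summable_sq_ldiff hu (a :: b :: L') (by simp)) K hK
      (by rw [hlat]; exact hdec L' le_rfl)
      (by rw [hlat]; exact moments_ldiff (by omega) r hdec hmom L' le_rfl) ℓ
    have h3 : d - 2 + [r a, r b].length + (p + L'.length)
        = d - 2 + (a :: b :: L').length + p := by
      simp only [List.length_cons, List.length_nil]
      omega
    rw [h3] at h1
    exact h1

end decay

end

/-! ### Complexification of the Hessian -/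

section

open Finset Filter Topology

section complexification

variable {N : ℕ} {ι : Type*} [Fintype ι]

/-- Complexification of a real vector. -/
noncomputable def complexify (N : ℕ) : EuclideanSpace ℝ (Fin N) →ₗᵢ[ℝ] EuclideanSpace ℂ (Fin N) where
  toFun v := WithLp.toLp 2 fun i => (v i : ℂ)
  map_add' v w := by ext i; simp
  map_smul' c v := by ext i; simp
  norm_map' v := by simp [EuclideanSpace.norm_eq]

/-- Real part of a complex vector. -/
noncomputable def vecRe (v : EuclideanSpace ℂ (Fin N)) : EuclideanSpace ℝ (Fin N) :=
  WithLp.toLp 2 fun i => (v i).re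

/-- Imaginary part of a complex vector. -/
noncomputable def vecIm (v : EuclideanSpace ℂ (Fin N)) : EuclideanSpace ℝ (Fin N) :=
  WithLp.toLp 2 fun i => (v i).im

theorem norm_sq_vecRe_add (v : EuclideanSpace ℂ (Fin N)) :
    ‖vecRe v‖ ^ 2 + ‖vecIm v‖ ^ 2 = ‖v‖ ^ 2 := by
  rw [EuclideanSpace.norm_sq_eq, EuclideanSpace.norm_sq_eq, EuclideanSpace.norm_sq_eq,
    ← Finset.sum_add_distrib]
  refine Finset.sum_congr rfl fun i _ => ?_
  rw [← Complex.normSq_eq_norm_sq, Complex.normSq_apply]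
  simp [vecRe, vecIm]
  ring

open Classical in
/-- The block of the Hessian that couples the bonds `ρ` and `σ`. -/
noncomputable def hessBlock (V : (ι → EuclideanSpace ℝ (Fin N)) → ℝ) (ρ σ : ι) :
    Matrix (Fin N) (Fin N) ℝ :=
  Matrix.of fun j i => hessZero V (Pi.single ρ (EuclideanSpace.single i 1))
    (Pi.single σ (EuclideanSpace.single j 1))

/-- The complexified block of the Hessian as an operator. -/
noncomputable def hessOp (V : (ι → EuclideanSpace ℝ (Fin N)) → ℝ) (ρ σ : ι) :
    EuclideanSpace ℂ (Fin N) →L[ℂ] EuclideanSpace ℂ (Fin N) :=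
  Matrix.toEuclideanCLM (𝕜 := ℂ) ((hessBlock V ρ σ).map fun x => (x : ℂ))

theorem hessOp_apply (V : (ι → EuclideanSpace ℝ (Fin N)) → ℝ) (ρ σ : ι)
    (v : EuclideanSpace ℂ (Fin N)) (j : Fin N) :
    hessOp V ρ σ v j = ∑ i, (hessBlock V ρ σ j i : ℂ) * v i := by
  rw [hessOp, Matrix.ofLp_toEuclideanCLM]
  rfl

open Classical in
theorem eq_sum_single (b : ι → EuclideanSpace ℝ (Fin N)) :
    b = ∑ ρ, ∑ i, b ρ i • (Pi.single ρ (EuclideanSpace.single i 1) :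
      ι → EuclideanSpace ℝ (Fin N)) := by
  ext ρ i
  simp only [Finset.sum_apply, WithLp.ofLp_sum, Pi.smul_apply, WithLp.ofLp_smul]
  rw [Finset.sum_eq_single ρ, Finset.sum_eq_single i]
  · simp
  · intro j _ hj
    simp [hj.symm]
  · simp
  · intro σ _ hσ
    simp [Pi.single_eq_of_ne hσ.symm]
  · simp

theorem hessZeroApply_apply (V : (ι → EuclideanSpace ℝ (Fin N)) → ℝ)
    (b : ι → EuclideanSpace ℝ (Fin N)) (σ : ι) (j : Fin N) :
    hessZeroApply V b σ j = ∑ ρ, ∑ i, hessBlock V ρ σ j i * b ρ i := by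
  classical
  have h := congrArg (fun x => hessZero V x (Pi.single σ (EuclideanSpace.single j 1)))
    (eq_sum_single b)
  have h2 : ∀ b' : ι → EuclideanSpace ℝ (Fin N), hessZeroApply V b' σ j
      = hessZero V b' (Pi.single σ (EuclideanSpace.single j 1)) := fun b' => by
    simp only [hessZeroApply]
  rw [h2]
  refine h.trans ?_
  simp only [hessZero, map_sum, _root_.sum_apply, map_smul, _root_.smul_apply, smul_eq_mul]
  refine Finset.sum_congr rfl fun ρ _ => Finset.sum_congr rfl fun i _ => ?_
  rw [mul_comm]
  simp only [hessBlock, Matrix.of_apply, hessZero]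

theorem hessZero_eq_sum (V : (ι → EuclideanSpace ℝ (Fin N)) → ℝ)
    (a b : ι → EuclideanSpace ℝ (Fin N)) :
    hessZero V a b = ∑ σ, ∑ j, b σ j * hessZeroApply V a σ j := by
  classical
  refine (congrArg (hessZero V a) (eq_sum_single b)).trans ?_
  simp only [hessZero, map_sum, map_smul, smul_eq_mul]
  refine Finset.sum_congr rfl fun σ _ => Finset.sum_congr rfl fun j _ => ?_
  simp only [hessZeroApply, hessZero]

theorem complexify_hessZeroApply (V : (ι → EuclideanSpace ℝ (Fin N)) → ℝ)
    (b : ι → EuclideanSpace ℝ (Fin N)) (σ : ι) :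
    complexify N (hessZeroApply V b σ) = ∑ ρ, hessOp V ρ σ (complexify N (b ρ)) := by
  ext j
  have h1 : ∀ v : EuclideanSpace ℝ (Fin N), ∀ i, complexify N v i = (v i : ℂ) := fun _ _ => rfl
  rw [h1, hessZeroApply_apply, WithLp.ofLp_sum, Finset.sum_apply]
  simp only [hessOp_apply, h1]
  push_cast
  rfl

/-- The Hessian blocks are real, so the real part of the sesquilinear form splits into the forms of
the real and imaginary parts. This lets stability for real displacements be tested with complex
plane waves. -/
theorem hessZero_vecRe_add_vecIm (V : (ι → EuclideanSpace ℝ (Fin N)) → ℝ)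
    (z : ι → ℂ) (a : EuclideanSpace ℂ (Fin N)) :
    hessZero V (fun ρ => vecRe (z ρ • a)) (fun ρ => vecRe (z ρ • a)) +
      hessZero V (fun ρ => vecIm (z ρ • a)) (fun ρ => vecIm (z ρ • a))
      = (∑ ρ, ∑ σ, ((starRingEnd ℂ) (z σ) * z ρ) * inner ℂ a (hessOp V ρ σ a)).re := by
  have h1 : ∀ ρ σ, ((starRingEnd ℂ) (z σ) * z ρ) * inner ℂ a (hessOp V ρ σ a)
      = ∑ j, (starRingEnd ℂ) (z σ • a j) * ∑ i, (hessBlock V ρ σ j i : ℂ) * (z ρ • a i) := by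
    intro ρ σ
    rw [PiLp.inner_apply, Finset.mul_sum]
    refine Finset.sum_congr rfl fun j _ => ?_
    rw [hessOp_apply, RCLike.inner_apply, smul_eq_mul, map_mul, Finset.sum_mul, Finset.mul_sum,
      Finset.mul_sum]
    refine Finset.sum_congr rfl fun i _ => ?_
    rw [smul_eq_mul]
    ring
  simp only [h1]
  rw [hessZero_eq_sum, hessZero_eq_sum, ← Finset.sum_add_distrib, Finset.sum_comm, Complex.re_sum]
  refine Finset.sum_congr rfl fun σ _ => ?_
  rw [← Finset.sum_add_distrib, Finset.sum_comm, Complex.re_sum]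
  refine Finset.sum_congr rfl fun j _ => ?_
  rw [← Finset.mul_sum, Complex.mul_re, hessZeroApply_apply, hessZeroApply_apply, Complex.re_sum,
    Complex.im_sum]
  simp only [Complex.re_sum, Complex.im_sum, Complex.re_ofReal_mul, Complex.im_ofReal_mul,
    Complex.conj_re, Complex.conj_im, neg_mul, sub_neg_eq_add]
  rfl

end complexification

end

/-! ### Transfer between the Bravais lattice and `ℤᵈ` -/

section

open Finset Filter Topology

section lattice

variable {d : ℕ} {A : Matrix (Fin d) (Fin d) ℝ}

/-- The coordinates isomorphism `ℤᵈ ≃ A ℤᵈ`. -/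
noncomputable def latticeEquiv (hA : A.det ≠ 0) : (Fin d → ℤ) ≃+ bravaisLattice A :=
  AddEquiv.ofBijective
    ({ toFun := fun k => ⟨WithLp.toLp 2 (A.mulVec fun i => (k i : ℝ)), k, rfl⟩
       map_zero' := by
        ext1
        have h : (fun i : Fin d => (((0 : Fin d → ℤ) i : ℤ) : ℝ)) = 0 := by ext i; simp
        change WithLp.toLp 2 (A.mulVec fun i => (((0 : Fin d → ℤ) i : ℤ) : ℝ)) = 0
        rw [h, Matrix.mulVec_zero]
        rfl
       map_add' := fun k l => by
        ext1
        change WithLp.toLp 2 (A.mulVec fun i => (((k + l) i : ℤ) : ℝ))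
          = WithLp.toLp 2 (A.mulVec fun i => (k i : ℝ)) + WithLp.toLp 2 (A.mulVec fun i => (l i : ℝ))
        rw [← WithLp.toLp_add, ← Matrix.mulVec_add]
        congr 2
        ext i
        simp } : (Fin d → ℤ) →+ bravaisLattice A)
    ⟨fun k l h => by
      have h1 : A.mulVec (fun i => (k i : ℝ)) = A.mulVec fun i => (l i : ℝ) :=
        congrArg (fun x : bravaisLattice A => WithLp.ofLp (x : EuclideanSpace ℝ (Fin d))) h
      have h2 := Matrix.mulVec_injective_of_isUnit
        ((Matrix.isUnit_iff_isUnit_det A).2 (isUnit_iff_ne_zero.2 hA)) h1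
      ext i
      exact_mod_cast congrFun h2 i,
    fun x => by
      obtain ⟨x, k, rfl⟩ := x
      exact ⟨k, rfl⟩⟩

theorem coe_latticeEquiv (hA : A.det ≠ 0) (k : Fin d → ℤ) :
    (latticeEquiv hA k : EuclideanSpace ℝ (Fin d))
      = WithLp.toLp 2 (A.mulVec fun i => (k i : ℝ)) := rfl

theorem coord_eq_sum (hA : A.det ≠ 0) (k : Fin d → ℤ) (i : Fin d) :
    (k i : ℝ) = ∑ t, A⁻¹ i t * (latticeEquiv hA k : EuclideanSpace ℝ (Fin d)) t := by
  have h : A⁻¹.mulVec (A.mulVec fun i => (k i : ℝ)) = fun i => (k i : ℝ) := by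
    rw [Matrix.mulVec_mulVec, Matrix.nonsing_inv_mul _ (isUnit_iff_ne_zero.2 hA),
      Matrix.one_mulVec]
  exact (congrFun h i).symm

theorem norm_cast_vec (k : Fin d → ℤ) : ‖fun i => (k i : ℝ)‖ = ‖k‖ := by
  rw [Pi.norm_def, Pi.norm_def]
  congr 2

theorem exists_norm_compare (hA : A.det ≠ 0) : ∃ c : ℝ, 1 ≤ c ∧ ∀ k : Fin d → ℤ,
    modulus₀ (latticeEquiv hA k) ≤ c * (‖k‖ + 2) ∧ ‖k‖ + 2 ≤ c * modulus₀ (latticeEquiv hA k) := by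
  obtain ⟨c₁, hc₁, h₁⟩ : ∃ c : ℝ, 0 ≤ c ∧ ∀ v : Fin d → ℝ, ‖WithLp.toLp 2 (A.mulVec v)‖ ≤ c * ‖v‖ := by
    let T : (Fin d → ℝ) →L[ℝ] EuclideanSpace ℝ (Fin d) :=
      LinearMap.toContinuousLinearMap
        ((WithLp.linearEquiv 2 ℝ (Fin d → ℝ)).symm.toLinearMap ∘ₗ A.mulVecLin)
    exact ⟨‖T‖, norm_nonneg _, fun v => T.le_opNorm v⟩
  obtain ⟨c₂, hc₂, h₂⟩ : ∃ c : ℝ, 0 ≤ c ∧ ∀ v : EuclideanSpace ℝ (Fin d),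
      ‖A⁻¹.mulVec (WithLp.ofLp v)‖ ≤ c * ‖v‖ := by
    let T : EuclideanSpace ℝ (Fin d) →L[ℝ] (Fin d → ℝ) :=
      LinearMap.toContinuousLinearMap
        (A⁻¹.mulVecLin ∘ₗ (WithLp.linearEquiv 2 ℝ (Fin d → ℝ)).toLinearMap)
    exact ⟨‖T‖, norm_nonneg _, fun v => T.le_opNorm v⟩
  -- The constants bound `A` and its inverse; the `+ 1` accounts for the summand `2` in the weights.
  refine ⟨c₁ + c₂ + 1, by linarith, fun k => ?_⟩
  have hk := norm_nonneg k
  have hx := norm_nonneg (latticeEquiv hA k : EuclideanSpace ℝ (Fin d))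
  have h3 : ‖(latticeEquiv hA k : EuclideanSpace ℝ (Fin d))‖ ≤ c₁ * ‖k‖ := by
    rw [coe_latticeEquiv, ← norm_cast_vec k]
    exact h₁ _
  have h4 : ‖k‖ ≤ c₂ * ‖(latticeEquiv hA k : EuclideanSpace ℝ (Fin d))‖ := by
    rw [← norm_cast_vec k]
    have h5 : (fun i => (k i : ℝ))
        = A⁻¹.mulVec (WithLp.ofLp (latticeEquiv hA k : EuclideanSpace ℝ (Fin d))) :=
      funext fun i => coord_eq_sum hA k i
    rw [h5]
    exact h₂ _
  unfold modulus₀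
  constructor <;> nlinarith [mul_nonneg hc₁ hk, mul_nonneg hc₂ hk, mul_nonneg hc₁ hx,
    mul_nonneg hc₂ hx]

/-- The factor depends on `M` and not on `n`, so one constant serves all the orders of differences
that occur. The summand `log c` is absorbed because `log y ≥ log 2`. -/
theorem weight_compare {c : ℝ} (hc : 1 ≤ c) {n M : ℕ} (hn : n ≤ M) (α : ℕ) {x y : ℝ} (hx : 2 ≤ x)
    (hy : 2 ≤ y) (hxy : x ≤ c * y) (hyx : y ≤ c * x) :
    (x ^ n)⁻¹ * Real.log x ^ α
      ≤ (c ^ M * (1 + Real.log c / Real.log 2) ^ α) * ((y ^ n)⁻¹ * Real.log y ^ α) := by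
  have hl2 : 0 < Real.log 2 := Real.log_pos (by norm_num)
  have hlc : 0 ≤ Real.log c := Real.log_nonneg hc
  have hlx : 0 ≤ Real.log x := Real.log_nonneg (by linarith)
  have hly : Real.log 2 ≤ Real.log y := Real.log_le_log (by norm_num) hy
  have h1 : (x ^ n)⁻¹ ≤ c ^ M * (y ^ n)⁻¹ := by
    rw [← div_eq_mul_inv, ← one_div, div_le_div_iff₀ (by positivity) (by positivity), one_mul]
    calc y ^ n ≤ (c * x) ^ n := by gcongr
      _ = c ^ n * x ^ n := mul_pow _ _ _
      _ ≤ c ^ M * x ^ n := by gcongr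
  have h2 : Real.log x ≤ (1 + Real.log c / Real.log 2) * Real.log y := by
    have h3 : Real.log x ≤ Real.log c + Real.log y := by
      rw [← Real.log_mul (by linarith) (by linarith)]
      exact Real.log_le_log (by linarith) hxy
    have h4 : Real.log c ≤ Real.log c / Real.log 2 * Real.log y := by
      rw [div_mul_eq_mul_div, le_div_iff₀ hl2]
      gcongr
    linarith
  calc _ ≤ (c ^ M * (y ^ n)⁻¹) * ((1 + Real.log c / Real.log 2) * Real.log y) ^ α := by gcongr
    _ = _ := by rw [mul_pow]; ring

/-- The real monomials of degree less than `p` in the lattice coordinates. -/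
def latticeMonomials (hA : A.det ≠ 0) (p : ℕ) : Set ((Fin d → ℤ) → ℝ) :=
  {q | ∃ i < p, ∃ s : Fin i → Fin d,
    q = fun k => ∏ m, (latticeEquiv hA k : EuclideanSpace ℝ (Fin d)) (s m)}

theorem PolyLT.sum {κ : Type*} (t : Finset κ) {p : ℕ} {q : κ → (Fin d → ℤ) → ℝ}
    (h : ∀ i, PolyLT p (q i)) : PolyLT p (∑ i ∈ t, q i) := by
  classical
  induction t using Finset.induction_on with
  | empty => exact PolyLT.zero p
  | insert i t hi ih => rw [Finset.sum_insert hi]; exact (h i).add ih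

theorem polyLT_monomial (hA : A.det ≠ 0) (i : ℕ) (s : Fin i → Fin d) :
    PolyLT (i + 1) fun k => ∏ m, (latticeEquiv hA k : EuclideanSpace ℝ (Fin d)) (s m) := by
  induction i with
  | zero => simpa using PolyLT.const 0 1
  | succ i ih =>
    have h : PolyLT (i + 1 + 1) (∑ t, A (s 0) t • fun k : Fin d → ℤ =>
        (k t : ℝ) * ∏ m, (latticeEquiv hA k : EuclideanSpace ℝ (Fin d)) (Fin.tail s m)) :=
      PolyLT.sum _ fun t => (PolyLT.coord_mul t (ih (Fin.tail s))).smul _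
    convert h using 1
    ext k
    rw [Fin.prod_univ_succ, coe_latticeEquiv]
    simp only [Finset.sum_apply, Pi.smul_apply, smul_eq_mul, ← mul_assoc]
    rw [← Finset.sum_mul]
    rfl

theorem coord_mul_mem_span (hA : A.det ≠ 0) {p : ℕ} {q : (Fin d → ℤ) → ℝ}
    (hq : q ∈ Submodule.span ℝ (latticeMonomials hA p)) (t : Fin d) :
    (fun k => (latticeEquiv hA k : EuclideanSpace ℝ (Fin d)) t * q k)
      ∈ Submodule.span ℝ (latticeMonomials hA (p + 1)) := by
  induction hq using Submodule.span_induction with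
  | mem q hq =>
    obtain ⟨i, hi, s, rfl⟩ := hq
    refine Submodule.subset_span ⟨i + 1, by omega, Fin.cons t s, ?_⟩
    ext k
    rw [Fin.prod_univ_succ]
    simp
  | zero =>
    convert Submodule.zero_mem (Submodule.span ℝ (latticeMonomials hA (p + 1))) using 1
    ext k
    simp
  | add q q' _ _ ih ih' =>
    convert Submodule.add_mem _ ih ih' using 1
    ext k
    simp [mul_add]
  | smul c q _ ih =>
    convert Submodule.smul_mem _ c ih using 1
    ext k
    simp [mul_left_comm]

/-- The integer coordinates are linear in the Euclidean ones through `A⁻¹`, so the moment hypotheses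
on `Λ` control all polynomials on `ℤᵈ`. The converse `polyLT_monomial` serves for summability. -/
theorem PolyLT.mem_span (hA : A.det ≠ 0) {p : ℕ} {q : (Fin d → ℤ) → ℝ} (hq : PolyLT p q) :
    q ∈ Submodule.span ℝ (latticeMonomials hA p) := by
  induction hq with
  | zero p => exact Submodule.zero_mem _
  | const p c =>
    have h : (fun _ : Fin d → ℤ => (1 : ℝ)) ∈ Submodule.span ℝ (latticeMonomials hA (p + 1)) :=
      Submodule.subset_span ⟨0, by omega, Fin.elim0, by simp⟩
    convert Submodule.smul_mem _ c h using 1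
    ext k
    simp
  | @coord_mul p q i _ ih =>
    have h : ∑ t, A⁻¹ i t • (fun k => (latticeEquiv hA k : EuclideanSpace ℝ (Fin d)) t * q k)
        ∈ Submodule.span ℝ (latticeMonomials hA (p + 1)) :=
      Submodule.sum_mem _ fun t _ => Submodule.smul_mem _ _ (coord_mul_mem_span hA ih t)
    convert h using 1
    ext k
    rw [coord_eq_sum hA k i, Finset.sum_mul]
    simp [mul_assoc]
  | add _ _ ih ih' => exact Submodule.add_mem _ ih ih'
  | smul c _ ih => exact Submodule.smul_mem _ c ih

/-- `HasSum` rather than an equation of sums, so that convergence is carried along with the value in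
the induction over the span. -/
theorem hasSum_polyLT_smul (hA : A.det ≠ 0) (hd : 1 ≤ d) {N p α : ℕ} {K : ℝ}
    {f : bravaisLattice A → EuclideanSpace ℝ (Fin N)}
    (hf : ∀ k, ‖f (latticeEquiv hA k)‖
      ≤ K * (((‖k‖ + 2) ^ (d + p))⁻¹ * Real.log (‖k‖ + 2) ^ α))
    (hmom : ∀ i < p, forceMoment i f = 0) {q : (Fin d → ℤ) → ℝ} (hq : PolyLT p q) :
    HasSum (fun k => q k • f (latticeEquiv hA k)) 0 := by
  have hspan := hq.mem_span hA
  clear hq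
  induction hspan using Submodule.span_induction with
  | mem q hq =>
    obtain ⟨i, hi, s, rfl⟩ := hq
    have hs : Summable fun k => (∏ m, (latticeEquiv hA k : EuclideanSpace ℝ (Fin d)) (s m)) •
        f (latticeEquiv hA k) := Summable.of_norm (by
      simpa only [norm_smul] using ((polyLT_monomial hA i s).mono hi).summable_smul hd hf)
    convert hs.hasSum using 1
    ext j
    have h1 := congrFun (congrFun (hmom i hi) j) s
    rw [forceMoment, ← (latticeEquiv hA).toEquiv.tsum_eq] at h1
    have h2 := (hs.hasSum.mapL (EuclideanSpace.proj (𝕜 := ℝ) j)).tsum_eq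
    change 0 = EuclideanSpace.proj (𝕜 := ℝ) j (∑' k, _)
    rw [← h2]
    refine h1.symm.trans (tsum_congr fun k => ?_)
    rw [mul_comm]
    rfl
  | zero => simp
  | add q q' _ _ ih ih' => simpa [add_smul] using ih.add ih'
  | smul c q _ ih => simpa [mul_smul] using ih.const_smul c

end lattice

section transfer

theorem ldiff_comp_addEquiv {G G' X : Type*} [AddCommGroup G] [AddCommGroup G'] [AddCommGroup X]
    (e : G ≃+ G') (L : List G) (u : G' → X) (k : G) :
    ldiff L (fun k => u (e k)) k = ldiff (L.map e) u (e k) := by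
  induction L generalizing k with
  | nil => rfl
  | cons s L ih => simp only [ldiff_cons, List.map_cons, fwdDiff, ih, map_add]

theorem ldiff_comp_addHom {G X Y : Type*} [AddCommGroup G] [AddCommGroup X] [AddCommGroup Y]
    (T : X →+ Y) (L : List G) (u : G → X) (k : G) :
    ldiff L (fun k => T (u k)) k = T (ldiff L u k) := by
  induction L generalizing k with
  | nil => rfl
  | cons s L ih => simp only [ldiff_cons, fwdDiff, ih, map_sub]

theorem norm_iterDiff_le_stencilNorm {G X : Type*} [AddCommGroup G] [NormedAddCommGroup X]
    (R : Finset G) (j : ℕ) (u : G → X) (ℓ : G) (ρ : Fin j → R) :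
    ‖iterDiff j (fun i => (ρ i : G)) u ℓ‖ ≤ stencilNorm R j u ℓ := by
  rw [stencilNorm]
  refine Real.le_sqrt_of_sq_le ?_
  exact Finset.single_le_sum
    (f := fun ρ : Fin j → R => ‖iterDiff j (fun i => (ρ i : G)) u ℓ‖ ^ 2)
    (fun _ _ => sq_nonneg _) (Finset.mem_univ ρ)

theorem stencilNorm_le_sum {G X : Type*} [AddCommGroup G] [NormedAddCommGroup X]
    (R : Finset G) (j : ℕ) (u : G → X) (ℓ : G) :
    stencilNorm R j u ℓ ≤ ∑ ρ : Fin j → R, ‖iterDiff j (fun i => (ρ i : G)) u ℓ‖ := by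
  have h : 0 ≤ ∑ ρ : Fin j → R, ‖iterDiff j (fun i => (ρ i : G)) u ℓ‖ :=
    Finset.sum_nonneg fun _ _ => norm_nonneg _
  rw [stencilNorm, Real.sqrt_le_left h]
  exact Finset.sum_sq_le_sq_sum_of_nonneg fun _ _ => norm_nonneg _

theorem stencilNorm_one_sq {G X : Type*} [AddCommGroup G] [NormedAddCommGroup X]
    (R : Finset G) (u : G → X) (ℓ : G) :
    stencilNorm R 1 u ℓ ^ 2 = ∑ ρ : R, ‖fwdDiff (ρ : G) u ℓ‖ ^ 2 := by
  rw [stencilNorm, Real.sq_sqrt (Finset.sum_nonneg fun _ _ => sq_nonneg _)]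
  exact Fintype.sum_equiv (Equiv.funUnique (Fin 1) R) _ _ fun ρ => rfl

end transfer

end

/-! ### The linearised force and lattice stability in coordinates -/

section

open Finset Filter Topology

section linearisedForce

variable {d N : ℕ} {G : Type*} [AddCommGroup G] (φ : (Fin d → ℤ) ≃+ G) (R : Finset G)
  (V : (R → EuclideanSpace ℝ (Fin N)) → ℝ)

theorem latOp_complexify (u : G → EuclideanSpace ℝ (Fin N)) (k : Fin d → ℤ) :
    latOp (fun ρ : R => φ.symm ρ) (hessOp V) (fun k => complexify N (u (φ k))) k
      = complexify N (linForce R V u (φ k)) := by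
  rw [linForce, discreteDiv, neg_neg, map_sum, latOp, Finset.sum_comm]
  refine Finset.sum_congr rfl fun σ _ => ?_
  rw [fwdDiff, map_sub, complexify_hessZeroApply, complexify_hessZeroApply,
    ← Finset.sum_sub_distrib]
  refine Finset.sum_congr rfl fun ρ _ => ?_
  simp only [fwdDiff, stencil, map_add, map_neg, map_sub, AddEquiv.apply_symm_apply]

theorem closure_range_symm (hR : AddSubgroup.closure (R : Set G) = ⊤) :
    AddSubgroup.closure (Set.range fun ρ : R => φ.symm ρ) = ⊤ := by
  have h : Set.range (fun ρ : R => φ.symm ρ) = (φ.symm : G →+ (Fin d → ℤ)) '' (R : Set G) := by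
    ext x
    simp
  rw [h, ← AddMonoidHom.map_closure, hR, ← AddMonoidHom.range_eq_map,
    AddMonoidHom.range_eq_top]
  exact φ.symm.surjective

theorem summable_sq_fwdDiff_complexify {u : G → EuclideanSpace ℝ (Fin N)} (hu : MemH1 R u)
    (ρ : R) :
    Summable fun k => ‖fwdDiff (φ.symm ρ) (fun k => complexify N (u (φ k))) k‖ ^ 2 := by
  refine Summable.of_nonneg_of_le (fun _ => sq_nonneg _) (fun k => ?_)
    (φ.toEquiv.summable_iff.2 hu)
  change _ ≤ stencilNorm R 1 u (φ k) ^ 2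
  rw [stencilNorm_one_sq]
  have h : fwdDiff (φ.symm ρ) (fun k => complexify N (u (φ k))) k
      = complexify N (fwdDiff (ρ : G) u (φ k)) := by simp [fwdDiff]
  rw [h, LinearIsometry.norm_map]
  exact Finset.single_le_sum (f := fun ρ : R => ‖fwdDiff (ρ : G) u (φ k)‖ ^ 2)
    (fun _ _ => sq_nonneg _) (Finset.mem_univ ρ)

/-- The additive map `P` stands for real or imaginary part, so stability of real displacements
applies to both parts of the complex test function `s • a`. The finite set `T` contains the supports
of all its differences. -/
theorem stability_of_additive {c₀ : ℝ}
    (hstab : ∀ u : G → EuclideanSpace ℝ (Fin N), MemHc R u →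
      c₀ * ∑' ℓ, stencilNorm R 1 u ℓ ^ 2 ≤ ∑' ℓ, hessZero V (stencil R u ℓ) (stencil R u ℓ))
    (P : EuclideanSpace ℂ (Fin N) →+ EuclideanSpace ℝ (Fin N)) (s : (Fin d → ℤ) → ℂ)
    (a : EuclideanSpace ℂ (Fin N)) (T : Finset (Fin d → ℤ))
    (hT : ∀ ρ : R, ∀ k ∉ T, fwdDiff (φ.symm ρ) s k = 0) :
    c₀ * ∑ k ∈ T, ∑ ρ : R, ‖P (fwdDiff (φ.symm ρ) s k • a)‖ ^ 2
      ≤ ∑ k ∈ T, hessZero V (fun ρ => P (fwdDiff (φ.symm ρ) s k • a))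
          (fun ρ => P (fwdDiff (φ.symm ρ) s k • a)) := by
  have h1 : ∀ k, stencil R (fun ℓ => P (s (φ.symm ℓ) • a)) (φ k)
      = fun ρ : R => P (fwdDiff (φ.symm ρ) s k • a) := fun k => by
    ext1 ρ
    simp [stencil, fwdDiff, sub_smul]
  have h0 : ∀ k ∉ T, stencil R (fun ℓ => P (s (φ.symm ℓ) • a)) (φ k) = 0 := fun k hk => by
    rw [h1]
    ext1 ρ
    simp [hT ρ k hk]
  have h2 := hstab (fun ℓ => P (s (φ.symm ℓ) • a)) (by
    refine (T.finite_toSet.image φ).subset fun ℓ hℓ => ?_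
    refine ⟨φ.symm ℓ, ?_, φ.apply_symm_apply ℓ⟩
    by_contra hk
    exact hℓ (by simpa using h0 _ hk))
  have h3 : ∀ k, stencilNorm R 1 (fun ℓ => P (s (φ.symm ℓ) • a)) (φ k) ^ 2
      = ∑ ρ : R, ‖P (fwdDiff (φ.symm ρ) s k • a)‖ ^ 2 := fun k => by
    rw [stencilNorm_one_sq]
    exact Finset.sum_congr rfl fun ρ _ => by rw [← congrFun (h1 k) ρ]; rfl
  rw [← φ.toEquiv.tsum_eq, ← φ.toEquiv.tsum_eq, tsum_eq_sum (s := T), tsum_eq_sum (s := T)] at h2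
  · simpa only [AddEquiv.toEquiv_eq_coe, AddEquiv.coe_toEquiv, h1, h3] using h2
  · intro k hk
    simp only [AddEquiv.toEquiv_eq_coe, AddEquiv.coe_toEquiv]
    rw [h0 k hk]
    simp [hessZero]
  · intro k hk
    simp only [AddEquiv.toEquiv_eq_coe, AddEquiv.coe_toEquiv]
    rw [h3]
    exact Finset.sum_eq_zero fun ρ _ => by simp [hT ρ k hk]

theorem symbolCoercive_of_latticeStable (hR : AddSubgroup.closure (R : Set G) = ⊤)
    (hstable : LatticeStable R V) : SymbolCoercive (fun ρ : R => φ.symm ρ) (hessOp V) := by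
  classical
  obtain ⟨c₀, hc₀, hstab⟩ := hstable
  refine symbolCoercive_of_stable (closure_range_symm φ R hR) hc₀ fun s hs a => ?_
  -- The support of `s` and its translates by `-ρ`: outside both, `D_ρ s` vanishes.
  let T : Finset (Fin d → ℤ) := hs.toFinset ∪
    Finset.univ.biUnion fun ρ : R => hs.toFinset.image fun k => k - φ.symm ρ
  have hT : ∀ ρ : R, ∀ k ∉ T, fwdDiff (φ.symm ρ) s k = 0 := fun ρ k hk => by
    simp only [T, Finset.mem_union, Set.Finite.mem_toFinset, Finset.mem_biUnion,
      Finset.mem_univ, true_and, Finset.mem_image, not_or, not_exists, not_and,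
      Function.mem_support, not_not] at hk
    have h1 : s (k + φ.symm ρ) = 0 := by
      by_contra h
      exact hk.2 ρ _ h (by abel)
    rw [fwdDiff, h1, hk.1, sub_zero]
  have hsum : ∀ ρ σ : R, ∑' ℓ, (starRingEnd ℂ) (fwdDiff (φ.symm σ) s ℓ) * fwdDiff (φ.symm ρ) s ℓ
      = ∑ ℓ ∈ T, (starRingEnd ℂ) (fwdDiff (φ.symm σ) s ℓ) * fwdDiff (φ.symm ρ) s ℓ := fun ρ σ =>
    tsum_eq_sum fun k hk => by rw [hT ρ k hk, mul_zero]
  have hre := stability_of_additive φ R V hstab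
    { toFun := vecRe, map_zero' := by ext i; simp [vecRe],
      map_add' := fun v w => by ext i; simp [vecRe] } s a T hT
  have him := stability_of_additive φ R V hstab
    { toFun := vecIm, map_zero' := by ext i; simp [vecIm],
      map_add' := fun v w => by ext i; simp [vecIm] } s a T hT
  simp only [AddMonoidHom.coe_mk, ZeroHom.coe_mk] at hre him
  have key := add_le_add hre him
  rw [← mul_add, ← Finset.sum_add_distrib, ← Finset.sum_add_distrib] at key
  simp only [← Finset.sum_add_distrib, norm_sq_vecRe_add, hessZero_vecRe_add_vecIm] at key
  simp only [hsum]
  have hl : ‖a‖ ^ 2 * ∑ ρ : R, (∑ ℓ ∈ T, (starRingEnd ℂ) (fwdDiff (φ.symm ρ) s ℓ) *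
      fwdDiff (φ.symm ρ) s ℓ).re = ∑ k ∈ T, ∑ ρ : R, ‖fwdDiff (φ.symm ρ) s k • a‖ ^ 2 := by
    rw [Finset.sum_comm, Finset.mul_sum]
    refine Finset.sum_congr rfl fun ρ _ => ?_
    rw [Complex.re_sum, Finset.mul_sum]
    refine Finset.sum_congr rfl fun k _ => ?_
    rw [← Complex.normSq_eq_conj_mul_self, Complex.ofReal_re, Complex.normSq_eq_norm_sq, norm_smul]
    ring
  have hrt : ∑ ρ : R, ∑ σ : R, (∑ ℓ ∈ T, (starRingEnd ℂ) (fwdDiff (φ.symm σ) s ℓ) *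
      fwdDiff (φ.symm ρ) s ℓ) * inner ℂ a (hessOp V ρ σ a)
      = ∑ k ∈ T, ∑ ρ : R, ∑ σ : R, ((starRingEnd ℂ) (fwdDiff (φ.symm σ) s k) *
        fwdDiff (φ.symm ρ) s k) * inner ℂ a (hessOp V ρ σ a) := by
    symm
    rw [Finset.sum_comm]
    refine Finset.sum_congr rfl fun ρ _ => ?_
    rw [Finset.sum_comm]
    exact Finset.sum_congr rfl fun σ _ => (Finset.sum_mul _ _ _).symm
  rw [hl, hrt, Complex.re_sum]
  exact key

end linearisedForce

end

/-! ### Assembly of the estimate on the Bravais lattice -/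

theorem zpow_eq_inv_pow_of_add_eq_zero {x : ℝ} {m : ℤ} {n : ℕ} (h : m + n = 0) :
    x ^ m = (x ^ n)⁻¹ := by
  rw [eq_neg_of_add_eq_zero_left h, zpow_neg, zpow_natCast]

theorem two_le_modulus₀ {d : ℕ} {A : Matrix (Fin d) (Fin d) ℝ} (ℓ : bravaisLattice A) :
    2 ≤ modulus₀ ℓ := by
  have := norm_nonneg (ℓ : EuclideanSpace ℝ (Fin d))
  unfold modulus₀
  linarith

/-- Decay of a single iterated difference of the solution. -/
theorem exists_iterDiff_decay {d N : ℕ} (hd : 2 ≤ d)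
    (A : Matrix (Fin d) (Fin d) ℝ) (hA : A.det ≠ 0) (R : Finset (bravaisLattice A))
    (hRspan : AddSubgroup.closure (R : Set (bravaisLattice A)) = ⊤)
    (V : (R → EuclideanSpace ℝ (Fin N)) → ℝ) (hstable : LatticeStable R V)
    (p α j : ℕ) (hj : 1 ≤ j) (ρ : Fin j → R) :
    ∃ C : ℝ, ∀ u : bravaisLattice A → EuclideanSpace ℝ (Fin N), MemH1 R u →
      ∀ K : ℝ, 0 ≤ K →
        (∀ ℓ, ‖linForce R V u ℓ‖ ≤
          K * ((modulus₀ ℓ ^ (d + p))⁻¹ * Real.log (modulus₀ ℓ) ^ α)) →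
        (∀ i < p, forceMoment i (linForce R V u) = 0) →
        (∀ m, 1 ≤ m → m + 2 ≤ j → ∀ ℓ, stencilNorm R m (linForce R V u) ℓ ≤
          K * ((modulus₀ ℓ ^ (d + (p + m)))⁻¹ * Real.log (modulus₀ ℓ) ^ α)) →
        ∀ ℓ, ‖iterDiff j (fun i => (ρ i : bravaisLattice A)) u ℓ‖ ≤
          C * K * ((modulus₀ ℓ ^ (d - 2 + j + p))⁻¹ * Real.log (modulus₀ ℓ) ^ (α + 1)) := by
  set φ := latticeEquiv hA
  obtain ⟨c, hc, hcmp⟩ := exists_norm_compare hA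
  have hco := symbolCoercive_of_latticeStable φ R V hRspan hstable
  obtain ⟨C, hC, hmain⟩ := ldiff_decay hd hco p α (List.ofFn ρ) (by simpa using hj)
  have htwo : ∀ k : Fin d → ℤ, 2 ≤ ‖k‖ + 2 := fun k => by linarith [norm_nonneg k]
  -- An upper bound for all weight exponents in the hypotheses and the conclusion.
  set M := d + p + j
  set B := fun β : ℕ => c ^ M * (1 + Real.log c / Real.log 2) ^ β
  have hlc : 0 ≤ Real.log c / Real.log 2 :=
    div_nonneg (Real.log_nonneg hc) (Real.log_nonneg (by norm_num))
  have hB : ∀ β, 0 ≤ B β := fun β => mul_nonneg (pow_nonneg (by linarith) _)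
    (pow_nonneg (by linarith) _)
  -- `B α` converts the hypotheses to weights on `ℤᵈ`; `B (α + 1)` converts the conclusion back.
  refine ⟨C * B α * B (α + 1), fun u hu K hK hf hmom hDf ℓ => ?_⟩
  have hin : ∀ n ≤ M, ∀ k x, x ≤ K * ((modulus₀ (φ k) ^ n)⁻¹ * Real.log (modulus₀ (φ k)) ^ α) →
      x ≤ K * B α * (((‖k‖ + 2) ^ n)⁻¹ * Real.log (‖k‖ + 2) ^ α) := fun n hn k x hx => by
    rw [mul_assoc]
    exact hx.trans (mul_le_mul_of_nonneg_left
      (weight_compare hc hn α (two_le_modulus₀ _) (htwo k) (hcmp k).1 (hcmp k).2) hK)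
  have hf' : ∀ k, ‖linForce R V u (φ k)‖
      ≤ K * B α * (((‖k‖ + 2) ^ (d + p))⁻¹ * Real.log (‖k‖ + 2) ^ α) := fun k =>
    hin _ (by omega) k _ (hf (φ k))
  have hlat : latOp (fun ρ : R => φ.symm ρ) (hessOp V) (fun k => complexify N (u (φ k)))
      = fun k => complexify N (linForce R V u (φ k)) := funext (latOp_complexify φ R V u)
  have hldiff : ∀ (n : ℕ) (s : Fin n → R) (w : bravaisLattice A → EuclideanSpace ℝ (Fin N))
      (k : Fin d → ℤ), ‖ldiff ((List.ofFn s).map fun ρ : R => φ.symm ρ)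
        (fun k => complexify N (w (φ k))) k‖
        = ‖iterDiff n (fun i => (s i : bravaisLattice A)) w (φ k)‖ := fun n s w k => by
    have h1 := ldiff_comp_addHom (complexify N).toLinearMap.toAddMonoidHom
      ((List.ofFn s).map fun ρ : R => φ.symm ρ) (fun k => w (φ k)) k
    have h2 := ldiff_comp_addEquiv φ ((List.ofFn s).map fun ρ : R => φ.symm ρ) w k
    rw [iterDiff_eq_ldiff]
    refine (congrArg norm h1).trans (((complexify N).norm_map _).trans ?_)
    rw [h2]
    simp [List.map_ofFn, Function.comp_def]
  have h := hmain (fun k => complexify N (u (φ k)))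
    (summable_sq_fwdDiff_complexify φ R hu) (K * B α) (mul_nonneg hK (hB α))
    (fun k => by simpa only [hlat, LinearIsometry.norm_map] using hf' k)
    (fun q hq => by
      have h1 := hasSum_polyLT_smul hA (by omega) hf' hmom hq
      have h2 := h1.mapL (complexify N).toContinuousLinearMap
      rw [hlat]
      simpa using h2.tsum_eq)
    (fun L' h1 h2 k => by
      rw [hlat, ← List.ofFn_get L', hldiff]
      rw [List.length_ofFn] at h2 ⊢
      exact hin _ (by omega) k _ ((norm_iterDiff_le_stencilNorm R _ _ _ _).trans
        (hDf _ h1 h2 (φ k))))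
    (φ.symm ℓ)
  rw [hldiff, AddEquiv.apply_symm_apply, List.length_ofFn] at h
  have hw := weight_compare hc (show d - 2 + j + p ≤ M by omega) (α + 1) (htwo (φ.symm ℓ))
    (two_le_modulus₀ (φ (φ.symm ℓ))) (hcmp _).2 (hcmp _).1
  rw [AddEquiv.apply_symm_apply] at hw
  refine (h.trans (mul_le_mul_of_nonneg_left hw
    (mul_nonneg hC (mul_nonneg hK (hB α))))).trans_eq ?_
  ring

theorem mainTheorem3 {d N : ℕ} (hd : 2 ≤ d)
    (A : Matrix (Fin d) (Fin d) ℝ) (hA : A.det ≠ 0)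
    (R : Finset (bravaisLattice A))
    (hR0 : (0 : bravaisLattice A) ∉ R)
    (hRneg : ∀ ρ ∈ R, -ρ ∈ R)
    (hRspan : AddSubgroup.closure (R : Set (bravaisLattice A)) = ⊤)
    (V : (R → EuclideanSpace ℝ (Fin N)) → ℝ)
    (hV : ContDiff ℝ 2 V)
    (hVsymm : ∀ B : R → EuclideanSpace ℝ (Fin N),
      V B = V fun ρ => -B ⟨-(ρ : bravaisLattice A), hRneg ρ ρ.2⟩)
    (hstable : LatticeStable R V)
    (p α j : ℕ) (hj : 1 ≤ j) :
    ∃ C : ℝ, ∀ u : bravaisLattice A → EuclideanSpace ℝ (Fin N), MemH1 R u →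
      ∀ K : ℝ,
        (∀ ℓ, ‖linForce R V u ℓ‖ ≤
          K * modulus₀ ℓ ^ (-(d : ℤ) - p) * Real.log (modulus₀ ℓ) ^ α) →
        (∀ i < p, forceMoment i (linForce R V u) = 0) →
        -- the next hypothesis is void for `j = 1, 2`
        (∀ m, 1 ≤ m → m + 2 ≤ j → ∀ ℓ, stencilNorm R m (linForce R V u) ℓ ≤
          K * modulus₀ ℓ ^ (-(d : ℤ) - p - m) * Real.log (modulus₀ ℓ) ^ α) →
        ∀ ℓ, stencilNorm R j u ℓ ≤
          C * K * modulus₀ ℓ ^ (2 - (d : ℤ) - p - j) * Real.log (modulus₀ ℓ) ^ (α + 1) := by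
  choose C hC using exists_iterDiff_decay hd A hA R hRspan V hstable p α j hj
  refine ⟨∑ ρ, C ρ, fun u hu K hf hmom hDf ℓ => ?_⟩
  -- The weight is positive, so the force bound at a single point forces `K ≥ 0`.
  have hpos : 0 < modulus₀ ℓ ^ (-(d : ℤ) - p) * Real.log (modulus₀ ℓ) ^ α := by
    have h2 := two_le_modulus₀ ℓ
    exact mul_pos (zpow_pos (by linarith) _) (pow_pos (Real.log_pos (by linarith)) _)
  have hK : 0 ≤ K := by
    have h := (norm_nonneg _).trans (hf ℓ)
    rw [mul_assoc] at h
    exact nonneg_of_mul_nonneg_left h hpos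
  refine (stencilNorm_le_sum R j u ℓ).trans ((Finset.sum_le_sum fun ρ _ =>
    hC ρ u hu K hK (fun ℓ => ?_) hmom (fun m h1 h2 ℓ => ?_) ℓ).trans_eq ?_)
  · rw [← zpow_eq_inv_pow_of_add_eq_zero (m := -(d : ℤ) - p) (by push_cast; ring), ← mul_assoc]
    exact hf ℓ
  · rw [← zpow_eq_inv_pow_of_add_eq_zero (m := -(d : ℤ) - p - m) (by push_cast; ring), ← mul_assoc]
    exact hDf m h1 h2 ℓ
  · rw [← Finset.sum_mul, ← Finset.sum_mul,
      ← zpow_eq_inv_pow_of_add_eq_zero (m := 2 - (d : ℤ) - p - j)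
        (by push_cast [Nat.cast_sub hd]; ring), ← mul_assoc]
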